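/- Let $\alpha,L>0$. Write $\operatorname{mod}(x,L)\in[0,L)$ for the residue of $x$ modulo $L$ and let $$K(x)=\frac{1}{2(1-e^{-L/\alpha})}\left[e^{-\operatorname{mod}(x,L)/\alpha}+e^{-L/\alpha}e^{\operatorname{mod}(x,L)/\alpha}\right],\qquad K*f(x)=\frac1\alpha\int_0^L K(x-y)f(y)\,dy ,$$ so that $f\mapsto K*f$ is the inverse of $1-\alpha^2\partial_{xx}$ on the circle of length $L$. Let $K'$ be the derivative of $K$ off $L\mathbb Z$, with the convention $K'=0$ on $L\mathbb Z$. $H^1$ denotes the Sobolev space of the circle of length $L$ (the periodic interval $[0,L]$). Let $(\Omega,\mathcal F,(\mathcal F_t)_{t\ge0},\mathbb P)$ be a filtered probability space, $(W^j)_{j}$ a finite family of $(\mathcal F_t)$-Brownian motions with continuous paths (not assumed independent), $\tau\in[0,\infty]$ an $(\mathcal F_t)$-stopping time, and $(\Xi^j)_j$ real $L$-periodic $C^2$ functions on $\mathbb R$ (for example constants, Fourier modes $\xi[C\cos(2\pi jx/L)+D\sin(2\pi jx/L)]$, and finite linear combinations of these). Stratonovich integrals are $\int Y\circ dW=\int Y\,dW+\frac12[Y,W]$,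 where, for continuous adapted $Y$, the Itô integral $\int Y\,dW$ is the limit of left-point Riemann sums and $[Y,W]$ is the limit of the sums of products of increments, both uniformly on $[0,T\wedge\tau]$ in probability for every $T$, as the mesh of the partition of $[0,T]$ tends to $0$. Let $(p_k,q_k)_k$ be finitely many pairs of real processes which, stopped at $\tau$, are continuous semimartingales and which satisfy on $[0,\tau]$ $$dp_k=-p_k\sum_l p_l\,K'(q_k-q_l)\,dt-p_k\sum_j\Xi^j_x(q_k)\circ dW^j,\qquad dq_k=\sum_l p_l\,K(q_k-q_l)\,dt+\sum_j\Xi^j(q_k)\circ dW^j .$$ Put $u(x,t)=\sum_k p_k(t)K(x-q_k(t))$. Then the following hold. (1) $u$ is, on $[0,\tau]$, a weak solution of the hydrodynamic stochastic Camassa–Holm equation on the periodic interval $[0,L]$: $u(\cdot,t)\in H^1$ for all $t\le\tau$, with weak derivative $u_x$, and for every $\phi\in H^1$ the process $t\mapsto\int_0^L\phi\,u(\cdot,t)\,dx$ is continuous and adapted on $[0,\tau]$, all the integrals below exist, and, almost surely, for all $t\le\tau$, $$\int_0^L\phi\,\bigl(u(x,t)-u(x,0)\bigr)\,dx=\int_0^t\!\int_0^L\phi_x\Bigl\{\tfrac12u^2+K*\bigl[u^2+\tfrac{\alpha^2}{2}u_x^2\bigr]\Bigr\}dx\,ds-\sum_j\int_0^t\Bigl(\int_0^L\phi\,\bigl\{u_x\Xi^j+K*[2u\,\Xi^j_x+\alpha^2u_x\Xi^j_{xx}]\bigr\}dx\Bigr)\circ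 dW^j_s .$$ (2) For all $P,Q\in\mathbb R$, all $j$, and all $x\notin Q+L\mathbb Z$, the single peakon $v(x)=P\,K(x-Q)$ satisfies $$K*\bigl(2v\,\Xi^j_x+\alpha^2v_x\Xi^j_{xx}\bigr)(x)=v(x)\,\Xi^j_x(Q)+v_x(x)\,\Xi^j(Q)-v_x(x)\,\Xi^j(x).$$ (3) Consequently, for all finite families of reals $(P_k,Q_k)_k$ and all $j$, with $v^k(x)=P_kK(x-Q_k)$ and $v=\sum_kv^k$, for almost every $x$, $$\sum_k\bigl[v^k\,\Xi^j_x(Q_k)+v^k_x\,\Xi^j(Q_k)\bigr]-v_x\,\Xi^j-K*\bigl(2v\,\Xi^j_x+\alpha^2v_x\Xi^j_{xx}\bigr)=0 .$$ -/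

import Mathlib

open MeasureTheory ProbabilityTheory Filter Topology
open scoped NNReal ENNReal

namespace SCH

noncomputable section

/-! ### The periodic Green's function and Sobolev space -/

/-- The representative of `x` modulo `L` in `[0, L)` (for `L > 0`). -/
def pmod (L x : ℝ) : ℝ := x - L * (⌊x / L⌋ : ℝ)

/-- The `L`-periodic kernel
`K(x) = (e^{-mod(x,L)/α} + e^{-L/α} e^{mod(x,L)/α}) / (2 (1 - e^{-L/α}))`. -/
def greenK (α L x : ℝ) : ℝ :=
  (1 / (2 * (1 - Real.exp (-L / α)))) *
    (Real.exp (-pmod L x / α) + Real.exp (-L / α) * Real.exp (pmod L x / α))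

/-- The spatial derivative of `greenK`, with value `0` (the mean of the two one-sided derivatives)
at the peaks `x ∈ Lℤ`; this is the convention `sign 0 = 0`. -/
def greenKx (α L x : ℝ) : ℝ :=
  if pmod L x = 0 then 0 else
    (1 / (2 * α * (1 - Real.exp (-L / α)))) *
      (-Real.exp (-pmod L x / α) + Real.exp (-L / α) * Real.exp (pmod L x / α))

/-- The operator `f ↦ K ∗ f`, the inverse of `1 - α² ∂_xx` on the circle of length `L`;
its integral kernel is `K / α`, because `(1 - α² ∂_xx) K = α δ`. -/
def greenConv (α L : ℝ) (f : ℝ → ℝ) (x : ℝ) : ℝ :=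
  (1 / α) * ∫ y in (0 : ℝ)..L, greenK α L (x - y) * f y

/-- `f ∈ H¹` of the circle of length `L`, with weak derivative `g`: both are square integrable over
a period and `∫ f ψ' = - ∫ g ψ` for all smooth `L`-periodic `ψ`. Only the restrictions of `f` and
`g` to `(0, L]` matter. -/
structure HasPeriodicWeakDeriv (L : ℝ) (f g : ℝ → ℝ) : Prop where
  memLp : MemLp f 2 (volume.restrict (Set.Ioc 0 L))
  memLp_deriv : MemLp g 2 (volume.restrict (Set.Ioc 0 L))
  integral_eq : ∀ ψ : ℝ → ℝ, ContDiff ℝ ((⊤ : ℕ∞) : WithTop ℕ∞) ψ → Function.Periodic ψ L →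
    ∫ x in (0 : ℝ)..L, f x * deriv ψ x = -∫ x in (0 : ℝ)..L, g x * ψ x

/-! ### Stochastic calculus along continuous adapted processes -/

variable {Ω : Type*} [mΩ : MeasurableSpace Ω]

/-- `W` is a standard one-dimensional Brownian motion relative to the filtration `ℱ`. -/
structure IsFiltrationBrownian (ℱ : Filtration ℝ≥0 mΩ) (μ : Measure Ω) (W : ℝ≥0 → Ω → ℝ) :
    Prop where
  isBrownian : IsBrownianReal W μ
  continuous_paths : ∀ ω, Continuous fun t => W t ω
  adapted : StronglyAdapted ℱ W
  indep : ∀ s t : ℝ≥0, s ≤ t →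
    Indep (MeasurableSpace.comap (fun ω => W t ω - W s ω) inferInstance) (ℱ s) μ

/-- `X` is a continuous `ℱ`-semimartingale: a continuous local martingale plus a continuous adapted
process with paths of locally bounded variation (the latter carries the initial value). -/
def IsContSemimartingale (ℱ : Filtration ℝ≥0 mΩ) (μ : Measure Ω) (X : ℝ≥0 → Ω → ℝ) : Prop :=
  ∃ M A : ℝ≥0 → Ω → ℝ,
    StronglyAdapted ℱ M ∧ (∀ ω, Continuous fun t => M t ω) ∧
    Locally (fun N => Martingale N ℱ μ) ℱ M μ ∧
    StronglyAdapted ℱ A ∧ (∀ ω, Continuous fun t => A t ω) ∧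
    (∀ ω, LocallyBoundedVariationOn (fun t => A t ω) Set.univ) ∧
    ∀ t ω, X t ω = M t ω + A t ω

/-- `Y`, stopped at `τ`, is a continuous adapted process. -/
def IsContAdaptedUpTo (ℱ : Filtration ℝ≥0 mΩ) (τ : Ω → WithTop ℝ≥0) (Y : ℝ≥0 → Ω → ℝ) : Prop :=
  StronglyAdapted ℱ (stoppedProcess Y τ) ∧ ∀ ω, Continuous fun t => stoppedProcess Y τ t ω

/-- `0 = σ 0 ≤ σ 1 ≤ … ≤ σ N = T` is a partition of `[0, T]` with mesh at most `δ`. -/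
structure IsPartition (T : ℝ≥0) (δ : ℝ) (N : ℕ) (σ : ℕ → ℝ≥0) : Prop where
  mono : Monotone σ
  left : σ 0 = 0
  right : σ N = T
  mesh : ∀ i < N, (σ (i + 1) : ℝ) - σ i ≤ δ

/-- The sums `S N σ` attached to partitions converge to `I`, as the mesh tends to `0`, uniformly on
`[0, T ∧ τ]` in probability, for every `T`. -/
def TendstoUcp (μ : Measure Ω) (τ : Ω → WithTop ℝ≥0)
    (S : ℕ → (ℕ → ℝ≥0) → ℝ≥0 → Ω → ℝ) (I : ℝ≥0 → Ω → ℝ) : Prop :=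
  ∀ (T : ℝ≥0) (ε : ℝ), 0 < ε → ∀ η : ℝ≥0∞, 0 < η → ∃ δ : ℝ, 0 < δ ∧
    ∀ (N : ℕ) (σ : ℕ → ℝ≥0), IsPartition T δ N σ →
      μ {ω | ∃ t : ℝ≥0, t ≤ T ∧ (t : WithTop ℝ≥0) ≤ τ ω ∧ ε ≤ |S N σ t ω - I t ω|} ≤ η

/-- Left-point sums `∑ Y_{σ_i} (W_{σ_{i+1} ∧ t} - W_{σ_i ∧ t})`. -/
def leftSum (Y W : ℝ≥0 → Ω → ℝ) (N : ℕ) (σ : ℕ → ℝ≥0) (t : ℝ≥0) (ω : Ω) : ℝ :=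
  ∑ i ∈ Finset.range N, Y (min (σ i) t) ω * (W (min (σ (i + 1)) t) ω - W (min (σ i) t) ω)

/-- Sums of products of increments
`∑ (Y_{σ_{i+1} ∧ t} - Y_{σ_i ∧ t}) (W_{σ_{i+1} ∧ t} - W_{σ_i ∧ t})`. -/
def covSum (Y W : ℝ≥0 → Ω → ℝ) (N : ℕ) (σ : ℕ → ℝ≥0) (t : ℝ≥0) (ω : Ω) : ℝ :=
  ∑ i ∈ Finset.range N, (Y (min (σ (i + 1)) t) ω - Y (min (σ i) t) ω) *
    (W (min (σ (i + 1)) t) ω - W (min (σ i) t) ω)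

/-- `I` is the Itô integral `∫₀ᵗ Y dW` on `[0, τ]` of the continuous adapted process `Y`. -/
def IsItoIntegral (ℱ : Filtration ℝ≥0 mΩ) (μ : Measure Ω) (τ : Ω → WithTop ℝ≥0)
    (Y W I : ℝ≥0 → Ω → ℝ) : Prop :=
  IsContAdaptedUpTo ℱ τ Y ∧ TendstoUcp μ τ (leftSum Y W) I

/-- `C` is the quadratic covariation `[Y, W]` on `[0, τ]`. -/
def IsCovariation (μ : Measure Ω) (τ : Ω → WithTop ℝ≥0) (Y W C : ℝ≥0 → Ω → ℝ) : Prop :=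
  TendstoUcp μ τ (covSum Y W) C

/-- `I` is the Stratonovich integral `∫₀ᵗ Y ∘ dW = ∫₀ᵗ Y dW + ½ [Y, W]_t` on `[0, τ]`. -/
def IsStratonovichIntegral (ℱ : Filtration ℝ≥0 mΩ) (μ : Measure Ω) (τ : Ω → WithTop ℝ≥0)
    (Y W I : ℝ≥0 → Ω → ℝ) : Prop :=
  ∃ J C : ℝ≥0 → Ω → ℝ, IsItoIntegral ℱ μ τ Y W J ∧ IsCovariation μ τ Y W C ∧
    ∀ t ω, I t ω = J t ω + 1 / 2 * C t ω

/-! ### Peakons and the stochastic Camassa-Holm equation -/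

variable {ι κ : Type*} [Fintype ι] [Fintype κ]

/-- A single periodic peakon `x ↦ P K(x - Q)`. -/
def peakon (α L P Q x : ℝ) : ℝ := P * greenK α L (x - Q)

/-- The superposition of peakons `u(x, t) = ∑ₖ pₖ(t) K(x - qₖ(t))`. -/
def multiPeakon (α L : ℝ) (p q : κ → ℝ≥0 → Ω → ℝ) (t : ℝ≥0) (ω : Ω) (x : ℝ) : ℝ :=
  ∑ k, peakon α L (p k t ω) (q k t ω) x

/-- On `[0, τ]`, the continuous semimartingales `(pₖ, qₖ)` solve the Stratonovich equations
`dpₖ = -pₖ ∑ₗ pₗ K'(qₖ - qₗ) dt - pₖ ∑ⱼ Ξʲₓ(qₖ) ∘ dWʲ` and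
`dqₖ = ∑ₗ pₗ K(qₖ - qₗ) dt + ∑ⱼ Ξʲ(qₖ) ∘ dWʲ`. -/
structure IsPeakonSolution (ℱ : Filtration ℝ≥0 mΩ) (μ : Measure Ω) (α L : ℝ)
    (Ξ : ι → ℝ → ℝ) (W : ι → ℝ≥0 → Ω → ℝ) (τ : Ω → WithTop ℝ≥0)
    (p q : κ → ℝ≥0 → Ω → ℝ) : Prop where
  semimartingale_p : ∀ k, IsContSemimartingale ℱ μ (stoppedProcess (p k) τ)
  semimartingale_q : ∀ k, IsContSemimartingale ℱ μ (stoppedProcess (q k) τ)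
  momentum : ∀ k, ∃ I : ι → ℝ≥0 → Ω → ℝ,
    (∀ j, IsStratonovichIntegral ℱ μ τ
      (fun t ω => p k t ω * deriv (Ξ j) (q k t ω)) (W j) (I j)) ∧
    ∀ᵐ ω ∂μ, ∀ t : ℝ≥0, (t : WithTop ℝ≥0) ≤ τ ω →
      p k t ω = p k 0 ω
        - (∫ s in (0 : ℝ)..t, p k s.toNNReal ω *
            ∑ l, p l s.toNNReal ω * greenKx α L (q k s.toNNReal ω - q l s.toNNReal ω))
        - ∑ j, I j t ω
  position : ∀ k, ∃ I : ι → ℝ≥0 → Ω → ℝ,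
    (∀ j, IsStratonovichIntegral ℱ μ τ (fun t ω => Ξ j (q k t ω)) (W j) (I j)) ∧
    ∀ᵐ ω ∂μ, ∀ t : ℝ≥0, (t : WithTop ℝ≥0) ≤ τ ω →
      q k t ω = q k 0 ω
        + (∫ s in (0 : ℝ)..t,
            ∑ l, p l s.toNNReal ω * greenK α L (q k s.toNNReal ω - q l s.toNNReal ω))
        + ∑ j, I j t ω

/-- The flux `½ u² + K ∗ [u² + (α²/2) uₓ²]`, for a profile `v` with weak derivative `vx`. -/
def flux (α L : ℝ) (v vx : ℝ → ℝ) (x : ℝ) : ℝ :=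
  1 / 2 * v x ^ 2 + greenConv α L (fun y => v y ^ 2 + α ^ 2 / 2 * vx y ^ 2) x

/-- The noise coefficient `uₓ Ξ + K ∗ [2 u Ξₓ + α² uₓ Ξₓₓ]`, for a profile `v` with weak
derivative `vx`. -/
def noiseCoeff (α L : ℝ) (ξ v vx : ℝ → ℝ) (x : ℝ) : ℝ :=
  vx x * ξ x +
    greenConv α L (fun y => 2 * v y * deriv ξ y + α ^ 2 * vx y * deriv (deriv ξ) y) x

/-- The random field `u` is, on `[0, τ]`, a weak solution of the hydrodynamic stochastic
Camassa-Holm equation on the circle of length `L`: it takes values in `H¹`, and for all `φ ∈ H¹`,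
almost surely, for all `t ≤ τ`,
`∫ φ (u_t - u_0) dx = ∫₀ᵗ ∫ φₓ {½ u² + K ∗ [u² + (α²/2) uₓ²]} dx ds`
`  - ∑ⱼ ∫₀ᵗ (∫ φ {uₓ Ξʲ + K ∗ [2 u Ξʲₓ + α² uₓ Ξʲₓₓ]} dx) ∘ dWʲ`,
where all the integrals exist. -/
def IsWeakSolution (ℱ : Filtration ℝ≥0 mΩ) (μ : Measure Ω) (α L : ℝ)
    (Ξ : ι → ℝ → ℝ) (W : ι → ℝ≥0 → Ω → ℝ) (τ : Ω → WithTop ℝ≥0)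
    (u : ℝ≥0 → Ω → ℝ → ℝ) : Prop :=
  ∃ ux : ℝ≥0 → Ω → ℝ → ℝ,
    (∀ (t : ℝ≥0) (ω : Ω), (t : WithTop ℝ≥0) ≤ τ ω → HasPeriodicWeakDeriv L (u t ω) (ux t ω)) ∧
    ∀ φ φx : ℝ → ℝ, HasPeriodicWeakDeriv L φ φx →
      IsContAdaptedUpTo ℱ τ (fun t ω => ∫ x in (0 : ℝ)..L, φ x * u t ω x) ∧
      (∀ (t : ℝ≥0) (ω : Ω), (t : WithTop ℝ≥0) ≤ τ ω → IntervalIntegrable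
        (fun s : ℝ => ∫ x in (0 : ℝ)..L,
          φx x * flux α L (u s.toNNReal ω) (ux s.toNNReal ω) x) volume 0 t) ∧
      ∃ I : ι → ℝ≥0 → Ω → ℝ,
        (∀ j, IsStratonovichIntegral ℱ μ τ
          (fun t ω => ∫ x in (0 : ℝ)..L, φ x * noiseCoeff α L (Ξ j) (u t ω) (ux t ω) x)
          (W j) (I j)) ∧
        ∀ᵐ ω ∂μ, ∀ t : ℝ≥0, (t : WithTop ℝ≥0) ≤ τ ω →
          ∫ x in (0 : ℝ)..L, φ x * (u t ω x - u 0 ω x) =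
            (∫ s in (0 : ℝ)..t, ∫ x in (0 : ℝ)..L,
              φx x * flux α L (u s.toNNReal ω) (ux s.toNNReal ω) x)
            - ∑ j, I j t ω

end

end SCH

/-!
The spatial variable is eliminated first. A test function `φ` of class `H¹` has a periodic, absolutely
continuous representative `Φ` (`HasPeriodicWeakDeriv.exists_primitive`), and its pairing with the unit
peakon, `F(q) = ∫ Φ(x) K(x - q) dx`, solves `F - α² F'' = α Φ`; in particular it is of class `C²`
(`contDiff_pairing`), although `K` has a corner. Hence `∫ φ u dx = ∑ₖ pₖ F(qₖ)`, and the weak form of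
the equation is the Stratonovich chain rule for this expression, provided that

* the flux of a superposition of peakons, tested against `φ'`, is the drift
  `∑ₖ (F(qₖ) βₖ + pₖ F'(qₖ) γₖ)`, where `βₖ`, `γₖ` are the drifts of `pₖ`, `qₖ` (`integral_mul_flux`),
* the noise coefficient `u_x Ξ + K * (2 u Ξ_x + α² u_x Ξ_xx)` of a superposition of peakons is
  `∑ₖ (Ξ_x(qₖ) uᵏ + Ξ(qₖ) uᵏ_x)` (`noiseCoeff_eq`), which follows from the convolution identity for a
  single peakon (`greenConv_peakonSource`).

Both identities have the same proof: the circle is cut at the peaks, on each arc `K` is a combination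
of the exponentials `e^{±x/α}` and the integrand is an exact derivative, and the boundary terms are
evaluated by means of the jump of `K'` at its corner (`IsPeriodicPrimitive.integral_flux_piece`,
`integral_kerA_mul_source`). For two peakons the flux identity is symmetric in the pair, and the double
sum over all pairs is symmetrized.

The Stratonovich calculus is developed for the approximating sums, and limits are taken only at the
end, so that Itô's formula is not needed. `Small` and `Bdd` mean convergence to
zero, respectively boundedness, in probability, uniformly on `[0, T ∧ τ]`. The processes that may
serve as integrators are the good integrators: continuous adapted processes whose sums
`∑ H_{σ_n} (X_{σ_{n+1}} - X_{σ_n})` over adapted `H` with `|H| ≤ 1` are bounded in probability,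
uniformly in `H`. Brownian motions and continuous semimartingales are good integrators, by a weak-type
inequality for martingale transforms (`measure_martingale_transform_ge_le`), localization, and the
measurability of the total variation (`IsContSemimartingale.isGoodIntegrator`).

The central device is to replace an integrand by its average over `[t - h, t]`, with `h → 0` after the
mesh of the partition. The error is small against every good integrator, and the averaged integrand
is differentiable in time, so that its sums can be summed by parts. This gives

* the existence of the Itô integrals and covariations, hence of the Stratonovich integrals in the
  weak formulation (`IsGoodIntegrator.exists_tendstoUcp_leftSum`, `exists_tendstoUcp_covSum`),
* the associativity `Z ∘ (b dt + ∑ⱼ Yⱼ ∘ dWʲ) = Z b dt + ∑ⱼ (Z Yⱼ) ∘ dWʲ` (`small_trapSum_sub`).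

The chain rule `d(p F(q)) = F(q) ∘ dp + p F'(q) ∘ dq` (`small_mul_comp_sub_trapSum`) expresses that the
trapezoidal rule for a `C²` function is exact up to `o((y - x)²)`. Together they yield the equation of
`∑ₖ pₖ F(qₖ)` (`small_sum_mul_comp_sub`), and the two spatial identities turn it into the weak form of
the stochastic Camassa–Holm equation (`isWeakSolution_multiPeakon`).
-/

namespace SCH

noncomputable section

/-! ### A weak-type inequality for discrete martingale transforms -/

section DiscreteMartingale

variable {Ω : Type*} {m0 : MeasurableSpace Ω} {μ : Measure Ω}

lemma memLp_top_of_abs_le [IsFiniteMeasure μ] {g : Ω → ℝ} (hg : AEStronglyMeasurable g μ) {c : ℝ}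
    (h : ∀ ω, |g ω| ≤ c) : MemLp g ∞ μ :=
  memLp_top_of_bound hg c (ae_of_all _ h)

lemma integral_mul_condExp_of_bdd [IsFiniteMeasure μ] {m : MeasurableSpace Ω} (hm : m ≤ m0)
    {X g : Ω → ℝ} (hX : StronglyMeasurable[m] X) (hXb : MemLp X ∞ μ) (hg : MemLp g ∞ μ) :
    ∫ ω, X ω * (μ[g|m]) ω ∂μ = ∫ ω, X ω * g ω ∂μ := by
  have h1 : Integrable (X * g) μ := (hg.mul hXb (r := ∞)).integrable le_top
  have h2 := condExp_mul_of_stronglyMeasurable_left hX h1 (hg.integrable le_top)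
  rw [← integral_condExp hm (f := fun ω => X ω * g ω)]
  exact integral_congr_ae h2.symm

lemma integral_add_const_mul_add {a b c : Ω → ℝ} (ha : Integrable a μ) (hb : Integrable b μ)
    (hc : Integrable c μ) (k : ℝ) :
    ∫ ω, (a ω + k * b ω + c ω) ∂μ = ∫ ω, a ω ∂μ + k * ∫ ω, b ω ∂μ + ∫ ω, c ω ∂μ := by
  have h1 : Integrable (fun ω => a ω + k * b ω) μ := ha.add (hb.const_mul k)
  rw [integral_add h1 hc, integral_add ha (hb.const_mul k), integral_const_mul]

/-- Doob's weak-type maximal inequality, with the running maximum written as an existential. -/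
lemma measure_exists_ge_le_of_submartingale [IsFiniteMeasure μ] {𝒢 : Filtration ℕ m0}
    {g : ℕ → Ω → ℝ} (hg : Submartingale g 𝒢 μ) (h0 : 0 ≤ g) {c : ℝ} (hc : 0 < c) (m : ℕ) :
    μ {ω | ∃ n ≤ m, c ≤ g n ω} ≤ ENNReal.ofReal ((∫ ω, g m ω ∂μ) / c) := by
  have h := maximal_ineq hg h0 (ε := c.toNNReal) m
  have hset : {ω | ((c.toNNReal : ℝ≥0) : ℝ) ≤
      (Finset.range (m + 1)).sup' Finset.nonempty_range_add_one fun k => g k ω}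
      = {ω | ∃ n ≤ m, c ≤ g n ω} := by
    ext ω
    simp only [Set.mem_ofPred_eq, Finset.le_sup'_iff, Finset.mem_range, Real.coe_toNNReal _ hc.le,
      Nat.lt_succ_iff]
  rw [hset] at h
  rw [ENNReal.ofReal_div_of_pos hc, ENNReal.le_div_iff_mul_le (by simp [hc]) (by simp), mul_comm]
  refine le_trans (le_of_eq ?_) (h.trans (ENNReal.ofReal_le_ofReal
    (setIntegral_le_integral (hg.integrable m) (ae_of_all _ (h0 m)))))
  rfl

variable {𝒢 : Filtration ℕ m0}

/-- The increment of `V` minus its conditional expectation given the past. -/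
def martingaleDiff (μ : Measure Ω) (𝒢 : Filtration ℕ m0) (V : ℕ → Ω → ℝ) (k : ℕ) : Ω → ℝ :=
  V (k + 1) - V k - μ[V (k + 1) - V k|𝒢 k]

section

variable [IsFiniteMeasure μ] {V H : ℕ → Ω → ℝ} {c : ℝ}

lemma memLp_top_incr (hV : StronglyAdapted 𝒢 V) (hVc : ∀ n ω, |V n ω| ≤ c) (k : ℕ) :
    MemLp (V (k + 1) - V k) ∞ μ :=
  (memLp_top_of_abs_le (((hV (k + 1)).mono (𝒢.le _)).aestronglyMeasurable) (hVc (k + 1))).sub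
    (memLp_top_of_abs_le (((hV k).mono (𝒢.le _)).aestronglyMeasurable) (hVc k))

lemma memLp_top_martingaleDiff (hV : StronglyAdapted 𝒢 V) (hVc : ∀ n ω, |V n ω| ≤ c) (k : ℕ) :
    MemLp (martingaleDiff μ 𝒢 V k) ∞ μ :=
  (memLp_top_incr hV hVc k).sub ((memLp_top_incr hV hVc k).condExp le_top)

lemma condExp_martingaleDiff (hV : StronglyAdapted 𝒢 V) (hVc : ∀ n ω, |V n ω| ≤ c) (k : ℕ) :
    μ[martingaleDiff μ 𝒢 V k|𝒢 k] =ᵐ[μ] 0 := by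
  have h1 := (memLp_top_incr (μ := μ) hV hVc k)
  have h2 := h1.condExp (m := 𝒢 k) le_top
  refine (condExp_sub (h1.integrable le_top) (h2.integrable le_top) (𝒢 k)).trans ?_
  rw [condExp_of_stronglyMeasurable (𝒢.le k) stronglyMeasurable_condExp (h2.integrable le_top)]
  simp

/-- Summed over `k`, this bounds the `L²` norm of the martingale part of a bounded process by its
final second moment and its total conditional drift in `L¹`. -/
lemma integral_sq_martingaleDiff_le (hV : StronglyAdapted 𝒢 V) (hVc : ∀ n ω, |V n ω| ≤ c)
    (k : ℕ) :
    ∫ ω, martingaleDiff μ 𝒢 V k ω ^ 2 ∂μ ≤ ∫ ω, V (k + 1) ω ^ 2 ∂μ - ∫ ω, V k ω ^ 2 ∂μ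
      + 2 * c * ∫ ω, |(μ[V (k + 1) - V k|𝒢 k]) ω| ∂μ := by
  have hD := (memLp_top_incr (μ := μ) hV hVc k)
  have hd := hD.condExp (m := 𝒢 k) le_top
  have hVk : ∀ k, MemLp (V k) ∞ μ := fun k =>
    memLp_top_of_abs_le (((hV k).mono (𝒢.le _)).aestronglyMeasurable) (hVc k)
  set D := V (k + 1) - V k with hDdef
  set d := μ[D|𝒢 k] with hddef
  have e1 : ∫ ω, d ω * d ω ∂μ = ∫ ω, d ω * D ω ∂μ :=
    integral_mul_condExp_of_bdd (𝒢.le k) stronglyMeasurable_condExp hd hD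
  have e2 : ∫ ω, V k ω * d ω ∂μ = ∫ ω, V k ω * D ω ∂μ :=
    integral_mul_condExp_of_bdd (𝒢.le k) (hV k) (hVk k) hD
  have mulI : ∀ {a b : Ω → ℝ}, MemLp a ∞ μ → MemLp b ∞ μ → Integrable (fun ω => a ω * b ω) μ :=
    fun ha hb => (hb.mul ha (r := ∞)).integrable le_top
  have e3 : ∫ ω, martingaleDiff μ 𝒢 V k ω ^ 2 ∂μ
      = ∫ ω, D ω * D ω ∂μ + (-2) * ∫ ω, d ω * D ω ∂μ + ∫ ω, d ω * d ω ∂μ := by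
    rw [← integral_add_const_mul_add (mulI hD hD) (mulI hd hD) (mulI hd hd)]
    refine integral_congr_ae (ae_of_all _ fun ω => ?_)
    simp only [martingaleDiff, Pi.sub_apply]
    simp only [← hDdef, ← hddef]
    have : D ω = V (k + 1) ω - V k ω := rfl
    rw [this]; ring
  have e4 : ∫ ω, D ω * D ω ∂μ
      = ∫ ω, V (k + 1) ω ^ 2 ∂μ + (-1) * ∫ ω, V k ω ^ 2 ∂μ
        + ∫ ω, (-2 * V k ω) * D ω ∂μ := by
    have i1 : ∀ k, Integrable (fun ω => V k ω ^ 2) μ := fun k => by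
      simpa [sq] using mulI (hVk k) (hVk k)
    rw [← integral_add_const_mul_add (i1 _) (i1 _) (mulI ((hVk k).const_mul (-2)) hD)]
    refine integral_congr_ae (ae_of_all _ fun ω => ?_)
    have : D ω = V (k + 1) ω - V k ω := rfl
    simp only [this]; ring
  have e4' : ∫ ω, (-2 * V k ω) * D ω ∂μ = -2 * ∫ ω, V k ω * D ω ∂μ := by
    rw [← integral_const_mul]; simp only [mul_assoc]
  have e5 : 0 ≤ ∫ ω, d ω * d ω ∂μ := integral_nonneg fun ω => mul_self_nonneg _
  have e6 : -(∫ ω, V k ω * d ω ∂μ) ≤ c * ∫ ω, |d ω| ∂μ := by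
    rw [← integral_neg, ← integral_const_mul]
    refine integral_mono (mulI (hVk k) hd).neg ((hd.integrable le_top).abs.const_mul c) fun ω => ?_
    calc -(V k ω * d ω) ≤ |V k ω * d ω| := neg_le_abs _
      _ = |V k ω| * |d ω| := abs_mul _ _
      _ ≤ c * |d ω| := by gcongr; exact hVc k ω
  nlinarith

/-- The transform of the martingale part of a bounded process by a bounded adapted process. -/
lemma transform_martingaleDiff (hV : StronglyAdapted 𝒢 V) (hVc : ∀ n ω, |V n ω| ≤ c)
    (hH : StronglyAdapted 𝒢 H) (hH1 : ∀ n ω, |H n ω| ≤ 1) :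
    Martingale (fun n ω => ∑ k ∈ Finset.range n, H k ω * martingaleDiff μ 𝒢 V k ω) 𝒢 μ ∧
    ∀ n, MemLp (fun ω => ∑ k ∈ Finset.range n, H k ω * martingaleDiff μ 𝒢 V k ω) ∞ μ ∧
      ∫ ω, (∑ k ∈ Finset.range n, H k ω * martingaleDiff μ 𝒢 V k ω) ^ 2 ∂μ ≤
      ∫ ω, V n ω ^ 2 ∂μ + 2 * c * ∑ k ∈ Finset.range n, ∫ ω, |(μ[V (k + 1) - V k|𝒢 k]) ω| ∂μ := by
  have hHb : ∀ k, MemLp (H k) ∞ μ := fun k =>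
    memLp_top_of_abs_le (((hH k).mono (𝒢.le _)).aestronglyMeasurable) (hH1 k)
  have hG := fun k => memLp_top_martingaleDiff (μ := μ) hV hVc k
  have hHG : ∀ k, MemLp (fun ω => H k ω * martingaleDiff μ 𝒢 V k ω) ∞ μ := fun k =>
    (hG k).mul (hHb k) (r := ∞)
  have hS : ∀ n, MemLp (fun ω => ∑ k ∈ Finset.range n, H k ω * martingaleDiff μ 𝒢 V k ω) ∞ μ :=
    fun n => memLp_finsetSum _ fun k _ => hHG k
  have hGm : ∀ k n, k < n → StronglyMeasurable[𝒢 n] (martingaleDiff μ 𝒢 V k) := fun k n hkn =>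
    (((hV (k + 1)).mono (𝒢.mono hkn)).sub ((hV k).mono (𝒢.mono hkn.le))).sub
      (stronglyMeasurable_condExp.mono (𝒢.mono hkn.le))
  have hSm : StronglyAdapted 𝒢
      (fun n ω => ∑ k ∈ Finset.range n, H k ω * martingaleDiff μ 𝒢 V k ω) := fun n =>
    Finset.stronglyMeasurable_fun_sum _ fun k hk =>
      ((hH k).mono (𝒢.mono (Finset.mem_range.1 hk).le)).mul (hGm k n (Finset.mem_range.1 hk))
  refine ⟨martingale_of_condExp_sub_eq_zero_nat hSm (fun n => (hS n).integrable le_top) fun n => ?_,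
    fun n => ⟨hS n, ?_⟩⟩
  · have : (fun ω => ∑ k ∈ Finset.range (n + 1), H k ω * martingaleDiff μ 𝒢 V k ω)
        - (fun ω => ∑ k ∈ Finset.range n, H k ω * martingaleDiff μ 𝒢 V k ω)
        = H n * martingaleDiff μ 𝒢 V n := by
      ext ω; simp [Finset.sum_range_succ]
    rw [this]
    refine (condExp_mul_of_stronglyMeasurable_left (hH n)
      (((hG n).mul (hHb n) (r := ∞)).integrable le_top) ((hG n).integrable le_top)).trans ?_
    filter_upwards [condExp_martingaleDiff (μ := μ) hV hVc n] with ω hω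
    simp [hω]
  · induction n with
    | zero => simpa using integral_nonneg fun ω => sq_nonneg (V 0 ω)
    | succ n ih =>
      set S := fun ω => ∑ k ∈ Finset.range n, H k ω * martingaleDiff μ 𝒢 V k ω with hSdef
      set G := martingaleDiff μ 𝒢 V n with hGdef
      have i1 : Integrable (fun ω => S ω ^ 2) μ := by
        simpa only [sq] using (((hS n).mul' (hS n) (r := ∞)).integrable le_top)
      have i2 : Integrable (fun ω => (S ω * H n ω) * G ω) μ :=
        ((hG n).mul ((hHb n).mul (hS n) (r := ∞)) (r := ∞)).integrable le_top
      have i3 : Integrable (fun ω => (H n ω * G ω) ^ 2) μ := by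
        simpa only [sq] using (((hHG n).mul' (hHG n) (r := ∞)).integrable le_top)
      have i4 : Integrable (fun ω => G ω ^ 2) μ := by
        simpa only [sq] using (((hG n).mul' (hG n) (r := ∞)).integrable le_top)
      have e1 : ∫ ω, (∑ k ∈ Finset.range (n + 1), H k ω * martingaleDiff μ 𝒢 V k ω) ^ 2 ∂μ
          = ∫ ω, S ω ^ 2 ∂μ + 2 * ∫ ω, (S ω * H n ω) * G ω ∂μ + ∫ ω, (H n ω * G ω) ^ 2 ∂μ := by
        rw [← integral_add_const_mul_add i1 i2 i3]
        refine integral_congr_ae (ae_of_all _ fun ω => ?_)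
        simp only [Finset.sum_range_succ, hSdef, hGdef]; ring
      have e2 : ∫ ω, (S ω * H n ω) * G ω ∂μ = 0 := by
        rw [← integral_mul_condExp_of_bdd (𝒢.le n) (X := fun ω => S ω * H n ω)
          ((hSm n).mul (hH n)) ((hHb n).mul (hS n) (r := ∞)) (hG n)]
        rw [integral_congr_ae (g := fun _ => (0 : ℝ)), integral_zero]
        filter_upwards [condExp_martingaleDiff (μ := μ) hV hVc n] with ω hω
        simp [hω]
      have e3 : ∫ ω, (H n ω * G ω) ^ 2 ∂μ ≤ ∫ ω, G ω ^ 2 ∂μ := by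
        refine integral_mono i3 i4 fun ω => ?_
        have := hH1 n ω
        simp only [mul_pow]
        have h2 : H n ω ^ 2 ≤ 1 := (sq_le_one_iff_abs_le_one _).2 this
        nlinarith [sq_nonneg (G ω)]
      have e4 := integral_sq_martingaleDiff_le (μ := μ) hV hVc n
      rw [e1, e2, Finset.sum_range_succ]
      linarith

end

variable [IsProbabilityMeasure μ] {f H : ℕ → Ω → ℝ} {c l : ℝ}

/-- The truncation to `[-c, c]` differs from the identity by convex functions, which turn a
martingale into submartingales. -/
lemma clip_eq (hc : 0 < c) (x : ℝ) :
    max (-c) (min x c) = x - max (x - c) 0 + max (-x - c) 0 := by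
  rcases le_total x c with h | h <;> rcases le_total (-c) x with h' | h'
  · rw [min_eq_left h, max_eq_right h', max_eq_right (by linarith), max_eq_right (by linarith)]
    ring
  · rw [min_eq_left h, max_eq_left h', max_eq_right (by linarith), max_eq_left (by linarith)]
    ring
  · rw [min_eq_right h, max_eq_right (by linarith), max_eq_left (by linarith),
      max_eq_right (by linarith)]
    ring
  · linarith

/-- The total conditional drift of a truncated martingale is controlled by its first absolute
moment, because the truncation differs from the martingale by two submartingales. -/
lemma sum_integral_drift_clip_le (hf : Martingale f 𝒢 μ) (hc : 0 < c) (m : ℕ) :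
    ∑ k ∈ Finset.range m, ∫ ω, |(μ[(fun ω => max (-c) (min (f (k + 1) ω) c))
        - (fun ω => max (-c) (min (f k ω) c))|𝒢 k]) ω| ∂μ ≤ ∫ ω, |f m ω| ∂μ := by
  have hcm : Martingale (fun (_ : ℕ) (_ : Ω) => c) 𝒢 μ := martingale_const _ _ c
  set P : ℕ → Ω → ℝ := fun n ω => max (f n ω - c) 0 with hP
  set Q : ℕ → Ω → ℝ := fun n ω => max (-f n ω - c) 0 with hQ
  have hPs : Submartingale P 𝒢 μ := (hf.sub hcm).submartingale.pos
  have hQs : Submartingale Q 𝒢 μ := (hf.neg.sub hcm).submartingale.pos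
  have key : ∀ k, ∫ ω, |(μ[(fun ω => max (-c) (min (f (k + 1) ω) c))
        - (fun ω => max (-c) (min (f k ω) c))|𝒢 k]) ω| ∂μ
      ≤ (∫ ω, P (k + 1) ω ∂μ - ∫ ω, P k ω ∂μ) + (∫ ω, Q (k + 1) ω ∂μ - ∫ ω, Q k ω ∂μ) := by
    intro k
    have hPi := (hPs.integrable (k + 1)).sub (hPs.integrable k)
    have hQi := (hQs.integrable (k + 1)).sub (hQs.integrable k)
    have hfi := (hf.integrable (k + 1)).sub (hf.integrable k)
    have e0 : (fun ω => max (-c) (min (f (k + 1) ω) c)) - (fun ω => max (-c) (min (f k ω) c))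
        = (f (k + 1) - f k) - (P (k + 1) - P k) + (Q (k + 1) - Q k) := by
      ext ω
      simp only [Pi.sub_apply, Pi.add_apply, clip_eq hc, hP, hQ]; ring
    have e1 : μ[(f (k + 1) - f k) - (P (k + 1) - P k) + (Q (k + 1) - Q k)|𝒢 k] =ᵐ[μ]
        μ[f (k + 1) - f k|𝒢 k] - μ[P (k + 1) - P k|𝒢 k] + μ[Q (k + 1) - Q k|𝒢 k] :=
      (condExp_add (hfi.sub hPi) hQi _).trans
        ((condExp_sub hfi hPi _).add (EventuallyEq.refl _ _))
    have e2 : μ[f (k + 1) - f k|𝒢 k] =ᵐ[μ] 0 := by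
      refine (condExp_sub (hf.integrable _) (hf.integrable _) _).trans ?_
      filter_upwards [hf.condExp_ae_eq k.le_succ, hf.condExp_ae_eq (le_refl k)] with ω h1 h2
      simp [h1, h2]
    have hP0 := hPs.condExp_sub_nonneg k.le_succ
    have hQ0 := hQs.condExp_sub_nonneg k.le_succ
    have eP : ∫ ω, P (k + 1) ω ∂μ - ∫ ω, P k ω ∂μ = ∫ ω, (μ[P (k + 1) - P k|𝒢 k]) ω ∂μ := by
      rw [integral_condExp (𝒢.le k), ← integral_sub (hPs.integrable _) (hPs.integrable _)]; rfl
    have eQ : ∫ ω, Q (k + 1) ω ∂μ - ∫ ω, Q k ω ∂μ = ∫ ω, (μ[Q (k + 1) - Q k|𝒢 k]) ω ∂μ := by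
      rw [integral_condExp (𝒢.le k), ← integral_sub (hQs.integrable _) (hQs.integrable _)]; rfl
    rw [eP, eQ, ← integral_add integrable_condExp integrable_condExp, e0]
    refine integral_mono_ae integrable_condExp.abs (integrable_condExp.add integrable_condExp) ?_
    filter_upwards [e1, e2, hP0, hQ0] with ω h1 h2 h3 h4
    simp only [h1, Pi.add_apply, Pi.sub_apply, h2, Pi.zero_apply]
    simp only [Pi.zero_apply] at h3 h4
    rw [abs_le]
    constructor <;> simp only [Nat.succ_eq_add_one] at h3 h4 <;> linarith
  calc _ ≤ ∑ k ∈ Finset.range m, ((∫ ω, P (k + 1) ω ∂μ + ∫ ω, Q (k + 1) ω ∂μ)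
          - (∫ ω, P k ω ∂μ + ∫ ω, Q k ω ∂μ)) :=
        Finset.sum_le_sum fun k _ => (key k).trans (le_of_eq (by ring))
    _ = (∫ ω, P m ω ∂μ + ∫ ω, Q m ω ∂μ) - (∫ ω, P 0 ω ∂μ + ∫ ω, Q 0 ω ∂μ) :=
        Finset.sum_range_sub (fun k => ∫ ω, P k ω ∂μ + ∫ ω, Q k ω ∂μ) m
    _ ≤ ∫ ω, P m ω ∂μ + ∫ ω, Q m ω ∂μ := by
        have h1 : 0 ≤ ∫ ω, P 0 ω ∂μ := integral_nonneg fun ω => le_max_right _ _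
        have h2 : 0 ≤ ∫ ω, Q 0 ω ∂μ := integral_nonneg fun ω => le_max_right _ _
        linarith
    _ ≤ ∫ ω, |f m ω| ∂μ := by
        rw [← integral_add (hPs.integrable m) (hQs.integrable m)]
        refine integral_mono ((hPs.integrable m).add (hQs.integrable m)) (hf.integrable m).abs ?_
        intro ω
        simp only [hP, hQ]
        rcases le_total 0 (f m ω) with h | h
        · rw [abs_of_nonneg h, max_eq_right (by linarith : -f m ω - c ≤ 0), add_zero]
          exact max_le (by linarith) h
        · rw [abs_of_nonpos h, max_eq_right (by linarith : f m ω - c ≤ 0), zero_add]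
          exact max_le (by linarith) (by linarith)

/-- A weak-type bound for the transform of an integrable martingale by a bounded adapted process.
Off the event that the martingale leaves `(-c, c)` it agrees with its truncation, whose drift is
bounded in `L¹` and whose martingale part is bounded in `L²`. -/
theorem measure_martingale_transform_ge_le (hf : Martingale f 𝒢 μ) (hH : StronglyAdapted 𝒢 H)
    (hH1 : ∀ n ω, |H n ω| ≤ 1) (hc : 0 < c) (hl : 0 < l) (m : ℕ) :
    μ {ω | ∃ n ≤ m, l ≤ |∑ k ∈ Finset.range n, H k ω * (f (k + 1) ω - f k ω)|} ≤
      ENNReal.ofReal ((∫ ω, |f m ω| ∂μ) / c) + ENNReal.ofReal (2 * (∫ ω, |f m ω| ∂μ) / l)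
        + ENNReal.ofReal (2 * (3 * c * (∫ ω, |f m ω| ∂μ) + 1) / l) := by
  set a := ∫ ω, |f m ω| ∂μ with ha
  set V : ℕ → Ω → ℝ := fun n ω => max (-c) (min (f n ω) c) with hVdef
  have hV : StronglyAdapted 𝒢 V := fun n =>
    (by fun_prop : Continuous fun x : ℝ => max (-c) (min x c)).comp_stronglyMeasurable (hf.1 n)
  have hVc : ∀ n ω, |V n ω| ≤ c := fun n ω => by
    rw [abs_le]
    exact ⟨le_max_left _ _, max_le (by linarith) (min_le_right _ _)⟩
  set d : ℕ → Ω → ℝ := fun k => μ[V (k + 1) - V k|𝒢 k] with hd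
  have hdsum : ∑ k ∈ Finset.range m, ∫ ω, |d k ω| ∂μ ≤ a := sum_integral_drift_clip_le hf hc m
  obtain ⟨hSm, hS⟩ := transform_martingaleDiff (μ := μ) hV hVc hH hH1
  set S : ℕ → Ω → ℝ := fun n ω => ∑ k ∈ Finset.range n, H k ω * martingaleDiff μ 𝒢 V k ω with hSdef
  have hfabs : Submartingale (fun n ω => |f n ω|) 𝒢 μ := by
    have := hf.submartingale.sup hf.neg.submartingale
    exact this
  have hSabs : Submartingale (fun n ω => |S n ω|) 𝒢 μ := by
    have := hSm.submartingale.sup hSm.neg.submartingale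
    exact this
  have b1 : μ {ω | ∃ n ≤ m, c ≤ |f n ω|} ≤ ENNReal.ofReal (a / c) :=
    measure_exists_ge_le_of_submartingale hfabs (fun n ω => abs_nonneg _) hc m
  have b2 : μ {ω | ∃ n ≤ m, l / 2 ≤ |S n ω|} ≤ ENNReal.ofReal (2 * (3 * c * a + 1) / l) := by
    refine (measure_exists_ge_le_of_submartingale hSabs (fun n ω => abs_nonneg _) (half_pos hl) m).trans ?_
    refine ENNReal.ofReal_le_ofReal ?_
    have hVm : ∫ ω, V m ω ^ 2 ∂μ ≤ c * a := by
      rw [ha, ← integral_const_mul]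
      refine integral_mono_of_nonneg (ae_of_all _ fun ω => sq_nonneg _)
        ((hf.integrable m).abs.const_mul c) (ae_of_all _ fun ω => ?_)
      have h1 : |V m ω| ≤ |f m ω| := by
        simp only [hVdef]
        rw [abs_le]
        constructor
        · rcases le_total (f m ω) c with h | h
          · rw [min_eq_left h]; exact (neg_abs_le _).trans (le_max_right _ _)
          · rw [min_eq_right h]
            exact le_trans (by linarith [abs_nonneg (f m ω)]) (le_max_right (-c) c)
        · exact max_le (by linarith [abs_nonneg (f m ω)]) ((min_le_left _ _).trans (le_abs_self _))
      calc V m ω ^ 2 = |V m ω| * |V m ω| := by rw [abs_mul_abs_self, sq]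
        _ ≤ c * |f m ω| := mul_le_mul (hVc m ω) h1 (abs_nonneg _) hc.le
    have hS2 : ∫ ω, S m ω ^ 2 ∂μ ≤ 3 * c * a := by
      have := (hS m).2
      have h3 : 2 * c * ∑ k ∈ Finset.range m, ∫ ω, |d k ω| ∂μ ≤ 2 * c * a := by gcongr
      simp only [hd] at h3
      linarith
    have i2 : Integrable (fun ω => S m ω ^ 2) μ := by
      simpa only [sq] using (((hS m).1.mul' (hS m).1 (r := ∞)).integrable le_top)
    have hS1 : ∫ ω, |S m ω| ∂μ ≤ 3 * c * a + 1 := by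
      calc ∫ ω, |S m ω| ∂μ ≤ ∫ ω, (S m ω ^ 2 + 1) ∂μ := by
            refine integral_mono ((hS m).1.integrable le_top).abs (i2.add (integrable_const 1)) ?_
            intro ω
            have h := sq_abs (S m ω)
            simp only
            nlinarith [sq_nonneg (|S m ω| - 1), abs_nonneg (S m ω)]
        _ = ∫ ω, S m ω ^ 2 ∂μ + 1 := by
            rw [integral_add i2 (integrable_const 1)]; simp
        _ ≤ _ := by linarith
    rw [div_le_div_iff₀ (half_pos hl) hl]
    nlinarith
  have b3 : μ {ω | l / 2 ≤ ∑ k ∈ Finset.range m, |d k ω|} ≤ ENNReal.ofReal (2 * a / l) := by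
    have hi : ∀ k, Integrable (fun ω => |d k ω|) μ := fun k => integrable_condExp.abs
    have := mul_meas_ge_le_integral_of_nonneg (μ := μ)
      (f := fun ω => ∑ k ∈ Finset.range m, |d k ω|)
      (ae_of_all _ fun ω => Finset.sum_nonneg fun k _ => abs_nonneg _)
      (integrable_finsetSum _ fun k _ => hi k) (l / 2)
    rw [integral_finsetSum _ fun k _ => hi k] at this
    rw [← ENNReal.ofReal_toReal (measure_ne_top μ {ω | l / 2 ≤ ∑ k ∈ Finset.range m, |d k ω|})]
    refine ENNReal.ofReal_le_ofReal ?_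
    rw [le_div_iff₀ hl]
    have h2 := this.trans hdsum
    rw [Measure.real] at h2
    linarith
  refine (measure_mono (t := {ω | ∃ n ≤ m, c ≤ |f n ω|} ∪ {ω | l / 2 ≤ ∑ k ∈ Finset.range m, |d k ω|}
    ∪ {ω | ∃ n ≤ m, l / 2 ≤ |S n ω|}) ?_).trans ((measure_union_le _ _).trans (add_le_add
      ((measure_union_le _ _).trans (add_le_add b1 b3)) b2))
  rintro ω ⟨n, hn, hω⟩
  by_contra hcon
  simp only [Set.mem_union, Set.mem_ofPred_eq, not_or, not_exists, not_and, not_le] at hcon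
  obtain ⟨⟨h1, h2⟩, h3⟩ := hcon
  have hVf : ∀ k ≤ m, V k ω = f k ω := fun k hk => by
    have := abs_lt.1 (h1 k hk)
    simp only [hVdef]
    rw [min_eq_left this.2.le, max_eq_right this.1.le]
  have hsum : ∑ k ∈ Finset.range n, H k ω * (f (k + 1) ω - f k ω)
      = S n ω + ∑ k ∈ Finset.range n, H k ω * d k ω := by
    simp only [hSdef]
    rw [← Finset.sum_add_distrib]
    refine Finset.sum_congr rfl fun k hk => ?_
    have hk' := Finset.mem_range.1 hk
    rw [← hVf k (by omega), ← hVf (k + 1) (by omega)]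
    simp only [martingaleDiff, Pi.sub_apply, hd]
    ring
  have hds : |∑ k ∈ Finset.range n, H k ω * d k ω| ≤ ∑ k ∈ Finset.range m, |d k ω| := by
    refine (Finset.abs_sum_le_sum_abs _ _).trans ?_
    refine (Finset.sum_le_sum fun k _ => ?_).trans
      (Finset.sum_le_sum_of_subset_of_nonneg (Finset.range_mono hn) fun k _ _ => abs_nonneg (d k ω))
    rw [abs_mul]
    exact mul_le_of_le_one_left (abs_nonneg _) (hH1 k ω)
  rw [hsum] at hω
  have := abs_add_le (S n ω) (∑ k ∈ Finset.range n, H k ω * d k ω)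
  linarith [h3 n hn]

end DiscreteMartingale

/-! ### Asymptotics in probability along refining partitions -/

section Framework

set_option linter.unusedSectionVars false

variable {Ω : Type*} [mΩ : MeasurableSpace Ω]

/-- The filter of partitions of `[0, T]` whose mesh tends to `0`. -/
def meshFilter (T : ℝ≥0) : Filter (ℕ × (ℕ → ℝ≥0)) :=
  ⨅ (δ : ℝ) (_ : 0 < δ), 𝓟 {π | IsPartition T δ π.1 π.2}

lemma IsPartition.mesh_mono {T : ℝ≥0} {δ δ' : ℝ} {N : ℕ} {σ : ℕ → ℝ≥0} (h : IsPartition T δ N σ)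
    (hδ : δ ≤ δ') : IsPartition T δ' N σ :=
  ⟨h.mono, h.left, h.right, fun i hi => (h.mesh i hi).trans hδ⟩

lemma hasBasis_meshFilter (T : ℝ≥0) :
    (meshFilter T).HasBasis (fun δ : ℝ => 0 < δ) (fun δ => {π | IsPartition T δ π.1 π.2}) := by
  refine hasBasis_biInf_principal' (fun δ hδ δ' hδ' => ?_) ⟨1, one_pos⟩
  exact ⟨min δ δ', lt_min hδ hδ', fun π h => h.mesh_mono (min_le_left _ _),
    fun π h => h.mesh_mono (min_le_right _ _)⟩

lemma exists_isPartition (T : ℝ≥0) {δ : ℝ} (hδ : 0 < δ) : ∃ N σ, IsPartition T δ N σ := by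
  set d : ℝ≥0 := δ.toNNReal with hd
  have hd0 : 0 < d := Real.toNNReal_pos.2 hδ
  have hdδ : (d : ℝ) = δ := Real.coe_toNNReal _ hδ.le
  obtain ⟨N, hN⟩ := exists_nat_ge (T / d)
  refine ⟨N, fun i => min (i * d) T, fun i j hij => ?_, by simp, ?_, fun i _ => ?_⟩
  · exact min_le_min_right _ (by gcongr)
  · exact min_eq_right ((div_le_iff₀ hd0).1 hN)
  · have h1 : min (((i + 1 : ℕ) : ℝ≥0) * d) T ≤ min ((i : ℝ≥0) * d) T + d := by
      rcases le_total ((i : ℝ≥0) * d) T with h | h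
      · rw [min_eq_left h]
        exact (min_le_left _ _).trans (by push_cast; rw [add_mul, one_mul])
      · rw [min_eq_right h]
        exact (min_le_right _ _).trans le_self_add
    have h2 : ((min (((i + 1 : ℕ) : ℝ≥0) * d) T : ℝ≥0) : ℝ)
        ≤ (min ((i : ℝ≥0) * d) T : ℝ≥0) + d := by exact_mod_cast h1
    rw [hdδ] at h2
    linarith

instance (T : ℝ≥0) : (meshFilter T).NeBot :=
  (hasBasis_meshFilter T).neBot_iff.2 fun {δ} hδ => by
    obtain ⟨N, σ, h⟩ := exists_isPartition T hδ
    exact ⟨(N, σ), h⟩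

/-- A smoothing parameter `h` together with a partition `(N, σ)`. -/
abbrev GridIndex := ℝ × ℕ × (ℕ → ℝ≥0)

/-- Eventually for small smoothing parameter `h > 0`, eventually for partitions of `[0, T]` of
small mesh (depending on `h`). -/
def gridFilter (T : ℝ≥0) : Filter GridIndex := (𝓝[>] (0 : ℝ)).curry (meshFilter T)

lemma eventually_gridFilter_iff {T : ℝ≥0} {P : GridIndex → Prop} :
    (∀ᶠ i in gridFilter T, P i) ↔ ∀ᶠ h in 𝓝[>] (0 : ℝ), ∀ᶠ π in meshFilter T, P (h, π) :=
  Iff.rfl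

lemma eventually_gridFilter_of_mesh {T : ℝ≥0} {P : ℕ × (ℕ → ℝ≥0) → Prop}
    (h : ∀ᶠ π in meshFilter T, P π) : ∀ᶠ i in gridFilter T, P i.2 :=
  eventually_gridFilter_iff.2 (Eventually.of_forall fun _ => h)

lemma eventually_mesh_of_gridFilter {T : ℝ≥0} {P : ℕ × (ℕ → ℝ≥0) → Prop}
    (h : ∀ᶠ i in gridFilter T, P i.2) : ∀ᶠ π in meshFilter T, P π :=
  (eventually_gridFilter_iff.1 h).exists.choose_spec

lemma eventually_isPartition (T : ℝ≥0) {δ : ℝ} (hδ : 0 < δ) :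
    ∀ᶠ i in gridFilter T, IsPartition T δ i.2.1 i.2.2 :=
  eventually_gridFilter_of_mesh ((hasBasis_meshFilter T).mem_of_mem hδ)

lemma eventually_smoothing_pos (T : ℝ≥0) : ∀ᶠ i in gridFilter T, 0 < i.1 :=
  eventually_gridFilter_iff.2 (eventually_mem_nhdsWithin.mono fun _ h => Eventually.of_forall
    fun _ => h)

/-- The times `t ≤ T` with `t ≤ τ ω`. -/
def horizon (τ : Ω → WithTop ℝ≥0) (T : ℝ≥0) (ω : Ω) : Set ℝ≥0 :=
  {t | t ≤ T ∧ (t : WithTop ℝ≥0) ≤ τ ω}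

lemma horizon_of_le {τ : Ω → WithTop ℝ≥0} {T s t : ℝ≥0} {ω : Ω} (ht : t ∈ horizon τ T ω)
    (hs : s ≤ t) : s ∈ horizon τ T ω :=
  ⟨hs.trans ht.1, (WithTop.coe_le_coe.2 hs).trans ht.2⟩

lemma min_mem_horizon {τ : Ω → WithTop ℝ≥0} {T s t : ℝ≥0} {ω : Ω} (ht : t ∈ horizon τ T ω) :
    min s t ∈ horizon τ T ω := horizon_of_le ht (min_le_right _ _)

/-- `P i` holds with probability at least `1 - η`, eventually in `i` (for the outer measure of the
complement). -/
def Whp (μ : Measure Ω) (T : ℝ≥0) (η : ℝ≥0∞) (P : GridIndex → Ω → Prop) : Prop :=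
  ∀ᶠ i in gridFilter T, μ {ω | ¬ P i ω} ≤ η

/-- `S` tends to `0` in probability, uniformly on `[0, T ∧ τ]`. -/
def Small (μ : Measure Ω) (τ : Ω → WithTop ℝ≥0) (T : ℝ≥0) (S : GridIndex → ℝ≥0 → Ω → ℝ) : Prop :=
  ∀ ε : ℝ, 0 < ε → ∀ η : ℝ≥0∞, 0 < η →
    Whp μ T η fun i ω => ∀ t ∈ horizon τ T ω, |S i t ω| < ε

/-- `S` is bounded in probability, uniformly on `[0, T ∧ τ]`. -/
def Bdd (μ : Measure Ω) (τ : Ω → WithTop ℝ≥0) (T : ℝ≥0) (S : GridIndex → ℝ≥0 → Ω → ℝ) : Prop :=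
  ∀ η : ℝ≥0∞, 0 < η → ∃ C : ℝ, 0 < C ∧
    Whp μ T η fun i ω => ∀ t ∈ horizon τ T ω, |S i t ω| ≤ C

/-- The terms `a i n`, `n < N`, tend to `0` in probability, uniformly in `n` and on
`[0, T ∧ τ]`. -/
def UnifSmall (μ : Measure Ω) (τ : Ω → WithTop ℝ≥0) (T : ℝ≥0)
    (a : GridIndex → ℕ → ℝ≥0 → Ω → ℝ) : Prop :=
  ∀ ε : ℝ, 0 < ε → ∀ η : ℝ≥0∞, 0 < η →
    Whp μ T η fun i ω => ∀ t ∈ horizon τ T ω, ∀ n < i.2.1, |a i n t ω| < ε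

/-- The sum of the terms `a i n` over the partition intervals. -/
def gridSum (a : GridIndex → ℕ → ℝ≥0 → Ω → ℝ) (i : GridIndex) (t : ℝ≥0) (ω : Ω) : ℝ :=
  ∑ n ∈ Finset.range i.2.1, a i n t ω

/-- The increment of `X` over the `n`-th partition interval, stopped at `t`. -/
def incr (X : ℝ≥0 → Ω → ℝ) (i : GridIndex) (n : ℕ) (t : ℝ≥0) (ω : Ω) : ℝ :=
  X (min (i.2.2 (n + 1)) t) ω - X (min (i.2.2 n) t) ω

/-- The value of `X` at the left end of the `n`-th partition interval, stopped at `t`. -/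
def leftVal (X : ℝ≥0 → Ω → ℝ) (i : GridIndex) (n : ℕ) (t : ℝ≥0) (ω : Ω) : ℝ :=
  X (min (i.2.2 n) t) ω

variable {μ : Measure Ω} {τ : Ω → WithTop ℝ≥0} {T : ℝ≥0} {η : ℝ≥0∞}

lemma Whp.mono {P Q : GridIndex → Ω → Prop} (hP : Whp μ T η P)
    (h : ∀ᶠ i in gridFilter T, ∀ ω, P i ω → Q i ω) : Whp μ T η Q := by
  filter_upwards [hP, h] with i h1 h2
  refine le_trans (measure_mono ?_) h1
  exact fun ω hω hp => hω (h2 ω hp)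

lemma Whp.and {P Q : GridIndex → Ω → Prop} (hP : Whp μ T (η / 2) P) (hQ : Whp μ T (η / 2) Q) :
    Whp μ T η fun i ω => P i ω ∧ Q i ω := by
  filter_upwards [hP, hQ] with i h1 h2
  calc μ {ω | ¬ (P i ω ∧ Q i ω)} ≤ μ ({ω | ¬ P i ω} ∪ {ω | ¬ Q i ω}) :=
        measure_mono fun ω hω => by
          by_contra hc
          simp only [Set.mem_union, Set.mem_ofPred_eq, not_or, not_not] at hc
          exact hω hc
    _ ≤ η / 2 + η / 2 := (measure_union_le _ _).trans (add_le_add h1 h2)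
    _ = η := ENNReal.add_halves η

lemma Whp.of_forall {P : GridIndex → Ω → Prop} (h : ∀ᶠ i in gridFilter T, ∀ ω, P i ω) :
    Whp μ T η P := by
  filter_upwards [h] with i hi
  simp [hi]

lemma Small.of_abs_le {S S' : GridIndex → ℝ≥0 → Ω → ℝ} (hS : Small μ τ T S')
    (h : ∀ᶠ i in gridFilter T, ∀ ω, ∀ t ∈ horizon τ T ω, |S i t ω| ≤ |S' i t ω|) :
    Small μ τ T S := fun ε hε η hη =>
  (hS ε hε η hη).mono (h.mono fun _ hi ω hω t ht => (hi ω t ht).trans_lt (hω t ht))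

lemma Small.congr {S S' : GridIndex → ℝ≥0 → Ω → ℝ} (hS : Small μ τ T S')
    (h : ∀ᶠ i in gridFilter T, ∀ ω, ∀ t ∈ horizon τ T ω, S i t ω = S' i t ω) :
    Small μ τ T S := hS.of_abs_le (h.mono fun _ hi ω t ht => by rw [hi ω t ht])

lemma Bdd.of_abs_le {S S' : GridIndex → ℝ≥0 → Ω → ℝ} (hS : Bdd μ τ T S')
    (h : ∀ᶠ i in gridFilter T, ∀ ω, ∀ t ∈ horizon τ T ω, |S i t ω| ≤ |S' i t ω|) :
    Bdd μ τ T S := fun η hη => by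
  obtain ⟨C, hC, hw⟩ := hS η hη
  exact ⟨C, hC, hw.mono (h.mono fun _ hi ω hω t ht => (hi ω t ht).trans (hω t ht))⟩

lemma Small.bdd {S : GridIndex → ℝ≥0 → Ω → ℝ} (hS : Small μ τ T S) : Bdd μ τ T S := fun η hη =>
  ⟨1, one_pos, (hS 1 one_pos η hη).mono (Eventually.of_forall fun _ _ h t ht => (h t ht).le)⟩

lemma small_zero : Small μ τ T (fun _ _ _ => 0) := fun ε hε _ _ =>
  Whp.of_forall (Eventually.of_forall fun _ _ _ _ => by simpa using hε)

lemma Small.add {S S' : GridIndex → ℝ≥0 → Ω → ℝ} (h : Small μ τ T S) (h' : Small μ τ T S') :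
    Small μ τ T (fun i t ω => S i t ω + S' i t ω) := fun ε hε η hη =>
  ((h _ (half_pos hε) _ (ENNReal.half_pos hη.ne')).and
    (h' _ (half_pos hε) _ (ENNReal.half_pos hη.ne'))).mono <| Eventually.of_forall
      fun i ω hω t ht => (abs_add_le _ _).trans_lt (by linarith [hω.1 t ht, hω.2 t ht])

lemma Small.neg {S : GridIndex → ℝ≥0 → Ω → ℝ} (h : Small μ τ T S) :
    Small μ τ T (fun i t ω => -S i t ω) :=
  h.of_abs_le (Eventually.of_forall fun _ _ _ _ => by rw [abs_neg])

lemma Small.sub {S S' : GridIndex → ℝ≥0 → Ω → ℝ} (h : Small μ τ T S) (h' : Small μ τ T S') :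
    Small μ τ T (fun i t ω => S i t ω - S' i t ω) := by
  simpa only [sub_eq_add_neg] using h.add h'.neg

lemma Small.sum {ι : Type*} {s : Finset ι} {S : ι → GridIndex → ℝ≥0 → Ω → ℝ}
    (h : ∀ j, Small μ τ T (S j)) : Small μ τ T (fun i t ω => ∑ j ∈ s, S j i t ω) := by
  classical
  induction s using Finset.induction_on with
  | empty => simpa using small_zero
  | insert a s ha ih => simpa only [Finset.sum_insert ha] using (h a).add ih

lemma Small.mul_bdd {S B : GridIndex → ℝ≥0 → Ω → ℝ} (h : Small μ τ T S) (h' : Bdd μ τ T B) :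
    Small μ τ T (fun i t ω => S i t ω * B i t ω) := fun ε hε η hη => by
  obtain ⟨C, hC, hw⟩ := h' _ (ENNReal.half_pos hη.ne')
  refine ((h _ (div_pos hε hC) _ (ENNReal.half_pos hη.ne')).and hw).mono <|
    Eventually.of_forall fun i ω hω t ht => ?_
  rw [abs_mul]
  calc |S i t ω| * |B i t ω| ≤ |S i t ω| * C := by gcongr; exact hω.2 t ht
    _ < ε / C * C := by gcongr; exact hω.1 t ht
    _ = ε := div_mul_cancel₀ _ hC.ne'

lemma Bdd.add {S S' : GridIndex → ℝ≥0 → Ω → ℝ} (h : Bdd μ τ T S) (h' : Bdd μ τ T S') :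
    Bdd μ τ T (fun i t ω => S i t ω + S' i t ω) := fun η hη => by
  obtain ⟨C, hC, hw⟩ := h _ (ENNReal.half_pos hη.ne')
  obtain ⟨C', hC', hw'⟩ := h' _ (ENNReal.half_pos hη.ne')
  exact ⟨C + C', add_pos hC hC', (hw.and hw').mono <| Eventually.of_forall fun i ω hω t ht =>
    (abs_add_le _ _).trans (add_le_add (hω.1 t ht) (hω.2 t ht))⟩

lemma Bdd.mul {S S' : GridIndex → ℝ≥0 → Ω → ℝ} (h : Bdd μ τ T S) (h' : Bdd μ τ T S') :
    Bdd μ τ T (fun i t ω => S i t ω * S' i t ω) := fun η hη => by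
  obtain ⟨C, hC, hw⟩ := h _ (ENNReal.half_pos hη.ne')
  obtain ⟨C', hC', hw'⟩ := h' _ (ENNReal.half_pos hη.ne')
  refine ⟨C * C', mul_pos hC hC', (hw.and hw').mono <| Eventually.of_forall fun i ω hω t ht => ?_⟩
  rw [abs_mul]
  exact mul_le_mul (hω.1 t ht) (hω.2 t ht) (abs_nonneg _) hC.le

lemma Bdd.neg {S : GridIndex → ℝ≥0 → Ω → ℝ} (h : Bdd μ τ T S) :
    Bdd μ τ T (fun i t ω => -S i t ω) :=
  h.of_abs_le (Eventually.of_forall fun _ _ _ _ => by rw [abs_neg])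

lemma bdd_const (c : ℝ) : Bdd μ τ T (fun _ _ _ => c) := fun _ _ =>
  ⟨|c| + 1, by positivity, Whp.of_forall (Eventually.of_forall fun _ _ _ _ => by linarith)⟩

/-! ### Sums over partition intervals -/

/-- Uniformly small coefficients against terms of bounded total absolute value. -/
lemma small_gridSum_mul_of_unifSmall {a b : GridIndex → ℕ → ℝ≥0 → Ω → ℝ} (ha : UnifSmall μ τ T a)
    (hb : Bdd μ τ T (gridSum fun i n t ω => |b i n t ω|)) :
    Small μ τ T (gridSum fun i n t ω => a i n t ω * b i n t ω) := fun ε hε η hη => by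
  obtain ⟨C, hC, hw⟩ := hb _ (ENNReal.half_pos hη.ne')
  refine ((ha (ε / (2 * C)) (by positivity) _ (ENNReal.half_pos hη.ne')).and hw).mono <|
    Eventually.of_forall fun i ω hω t ht => ?_
  calc |∑ n ∈ Finset.range i.2.1, a i n t ω * b i n t ω|
      ≤ ∑ n ∈ Finset.range i.2.1, ε / (2 * C) * |b i n t ω| := by
        refine (Finset.abs_sum_le_sum_abs _ _).trans (Finset.sum_le_sum fun n hn => ?_)
        rw [abs_mul]
        gcongr
        exact (hω.1 t ht n (Finset.mem_range.1 hn)).le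
    _ = ε / (2 * C) * ∑ n ∈ Finset.range i.2.1, |b i n t ω| := by rw [Finset.mul_sum]
    _ ≤ ε / (2 * C) * C := by
        gcongr
        exact (le_abs_self _).trans (hω.2 t ht)
    _ = ε / 2 := by field_simp
    _ < ε := half_lt_self hε

lemma bdd_gridSum_leftVal_mul {Y : GridIndex → ℝ≥0 → Ω → ℝ}
    {b : GridIndex → ℕ → ℝ≥0 → Ω → ℝ} (hY : Bdd μ τ T Y)
    (hb : Bdd μ τ T (gridSum fun i n t ω => |b i n t ω|)) :
    Bdd μ τ T (gridSum fun i n t ω => |leftVal (Y i) i n t ω * b i n t ω|) := fun η hη => by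
  obtain ⟨C, hC, hw⟩ := hb _ (ENNReal.half_pos hη.ne')
  obtain ⟨C', hC', hw'⟩ := hY _ (ENNReal.half_pos hη.ne')
  refine ⟨C' * C, by positivity, (hw.and hw').mono <| Eventually.of_forall fun i ω hω t ht => ?_⟩
  calc abs (∑ n ∈ Finset.range i.2.1, |leftVal (Y i) i n t ω * b i n t ω|)
      ≤ ∑ n ∈ Finset.range i.2.1, C' * |b i n t ω| := by
        rw [abs_of_nonneg (Finset.sum_nonneg fun _ _ => abs_nonneg _)]
        refine Finset.sum_le_sum fun n hn => ?_
        rw [abs_mul]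
        gcongr
        exact hω.2 _ (min_mem_horizon ht)
    _ = C' * ∑ n ∈ Finset.range i.2.1, |b i n t ω| := by rw [Finset.mul_sum]
    _ ≤ C' * C := by
        gcongr
        exact (le_abs_self _).trans (hω.1 t ht)

/-- By the inequality `2 |a b| ≤ a² + b²`. -/
lemma bdd_gridSum_abs_mul {a b : GridIndex → ℕ → ℝ≥0 → Ω → ℝ}
    (ha : Bdd μ τ T (gridSum fun i n t ω => a i n t ω ^ 2))
    (hb : Bdd μ τ T (gridSum fun i n t ω => b i n t ω ^ 2)) :
    Bdd μ τ T (gridSum fun i n t ω => |a i n t ω * b i n t ω|) := by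
  refine (ha.add hb).of_abs_le (Eventually.of_forall fun i ω t _ => ?_)
  simp only [gridSum]
  rw [abs_of_nonneg (Finset.sum_nonneg fun _ _ => abs_nonneg _), ← Finset.sum_add_distrib,
    abs_of_nonneg (Finset.sum_nonneg fun _ _ => by positivity)]
  refine Finset.sum_le_sum fun n _ => ?_
  rw [abs_le]
  constructor <;> nlinarith [sq_nonneg (a i n t ω - b i n t ω), sq_nonneg (a i n t ω + b i n t ω)]

/-- By the Cauchy–Schwarz inequality. -/
lemma small_gridSum_mul_of_sq {a b : GridIndex → ℕ → ℝ≥0 → Ω → ℝ}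
    (ha : Small μ τ T (gridSum fun i n t ω => a i n t ω ^ 2))
    (hb : Bdd μ τ T (gridSum fun i n t ω => b i n t ω ^ 2)) :
    Small μ τ T (gridSum fun i n t ω => a i n t ω * b i n t ω) := fun ε hε η hη => by
  refine (ha.mul_bdd hb (ε ^ 2) (by positivity) η hη).mono <|
    Eventually.of_forall fun i ω hω t ht => ?_
  have h1 := Finset.sum_mul_sq_le_sq_mul_sq (Finset.range i.2.1) (fun n => a i n t ω)
    (fun n => b i n t ω)
  have h2 := (le_abs_self _).trans_lt (hω t ht)
  exact abs_lt_of_sq_lt_sq (h1.trans_lt h2) hε.le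

end Framework

/-! ### Good integrators -/

section Integrators

set_option linter.unusedSectionVars false

variable {Ω : Type*} [mΩ : MeasurableSpace Ω]

/-- The increments `e` are those of a good integrator: the sums `∑ H e` over adapted `H` with
`|H| ≤ 1` are bounded in probability, uniformly in `H`. -/
def Integ (ℱ : Filtration ℝ≥0 mΩ) (μ : Measure Ω) (τ : Ω → WithTop ℝ≥0) (T : ℝ≥0)
    (e : GridIndex → ℕ → ℝ≥0 → Ω → ℝ) : Prop :=
  ∀ η : ℝ≥0∞, 0 < η → ∃ C : ℝ, 0 < C ∧ ∀ᶠ i in gridFilter T, ∀ H : ℝ≥0 → Ω → ℝ,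
    StronglyAdapted ℱ H → (∀ t ω, |H t ω| ≤ 1) →
    μ {ω | ¬ ∀ t ∈ horizon τ T ω, |gridSum (fun i n t ω => leftVal H i n t ω * e i n t ω) i t ω| ≤ C}
      ≤ η

variable {ℱ : Filtration ℝ≥0 mΩ} {μ : Measure Ω} {τ : Ω → WithTop ℝ≥0} {T : ℝ≥0} {η : ℝ≥0∞}

lemma measure_not_le_of_and {P Q R : Ω → Prop} (hP : μ {ω | ¬ P ω} ≤ η / 2)
    (hQ : μ {ω | ¬ Q ω} ≤ η / 2) (h : ∀ ω, P ω → Q ω → R ω) : μ {ω | ¬ R ω} ≤ η := by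
  calc μ {ω | ¬ R ω} ≤ μ ({ω | ¬ P ω} ∪ {ω | ¬ Q ω}) :=
        measure_mono fun ω hω => by
          by_contra hc
          simp only [Set.mem_union, Set.mem_ofPred_eq, not_or, not_not] at hc
          exact hω (h ω hc.1 hc.2)
    _ ≤ η / 2 + η / 2 := (measure_union_le _ _).trans (add_le_add hP hQ)
    _ = η := ENNReal.add_halves η

/-- The truncation of `x` to `[-1, 1]`. -/
def clip (x : ℝ) : ℝ := max (-1) (min x 1)

lemma continuous_clip : Continuous clip := by unfold clip; fun_prop

lemma abs_clip_le (x : ℝ) : |clip x| ≤ 1 :=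
  abs_le.2 ⟨le_max_left _ _, max_le (by norm_num) (min_le_right _ _)⟩

lemma clip_of_abs_le {x : ℝ} (h : |x| ≤ 1) : clip x = x := by
  have := abs_le.1 h
  rw [clip, min_eq_left this.2, max_eq_right this.1]

lemma stronglyAdapted_comp {g : ℝ → ℝ} (hg : Continuous g) {X : ℝ≥0 → Ω → ℝ}
    (hX : StronglyAdapted ℱ X) : StronglyAdapted ℱ (fun t ω => g (X t ω)) := fun t =>
  hg.comp_stronglyMeasurable (hX t)

/-- On the event that `|H| ≤ δ`, the sum `∑ H e` is `δ` times an admissible one. -/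
lemma Integ.abs_gridSum_le {e : GridIndex → ℕ → ℝ≥0 → Ω → ℝ} {i : GridIndex} {H : ℝ≥0 → Ω → ℝ}
    {δ C : ℝ} (hδ : 0 < δ) {ω : Ω} (hH : ∀ t ∈ horizon τ T ω, |H t ω| ≤ δ)
    (h : ∀ t ∈ horizon τ T ω, |gridSum (fun i n t ω =>
      leftVal (fun t ω => clip (H t ω / δ)) i n t ω * e i n t ω) i t ω| ≤ C) :
    ∀ t ∈ horizon τ T ω,
      |gridSum (fun i n t ω => leftVal H i n t ω * e i n t ω) i t ω| ≤ δ * C := by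
  intro t ht
  have key : gridSum (fun i n t ω => leftVal H i n t ω * e i n t ω) i t ω
      = δ * gridSum (fun i n t ω =>
        leftVal (fun t ω => clip (H t ω / δ)) i n t ω * e i n t ω) i t ω := by
    simp only [gridSum]
    rw [Finset.mul_sum]
    refine Finset.sum_congr rfl fun n _ => ?_
    have h1 := hH _ (min_mem_horizon (s := i.2.2 n) ht)
    simp only [leftVal]
    rw [clip_of_abs_le (by rwa [abs_div, abs_of_pos hδ, div_le_one hδ])]
    field_simp
  rw [key, abs_mul, abs_of_pos hδ]
  gcongr
  exact h t ht

lemma Integ.bdd {e : GridIndex → ℕ → ℝ≥0 → Ω → ℝ} (he : Integ ℱ μ τ T e)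
    {H : GridIndex → ℝ≥0 → Ω → ℝ} (hH : ∀ i, StronglyAdapted ℱ (H i)) (hb : Bdd μ τ T H) :
    Bdd μ τ T (gridSum fun i n t ω => leftVal (H i) i n t ω * e i n t ω) := fun η hη => by
  obtain ⟨C, hC, hw⟩ := he _ (ENNReal.half_pos hη.ne')
  obtain ⟨δ, hδ, hw'⟩ := hb _ (ENNReal.half_pos hη.ne')
  refine ⟨δ * C, by positivity, ?_⟩
  filter_upwards [hw, hw'] with i h1 h2
  refine measure_not_le_of_and (h1 _ (stronglyAdapted_comp
    (continuous_clip.comp (continuous_id.div_const δ)) (hH i)) fun _ _ => abs_clip_le _) h2 ?_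
  exact fun ω ha hb => Integ.abs_gridSum_le hδ hb ha

/-- Sums against an adapted process which is small in probability are small. -/
lemma Integ.small {e : GridIndex → ℕ → ℝ≥0 → Ω → ℝ} (he : Integ ℱ μ τ T e)
    {H : GridIndex → ℝ≥0 → Ω → ℝ} (hH : ∀ i, StronglyAdapted ℱ (H i)) (hs : Small μ τ T H) :
    Small μ τ T (gridSum fun i n t ω => leftVal (H i) i n t ω * e i n t ω) := fun ε hε η hη => by
  obtain ⟨C, hC, hw⟩ := he _ (ENNReal.half_pos hη.ne')
  have hδ : 0 < ε / (2 * C) := by positivity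
  filter_upwards [hw, hs _ hδ _ (ENNReal.half_pos hη.ne')] with i h1 h2
  refine measure_not_le_of_and (h1 _ (stronglyAdapted_comp
    (continuous_clip.comp (continuous_id.div_const (ε / (2 * C)))) (hH i)) fun _ _ => abs_clip_le _) h2 ?_
  intro ω ha hb t ht
  refine (Integ.abs_gridSum_le hδ (fun t ht => (hb t ht).le) ha t ht).trans_lt ?_
  have : ε / (2 * C) * C = ε / 2 := by field_simp
  rw [this]; exact half_lt_self hε

lemma Integ.add {e e' : GridIndex → ℕ → ℝ≥0 → Ω → ℝ} (he : Integ ℱ μ τ T e)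
    (he' : Integ ℱ μ τ T e') : Integ ℱ μ τ T (fun i n t ω => e i n t ω + e' i n t ω) :=
  fun η hη => by
  obtain ⟨C, hC, hw⟩ := he _ (ENNReal.half_pos hη.ne')
  obtain ⟨C', hC', hw'⟩ := he' _ (ENNReal.half_pos hη.ne')
  refine ⟨C + C', by positivity, ?_⟩
  filter_upwards [hw, hw'] with i h1 h2 H hH hH1
  refine measure_not_le_of_and (h1 H hH hH1) (h2 H hH hH1) fun ω ha hb t ht => ?_
  have : gridSum (fun i n t ω => leftVal H i n t ω * (e i n t ω + e' i n t ω)) i t ω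
      = gridSum (fun i n t ω => leftVal H i n t ω * e i n t ω) i t ω
        + gridSum (fun i n t ω => leftVal H i n t ω * e' i n t ω) i t ω := by
    simp only [gridSum, mul_add, Finset.sum_add_distrib]
  rw [this]
  exact (abs_add_le _ _).trans (add_le_add (ha t ht) (hb t ht))

/-- Good increments remain good when weighted by an adapted process which is bounded in
probability: on a likely event the weight is absorbed into the admissible integrand. -/
lemma Integ.mul_leftVal {e : GridIndex → ℕ → ℝ≥0 → Ω → ℝ} (he : Integ ℱ μ τ T e)
    {Y : GridIndex → ℝ≥0 → Ω → ℝ} (hY : ∀ i, StronglyAdapted ℱ (Y i)) (hb : Bdd μ τ T Y) :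
    Integ ℱ μ τ T (fun i n t ω => leftVal (Y i) i n t ω * e i n t ω) := fun η hη => by
  obtain ⟨C, hC, hw⟩ := he _ (ENNReal.half_pos hη.ne')
  obtain ⟨δ, hδ, hw'⟩ := hb _ (ENNReal.half_pos hη.ne')
  refine ⟨δ * C, by positivity, ?_⟩
  filter_upwards [hw, hw'] with i h1 h2 H hH hH1
  refine measure_not_le_of_and (h1 _ (stronglyAdapted_comp
    (continuous_clip.comp (continuous_id.div_const δ)) (hH.mul (hY i))) fun _ _ => abs_clip_le _) h2 ?_
  intro ω ha hb t ht
  have := Integ.abs_gridSum_le (H := H * Y i) hδ (fun t ht => ?_) ha t ht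
  · refine le_of_eq_of_le ?_ this
    simp only [gridSum, leftVal, Pi.mul_apply, mul_assoc]
  · rw [Pi.mul_apply, Pi.mul_apply, abs_mul]
    exact (mul_le_of_le_one_left (abs_nonneg _) (hH1 t ω)).trans (hb t ht)

/-- Increments of bounded total absolute value are good. -/
lemma Integ.of_abs {e : GridIndex → ℕ → ℝ≥0 → Ω → ℝ}
    (he : Bdd μ τ T (gridSum fun i n t ω => |e i n t ω|)) : Integ ℱ μ τ T e := fun η hη => by
  obtain ⟨C, hC, hw⟩ := he η hη
  refine ⟨C, hC, ?_⟩
  filter_upwards [hw] with i h H _ hH1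
  refine le_trans (measure_mono ?_) h
  intro ω hω hp
  refine hω fun t ht => le_trans ?_ ((le_abs_self _).trans (hp t ht))
  refine (Finset.abs_sum_le_sum_abs _ _).trans (Finset.sum_le_sum fun n _ => ?_)
  rw [abs_mul]
  exact mul_le_of_le_one_left (abs_nonneg _) (hH1 _ ω)

lemma Integ.neg {e : GridIndex → ℕ → ℝ≥0 → Ω → ℝ} (he : Integ ℱ μ τ T e) :
    Integ ℱ μ τ T (fun i n t ω => -e i n t ω) := by
  simpa [leftVal] using he.mul_leftVal (Y := fun _ _ _ => -1)
    (fun _ => stronglyAdapted_const _ _) (bdd_const _)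

lemma Integ.sub {e e' : GridIndex → ℕ → ℝ≥0 → Ω → ℝ} (he : Integ ℱ μ τ T e)
    (he' : Integ ℱ μ τ T e') : Integ ℱ μ τ T (fun i n t ω => e i n t ω - e' i n t ω) := by
  simpa only [sub_eq_add_neg] using he.add he'.neg

lemma integ_zero : Integ ℱ μ τ T (fun _ _ _ _ => 0) :=
  Integ.of_abs ((bdd_const 0).of_abs_le (Eventually.of_forall fun _ _ _ _ => by simp [gridSum]))

lemma Integ.sum {ι : Type*} {s : Finset ι} {e : ι → GridIndex → ℕ → ℝ≥0 → Ω → ℝ}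
    (he : ∀ j, Integ ℱ μ τ T (e j)) : Integ ℱ μ τ T (fun i n t ω => ∑ j ∈ s, e j i n t ω) := by
  classical
  induction s using Finset.induction_on with
  | empty => simpa using integ_zero
  | insert a s ha ih => simpa only [Finset.sum_insert ha] using (he a).add ih

lemma Integ.congr {e e' : GridIndex → ℕ → ℝ≥0 → Ω → ℝ} (he : Integ ℱ μ τ T e)
    (h : ∀ i n t ω, e' i n t ω = e i n t ω) : Integ ℱ μ τ T e' := by
  have : e' = e := by ext; exact h _ _ _ _
  exact this ▸ he

lemma Integ.of_top {e : GridIndex → ℕ → ℝ≥0 → Ω → ℝ} (he : Integ ℱ μ (fun _ => ⊤) T e) :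
    Integ ℱ μ τ T e := fun η hη => by
  obtain ⟨C, hC, hw⟩ := he η hη
  refine ⟨C, hC, ?_⟩
  filter_upwards [hw] with i h H hH hH1
  refine le_trans (measure_mono ?_) (h H hH hH1)
  exact fun ω hω hp => hω fun t ht => hp t ⟨ht.1, le_top⟩

/-- A continuous adapted process. -/
structure IsContAdapted (ℱ : Filtration ℝ≥0 mΩ) (X : ℝ≥0 → Ω → ℝ) : Prop where
  adapted : StronglyAdapted ℱ X
  cont : ∀ ω, Continuous fun t => X t ω

/-- A continuous adapted process whose sums against bounded adapted processes are bounded in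
probability, uniformly in the integrand. -/
structure IsGoodIntegrator (ℱ : Filtration ℝ≥0 mΩ) (μ : Measure Ω) (X : ℝ≥0 → Ω → ℝ) : Prop
    extends IsContAdapted ℱ X where
  integ : ∀ T, Integ ℱ μ (fun _ => ⊤) T (incr X)

lemma IsGoodIntegrator.add {X Y : ℝ≥0 → Ω → ℝ} (hX : IsGoodIntegrator ℱ μ X)
    (hY : IsGoodIntegrator ℱ μ Y) : IsGoodIntegrator ℱ μ (fun t ω => X t ω + Y t ω) where
  adapted := hX.adapted.add hY.adapted
  cont ω := (hX.cont ω).add (hY.cont ω)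
  integ T := ((hX.integ T).add (hY.integ T)).congr fun i n t ω => by simp only [incr]; ring

/-! ### Martingales are good integrators -/

/-- The grid obtained from `σ` by dividing each interval `[σ n, σ (n + 1)]` into `M` equal parts. -/
def subdivide (σ : ℕ → ℝ≥0) (M k : ℕ) : ℝ≥0 :=
  σ (k / M) + ((k % M : ℕ) : ℝ≥0) / M * (σ (k / M + 1) - σ (k / M))

lemma le_subdivide (σ : ℕ → ℝ≥0) (M k : ℕ) : σ (k / M) ≤ subdivide σ M k := le_self_add

lemma subdivide_le {σ : ℕ → ℝ≥0} (hσ : Monotone σ) {M : ℕ} (hM : 0 < M) (k : ℕ) :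
    subdivide σ M k ≤ σ (k / M + 1) := by
  have h1 : ((k % M : ℕ) : ℝ≥0) / M ≤ 1 :=
    div_le_one_of_le₀ (by exact_mod_cast (Nat.mod_lt k hM).le) (by positivity)
  calc subdivide σ M k ≤ σ (k / M) + 1 * (σ (k / M + 1) - σ (k / M)) := by
        unfold subdivide; gcongr
    _ = σ (k / M + 1) := by rw [one_mul, add_tsub_cancel_of_le (hσ (Nat.le_succ _))]

lemma subdivide_succ {σ : ℕ → ℝ≥0} (hσ : Monotone σ) {M : ℕ} (hM : 0 < M) (k : ℕ) :
    subdivide σ M k ≤ subdivide σ M (k + 1) ∧ subdivide σ M (k + 1) ≤ σ (k / M + 1) := by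
  by_cases h : M ∣ k + 1
  · have h1 : (k + 1) / M = k / M + 1 := Nat.succ_div_of_dvd h
    have h2 : (k + 1) % M = 0 := Nat.mod_eq_zero_of_dvd h
    have h3 : subdivide σ M (k + 1) = σ (k / M + 1) := by simp [subdivide, h1, h2]
    rw [h3]
    exact ⟨subdivide_le hσ hM k, le_rfl⟩
  · have h1 : (k + 1) / M = k / M := Nat.succ_div_of_not_dvd h
    have h2 : (k + 1) % M = k % M + 1 := by
      have e1 := Nat.div_add_mod k M
      have e2 := Nat.div_add_mod (k + 1) M
      rw [h1] at e2
      omega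
    refine ⟨?_, h1 ▸ subdivide_le hσ hM (k + 1)⟩
    unfold subdivide
    rw [h1, h2]
    gcongr
    exact Nat.le_succ _

lemma monotone_subdivide {σ : ℕ → ℝ≥0} (hσ : Monotone σ) {M : ℕ} (hM : 0 < M) :
    Monotone (subdivide σ M) := monotone_nat_of_le_succ fun k => (subdivide_succ hσ hM k).1

/-- The points of the subdivided grids are dense in `[σ 0, σ N]`. -/
lemma exists_subdivide_tendsto {σ : ℕ → ℝ≥0} {N : ℕ} {t : ℝ≥0} (h0 : σ 0 ≤ t)
    (hN : t < σ N) : ∃ k : ℕ → ℕ, (∀ M, 0 < M → k M ≤ N * M) ∧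
      Tendsto (fun M => subdivide σ M (k M)) atTop (𝓝 t) := by
  obtain ⟨n, hnN, h1, h2⟩ : ∃ n < N, σ n ≤ t ∧ t < σ (n + 1) := by
    induction N with
    | zero => exact absurd h0 (not_le.2 hN)
    | succ N ih =>
      by_cases h : t < σ N
      · obtain ⟨n, hn, h1, h2⟩ := ih h
        exact ⟨n, by omega, h1, h2⟩
      · exact ⟨N, by omega, not_lt.1 h, hN⟩
  set D : ℝ≥0 := σ (n + 1) - σ n with hD
  have hD0 : 0 < D := tsub_pos_of_lt (h1.trans_lt h2)
  set θ : ℝ≥0 := (t - σ n) / D with hθ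
  have hθ1 : θ < 1 := by
    rw [hθ, div_lt_one hD0, hD]
    exact tsub_lt_tsub_right_of_le h1 h2
  have hfl : ∀ M : ℕ, 0 < M → ⌊(θ : ℝ) * M⌋₊ < M := fun M hM => by
    rw [Nat.floor_lt (by positivity)]
    have : (0 : ℝ) < M := by exact_mod_cast hM
    calc (θ : ℝ) * M < 1 * M := by gcongr; exact_mod_cast hθ1
      _ = M := one_mul _
  refine ⟨fun M => n * M + ⌊(θ : ℝ) * M⌋₊, fun M hM => ?_, ?_⟩
  · have := hfl M hM
    nlinarith
  · have e : ∀ᶠ M : ℕ in atTop, (σ n + ((⌊(θ : ℝ) * M⌋₊ : ℕ) : ℝ≥0) / M * D)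
        = subdivide σ M (n * M + ⌊(θ : ℝ) * M⌋₊) := by
      filter_upwards [eventually_gt_atTop 0] with M hM
      have hd : (n * M + ⌊(θ : ℝ) * M⌋₊) / M = n := by
        rw [mul_comm, Nat.mul_add_div hM, Nat.div_eq_of_lt (hfl M hM), add_zero]
      have hm : (n * M + ⌊(θ : ℝ) * M⌋₊) % M = ⌊(θ : ℝ) * M⌋₊ := by
        rw [mul_comm, Nat.mul_add_mod, Nat.mod_eq_of_lt (hfl M hM)]
      unfold subdivide
      rw [hd, hm]
    have hlim : Tendsto (fun M : ℕ => ((⌊(θ : ℝ) * M⌋₊ : ℕ) : ℝ≥0) / M) atTop (𝓝 θ) := by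
      rw [← NNReal.tendsto_coe]
      simpa [Function.comp_def] using (tendsto_nat_floor_mul_div_atTop (R := ℝ) θ.2).comp
        (tendsto_natCast_atTop_atTop (R := ℝ))
    have h3 : σ n + θ * D = t := by
      rw [hθ, div_mul_cancel₀ _ hD0.ne', add_tsub_cancel_of_le h1]
    rw [← h3]
    exact ((hlim.mul_const D).const_add (σ n)).congr' e

end Integrators

section Martingales

set_option linter.unusedSectionVars false

variable {Ω : Type*} [mΩ : MeasurableSpace Ω] {ℱ : Filtration ℝ≥0 mΩ} {μ : Measure Ω}
  {τ : Ω → WithTop ℝ≥0} {T : ℝ≥0} {η : ℝ≥0∞}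

lemma subdivide_mul (σ : ℕ → ℝ≥0) {M : ℕ} (hM : 0 < M) (N : ℕ) : subdivide σ M (N * M) = σ N := by
  simp [subdivide, Nat.mul_div_cancel N hM]

/-- Evaluated at a point of the subdivided grid, a step integral is a transform along that grid. -/
lemma sum_step_subdivide {σ : ℕ → ℝ≥0} (hσ : Monotone σ) (x : ℝ≥0 → ℝ) (h : ℕ → ℝ) {N M : ℕ}
    (hM : 0 < M) {m : ℕ} (hm : m ≤ N * M) :
    ∑ n ∈ Finset.range N, h n * (x (min (σ (n + 1)) (subdivide σ M m))
        - x (min (σ n) (subdivide σ M m)))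
      = ∑ k ∈ Finset.range m, h (k / M) * (x (subdivide σ M (k + 1)) - x (subdivide σ M k)) := by
  induction m with
  | zero =>
    have : subdivide σ M 0 = σ 0 := by simp [subdivide]
    rw [this, Finset.range_zero, Finset.sum_empty]
    refine Finset.sum_eq_zero fun n _ => ?_
    rw [min_eq_right (hσ (Nat.zero_le _)), min_eq_right (hσ (Nat.zero_le _)), sub_self, mul_zero]
  | succ m ih =>
    rw [Finset.sum_range_succ, ← ih (by omega), ← sub_eq_iff_eq_add', ← Finset.sum_sub_distrib]
    have h1 := le_subdivide σ M m
    obtain ⟨h2, h3⟩ := subdivide_succ hσ hM m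
    have hmN : m / M < N := (Nat.div_lt_iff_lt_mul hM).2 (by omega)
    rw [Finset.sum_eq_single (m / M)]
    · rw [min_eq_right h3, min_eq_left (h1.trans h2), min_eq_right (h2.trans h3), min_eq_left h1]
      ring
    · intro n _ hn
      rcases lt_or_gt_of_ne hn with hlt | hgt
      · have e1 : σ (n + 1) ≤ subdivide σ M m := (hσ hlt).trans h1
        have e2 : σ n ≤ subdivide σ M m := (hσ (Nat.le_succ n)).trans e1
        rw [min_eq_left (e1.trans h2), min_eq_left (e2.trans h2), min_eq_left e1, min_eq_left e2]
        ring
      · have e1 : subdivide σ M (m + 1) ≤ σ n := h3.trans (hσ hgt)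
        have e2 : subdivide σ M (m + 1) ≤ σ (n + 1) := e1.trans (hσ (Nat.le_succ n))
        rw [min_eq_right e2, min_eq_right e1, min_eq_right (h2.trans e2), min_eq_right (h2.trans e1)]
        ring
    · intro hn
      exact absurd (Finset.mem_range.2 hmN) hn

lemma exists_pos_ofReal_le (hη : 0 < η) : ∃ e : ℝ, 0 < e ∧ ENNReal.ofReal e ≤ η := by
  rcases eq_or_ne η ∞ with h | h
  · exact ⟨1, one_pos, h ▸ le_top⟩
  · exact ⟨η.toReal, ENNReal.toReal_pos hη.ne' h, (ENNReal.ofReal_toReal h).le⟩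

/-- A constant beyond which the transforms of a martingale with first absolute moment `a` are
unlikely to go. -/
lemma exists_weak_type_const {a : ℝ} (ha : 0 ≤ a) (hη : 0 < η) : ∃ c l : ℝ, 0 < c ∧ 0 < l ∧
    ENNReal.ofReal (a / c) + ENNReal.ofReal (2 * a / l)
      + ENNReal.ofReal (2 * (3 * c * a + 1) / l) ≤ η := by
  obtain ⟨e, he, hle⟩ := exists_pos_ofReal_le hη
  set c := 2 * (a + 1) / e with hc
  have hc0 : 0 < c := by positivity
  set l := 2 * (2 * a + 2 * (3 * c * a + 1)) / e with hl
  have hl0 : 0 < l := by positivity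
  refine ⟨c, l, hc0, hl0, le_trans ?_ hle⟩
  rw [← ENNReal.ofReal_add (by positivity) (by positivity),
    ← ENNReal.ofReal_add (by positivity) (by positivity)]
  refine ENNReal.ofReal_le_ofReal ?_
  have h1 : a / c ≤ e / 2 := by
    rw [div_le_iff₀ hc0, hc]
    have : e / 2 * (2 * (a + 1) / e) = a + 1 := by field_simp
    rw [this]; linarith
  have h2 : 2 * a / l + 2 * (3 * c * a + 1) / l = e / 2 := by
    rw [← add_div, hl]
    field_simp
  linarith

/-- The stopping of the left value at `t` is immaterial, since the increment vanishes once
`σ n ≥ t`. -/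
lemma leftVal_mul_incr {H X : ℝ≥0 → Ω → ℝ} {i : GridIndex} (hi : Monotone i.2.2) (n : ℕ) (t : ℝ≥0)
    (ω : Ω) : leftVal H i n t ω * incr X i n t ω = H (i.2.2 n) ω * incr X i n t ω := by
  rcases le_total (i.2.2 n) t with h | h
  · rw [leftVal, min_eq_left h]
  · have : incr X i n t ω = 0 := by
      rw [incr, min_eq_right h, min_eq_right (h.trans (hi (Nat.le_succ n))), sub_self]
    rw [this, mul_zero, mul_zero]

/-- Continuous martingales are good integrators, by the weak-type inequality along finer and finer
subdivisions of the partition. -/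
lemma integ_incr_of_martingale [IsProbabilityMeasure μ] {X : ℝ≥0 → Ω → ℝ} (hX : Martingale X ℱ μ)
    (hXc : ∀ ω, Continuous fun t => X t ω) : Integ ℱ μ (fun _ => ⊤) T (incr X) := fun η hη => by
  obtain ⟨c, l, hc, hl, hcl⟩ := exists_weak_type_const (a := ∫ ω, |X T ω| ∂μ)
    (integral_nonneg fun _ => abs_nonneg _) hη
  refine ⟨l, hl, ?_⟩
  filter_upwards [eventually_isPartition T one_pos] with i hi H hH hH1
  set σ := i.2.2 with hσdef
  set N := i.2.1 with hNdef
  have hσ : Monotone σ := hi.mono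
  set S : ℕ → ℕ → Ω → ℝ := fun M n ω => ∑ k ∈ Finset.range n,
    H (σ (k / M)) ω * (X (subdivide σ M (k + 1)) ω - X (subdivide σ M k) ω) with hS
  have hM : ∀ M, 0 < M → μ {ω | ∃ n ≤ N * M, l ≤ |S M n ω|} ≤ η := by
    intro M hM
    have hmono := monotone_subdivide hσ hM
    let 𝒢 : Filtration ℕ mΩ := ⟨fun k => ℱ (subdivide σ M k), fun a b hab => ℱ.mono (hmono hab),
      fun k => ℱ.le _⟩
    have hf : Martingale (fun k => X (subdivide σ M k)) 𝒢 μ :=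
      ⟨fun k => hX.1 _, fun a b hab => hX.2 _ _ (hmono hab)⟩
    have hH' : StronglyAdapted 𝒢 (fun k => H (σ (k / M))) := fun k =>
      (hH _).mono (ℱ.mono (le_subdivide σ M k))
    have := measure_martingale_transform_ge_le hf hH' (fun _ _ => hH1 _ _) hc hl (N * M)
    refine this.trans ?_
    rw [subdivide_mul σ hM, show σ N = T from hi.right]
    exact hcl
  -- the events that the bound fails along every subdivision of order at least `M₀`
  set A : ℕ → Set Ω := fun M₀ => {ω | ∀ M ≥ M₀, 0 < M → ∃ n ≤ N * M, l ≤ |S M n ω|} with hA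
  have hAm : Monotone A := fun a b hab ω hω M hM => hω M (hab.trans hM)
  have hAη : μ (⋃ M, A M) ≤ η := by
    rw [hAm.measure_iUnion]
    refine iSup_le fun M₀ => (measure_mono ?_).trans (hM (M₀ + 1) (Nat.succ_pos _))
    exact fun ω hω => hω (M₀ + 1) (Nat.le_succ _) (Nat.succ_pos _)
  refine le_trans (measure_mono fun ω hω => ?_) hAη
  simp only [Set.mem_ofPred_eq, not_forall, not_le] at hω
  obtain ⟨t, ht, htl⟩ := hω
  have htT : t ≤ σ N := ht.1.trans_eq hi.right.symm
  -- a path exceeding `l` at `t` also does so, by continuity, at points of all fine subdivisions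
  set F : ℝ≥0 → ℝ := fun t => ∑ n ∈ Finset.range N, H (σ n) ω *
    (X (min (σ (n + 1)) t) ω - X (min (σ n) t) ω) with hF
  have hFc : Continuous F := by
    refine continuous_finsetSum _ fun n _ => continuous_const.mul (Continuous.sub ?_ ?_)
    · exact (hXc ω).comp (continuous_const.min continuous_id)
    · exact (hXc ω).comp (continuous_const.min continuous_id)
  have hFt : l < |F t| := by
    refine htl.trans_eq (congrArg _ (Finset.sum_congr rfl fun n _ => ?_))
    exact leftVal_mul_incr hi.mono n t ω
  obtain ⟨k, hk, hklim⟩ : ∃ k : ℕ → ℕ, (∀ M, 0 < M → k M ≤ N * M) ∧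
      Tendsto (fun M => subdivide σ M (k M)) atTop (𝓝 t) := by
    rcases htT.lt_or_eq with h | h
    · exact exists_subdivide_tendsto (hi.left.trans_le zero_le) h
    · refine ⟨fun M => N * M, fun _ _ => le_rfl, ?_⟩
      refine Tendsto.congr' ?_ tendsto_const_nhds
      filter_upwards [eventually_gt_atTop 0] with M hM
      rw [subdivide_mul σ hM, h]
  have hev := ((hFc.abs.tendsto t).comp hklim).eventually (lt_mem_nhds hFt)
  obtain ⟨M₀, hM₀⟩ := eventually_atTop.1 hev
  refine Set.mem_iUnion.2 ⟨M₀, fun M hMM hM0 => ⟨k M, hk M hM0, ?_⟩⟩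
  have := hM₀ M hMM
  simp only [Function.comp, hF] at this
  rw [sum_step_subdivide hσ (fun t => X t ω) (fun n => H (σ n) ω) hM0 (hk M hM0)] at this
  exact this.le

lemma continuous_stoppedProcess {X : ℝ≥0 → Ω → ℝ} {ω : Ω} (hX : Continuous fun t => X t ω) :
    Continuous fun t => stoppedProcess X τ t ω := by
  simp only [stoppedProcess]
  induction hτ : τ ω using WithTop.recTopCoe with
  | top =>
    have : ∀ t : ℝ≥0, (min (t : WithTop ℝ≥0) ⊤).untopA = t := fun t => by rw [min_top_right]; rfl
    simpa only [this] using hX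
  | coe a =>
    have : ∀ t : ℝ≥0, (min (t : WithTop ℝ≥0) (a : WithTop ℝ≥0)).untopA = min t a := fun t => by
      rw [← WithTop.coe_min]; rfl
    simp only [this]
    exact hX.comp (continuous_id.min continuous_const)

lemma incr_congr {X Y : ℝ≥0 → Ω → ℝ} {t : ℝ≥0} {ω : Ω} (h : ∀ s ≤ t, X s ω = Y s ω) (i : GridIndex)
    (n : ℕ) : incr X i n t ω = incr Y i n t ω := by
  simp only [incr, h _ (min_le_right _ _)]

/-- Continuous local martingales are good integrators: up to an event of small probability, they
agree on `[0, T]` with a martingale of the localizing sequence. -/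
lemma integ_incr_of_local_martingale [IsProbabilityMeasure μ] {X : ℝ≥0 → Ω → ℝ}
    (hX : Locally (fun N => Martingale N ℱ μ) ℱ X μ) (hXc : ∀ ω, Continuous fun t => X t ω) :
    Integ ℱ μ (fun _ => ⊤) T (incr X) := fun η hη => by
  obtain ⟨ρ, hρ, hρm⟩ := hX
  -- localization: the event that `ρ n ≤ T` becomes negligible
  obtain ⟨n, hn⟩ : ∃ n, μ {ω | ρ n ω ≤ T} ≤ η / 2 := by
    have hlim : Tendsto (fun n => μ {ω | ρ n ω ≤ T}) atTop (𝓝 0) := by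
      have hms : ∀ n, MeasurableSet {ω | ρ n ω ≤ (T : WithTop ℝ≥0)} := fun n =>
        ℱ.le T _ (hρ.isStoppingTime n T)
      have hae : ∀ᵐ ω ∂μ, ∀ᶠ n in atTop, ω ∉ {ω | ρ n ω ≤ (T : WithTop ℝ≥0)} := by
        filter_upwards [hρ.tendsto_top] with ω hω
        filter_upwards [hω.eventually (lt_mem_nhds (WithTop.coe_lt_top T))] with n hn
        exact not_le.2 hn
      have := tendsto_measure_of_ae_tendsto_indicator_of_isFiniteMeasure (μ := μ) atTop
        (A := ∅) (As := fun n => {ω | ρ n ω ≤ (T : WithTop ℝ≥0)}) MeasurableSet.empty hms ?_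
      · simpa using this
      · filter_upwards [hae] with ω hω
        filter_upwards [hω] with n hn
        simpa using hn
    exact (hlim.eventually (ge_mem_nhds (ENNReal.half_pos hη.ne'))).exists
  set Y := stoppedProcess (fun t => {ω | ⊥ < ρ n ω}.indicator (X t)) (ρ n) with hY
  have hYc : ∀ ω, Continuous fun t => Y t ω := fun ω => by
    refine continuous_stoppedProcess ?_
    by_cases h : ω ∈ {ω | ⊥ < ρ n ω}
    · simpa only [Set.indicator_of_mem h] using hXc ω
    · simpa only [Set.indicator_of_notMem h] using continuous_const
  obtain ⟨C, hC, hw⟩ := integ_incr_of_martingale (T := T) (hρm n) hYc _ (ENNReal.half_pos hη.ne')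
  refine ⟨C, hC, ?_⟩
  filter_upwards [hw] with i h H hH hH1
  have hn' : μ {ω | ¬ ((T : WithTop ℝ≥0) < ρ n ω)} ≤ η / 2 := by simpa only [not_lt] using hn
  refine measure_not_le_of_and hn' (h H hH hH1) fun ω h1 h2 t ht => ?_
  have hXY : ∀ s ≤ t, X s ω = Y s ω := fun s hs => by
    have h3 : (s : WithTop ℝ≥0) ≤ ρ n ω := (WithTop.coe_le_coe.2 (hs.trans ht.1)).trans h1.le
    rw [hY, stoppedProcess_eq_of_le h3, Set.indicator_of_mem]
    exact bot_le.trans_lt h1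
  have e : gridSum (fun i n t ω => leftVal H i n t ω * incr X i n t ω) i t ω
      = gridSum (fun i n t ω => leftVal H i n t ω * incr Y i n t ω) i t ω :=
    Finset.sum_congr rfl fun n _ => congrArg (leftVal H i n t ω * ·) (incr_congr hXY i n)
  rw [e]
  exact h2 t ht

lemma IsFiltrationBrownian.martingale [IsProbabilityMeasure μ] {W : ℝ≥0 → Ω → ℝ}
    (hW : IsFiltrationBrownian ℱ μ W) : Martingale W ℱ μ := by
  have hpre : IsPreBrownianReal W μ := hW.isBrownian.toIsPreBrownianReal
  refine ⟨hW.adapted, fun s t hst => ?_⟩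
  have hi : ∀ t, Integrable (W t) μ := fun t => hpre.integrable_eval t
  have hm : Measurable fun ω => W t ω - W s ω :=
    (((hW.adapted t).mono (ℱ.le t)).sub ((hW.adapted s).mono (ℱ.le s))).measurable
  have h1 : μ[fun ω => W t ω - W s ω|ℱ s] =ᵐ[μ] fun _ => ∫ ω, W t ω - W s ω ∂μ :=
    condExp_indep_eq hm.comap_le (ℱ.le s)
      (Measurable.stronglyMeasurable (comap_measurable _)) (hW.indep s t hst)
  have h2 : ∫ ω, W t ω - W s ω ∂μ = 0 := by
    rw [integral_sub (hi t) (hi s), hpre.integral_eval, hpre.integral_eval, sub_self]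
  have h3 : μ[fun ω => W t ω - W s ω|ℱ s] =ᵐ[μ] μ[W t|ℱ s] - μ[W s|ℱ s] :=
    condExp_sub (hi t) (hi s) _
  rw [condExp_of_stronglyMeasurable (ℱ.le s) (hW.adapted s) (hi s)] at h3
  filter_upwards [h1, h3] with ω e1 e3
  rw [e1, h2] at e3
  simp only [Pi.sub_apply] at e3
  linarith

lemma IsFiltrationBrownian.isGoodIntegrator [IsProbabilityMeasure μ] {W : ℝ≥0 → Ω → ℝ}
    (hW : IsFiltrationBrownian ℱ μ W) : IsGoodIntegrator ℱ μ W where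
  adapted := hW.adapted
  cont := hW.continuous_paths
  integ _ := integ_incr_of_martingale hW.martingale hW.continuous_paths

/-! ### Processes of bounded variation and semimartingales -/

lemma exists_measure_le_of_antitone [IsProbabilityMeasure μ] {B : ℕ → Set Ω} (hB : Antitone B)
    (hm : ∀ k, MeasurableSet (B k)) (h0 : ⋂ k, B k = ∅) (hη : 0 < η) : ∃ k, μ (B k) ≤ η := by
  have := tendsto_measure_iInter_atTop (μ := μ) (fun k => (hm k).nullMeasurableSet) hB
    ⟨0, measure_ne_top _ _⟩
  rw [h0, measure_empty] at this
  exact (this.eventually (ge_mem_nhds hη)).exists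

lemma exists_measure_lt_le [IsProbabilityMeasure μ] {V : Ω → ℝ≥0∞} (hV : Measurable V)
    (hfin : ∀ ω, V ω ≠ ∞) (hη : 0 < η) : ∃ C : ℕ, μ {ω | (C : ℝ≥0∞) < V ω} ≤ η := by
  refine exists_measure_le_of_antitone (B := fun C : ℕ => {ω | (C : ℝ≥0∞) < V ω})
    (fun a b hab ω hω => ?_) (fun k => measurableSet_lt measurable_const hV) ?_ hη
  · exact lt_of_le_of_lt (by exact_mod_cast hab) (show (b : ℝ≥0∞) < V ω from hω)
  · ext ω
    simp only [Set.mem_iInter, Set.mem_ofPred_eq, Set.mem_empty_iff_false, iff_false, not_forall,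
      not_lt]
    obtain ⟨k, hk⟩ := ENNReal.exists_nat_gt (hfin ω)
    exact ⟨k, hk.le⟩

/-- The variation of `A` along the dyadic points of level `j` in `[0, K]`. -/
def dyadicVar (A : ℝ≥0 → ℝ) (K j : ℕ) : ℝ :=
  ∑ k ∈ Finset.range (K * 2 ^ j), |A ((k + 1 : ℕ) / 2 ^ j) - A ((k : ℕ) / 2 ^ j)|

/-- The variation of a sequence along a subsequence is at most its full variation. -/
lemma sum_abs_sub_le_of_index (f : ℕ → ℝ) {k : ℕ → ℕ} (hk : Monotone k) {m : ℕ} (N : ℕ)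
    (hm : k N ≤ m) : ∑ n ∈ Finset.range N, |f (k (n + 1)) - f (k n)|
      ≤ ∑ l ∈ Finset.range m, |f (l + 1) - f l| := by
  set c : ℕ → ℝ := fun m => ∑ l ∈ Finset.range m, |f (l + 1) - f l| with hc
  have h1 : ∀ a b, a ≤ b → |f b - f a| ≤ c b - c a := fun a b hab => by
    induction b, hab using Nat.le_induction with
    | base => simp
    | succ b hab ih =>
      have : c (b + 1) = c b + |f (b + 1) - f b| := Finset.sum_range_succ _ _
      have h2 := abs_add_le (f (b + 1) - f b) (f b - f a)
      rw [sub_add_sub_cancel] at h2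
      linarith
  have hcm : Monotone c := monotone_nat_of_le_succ fun b => by
    have : c (b + 1) = c b + |f (b + 1) - f b| := Finset.sum_range_succ _ _
    linarith [abs_nonneg (f (b + 1) - f b)]
  calc _ ≤ ∑ n ∈ Finset.range N, (c (k (n + 1)) - c (k n)) :=
        Finset.sum_le_sum fun n _ => h1 _ _ (hk (Nat.le_succ n))
    _ = c (k N) - c (k 0) := Finset.sum_range_sub (fun n => c (k n)) N
    _ ≤ c m := by
        have : 0 ≤ c (k 0) := Finset.sum_nonneg fun _ _ => abs_nonneg _
        linarith [hcm hm]

/-- By continuity, the variation sums of `A` are bounded by the supremum of the dyadic ones, which,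
unlike the variation itself, is visibly measurable in a parameter. -/
lemma sum_abs_le_iSup_dyadicVar {A : ℝ≥0 → ℝ} (hA : Continuous A) {K : ℕ} {s : ℕ → ℝ≥0}
    (hs : Monotone s) {N : ℕ} (hN : s N ≤ K) :
    ENNReal.ofReal (∑ n ∈ Finset.range N, |A (s (n + 1)) - A (s n)|)
      ≤ ⨆ j, ENNReal.ofReal (dyadicVar A K j) := by
  have hlim : Tendsto (fun j : ℕ => ∑ n ∈ Finset.range N,
      |A ((⌊s (n + 1) * (2 : ℝ≥0) ^ j⌋₊ : ℕ) / 2 ^ j) - A ((⌊s n * (2 : ℝ≥0) ^ j⌋₊ : ℕ) / 2 ^ j)|)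
      atTop (𝓝 (∑ n ∈ Finset.range N, |A (s (n + 1)) - A (s n)|)) := by
    have h1 : ∀ x : ℝ≥0, Tendsto (fun j : ℕ => ((⌊x * (2 : ℝ≥0) ^ j⌋₊ : ℕ) : ℝ≥0) / 2 ^ j) atTop
        (𝓝 x) := fun x => by
      have h2 : Tendsto (fun j : ℕ => x - (1 / 2 : ℝ≥0) ^ j) atTop (𝓝 x) := by
        have := tendsto_pow_atTop_nhds_zero_of_lt_one (r := (1 / 2 : ℝ≥0)) zero_le
          (by rw [← NNReal.coe_lt_coe]; norm_num)
        simpa using (tendsto_const_nhds (x := x)).sub this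
      refine tendsto_of_tendsto_of_tendsto_of_le_of_le h2 tendsto_const_nhds (fun j => ?_)
        fun j => ?_
      · have h3 : x * 2 ^ j ≤ (⌊x * (2 : ℝ≥0) ^ j⌋₊ : ℕ) + 1 := (Nat.lt_floor_add_one _).le
        have h5 : (0 : ℝ≥0) < 2 ^ j := by positivity
        simp only
        rw [tsub_le_iff_right, one_div, inv_pow, ← one_div, ← add_div, le_div_iff₀ h5]
        exact h3
      · have h5 : (0 : ℝ≥0) < 2 ^ j := by positivity
        exact (div_le_iff₀ h5).2 (Nat.floor_le zero_le)
    refine tendsto_finsetSum _ fun n _ => (Tendsto.sub ?_ ?_).abs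
    · exact (hA.tendsto _).comp (h1 _)
    · exact (hA.tendsto _).comp (h1 _)
  refine le_of_tendsto ((ENNReal.continuous_ofReal.tendsto _).comp hlim)
    (Eventually.of_forall fun j => ?_)
  refine le_trans (ENNReal.ofReal_le_ofReal ?_) (le_iSup (fun j => ENNReal.ofReal (dyadicVar A K j)) j)
  refine sum_abs_sub_le_of_index (fun l : ℕ => A ((l : ℕ) / 2 ^ j))
    (k := fun n => ⌊s n * (2 : ℝ≥0) ^ j⌋₊) (fun a b hab => Nat.floor_mono ?_) N ?_
  · exact mul_le_mul_left (hs hab) _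
  · have : s N * (2 : ℝ≥0) ^ j ≤ ((K * 2 ^ j : ℕ) : ℝ≥0) := by
      push_cast; exact mul_le_mul_left hN _
    exact (Nat.floor_mono this).trans (by rw [Nat.floor_natCast])

/-- Continuous adapted processes of locally bounded variation are good integrators: the total
variation on `[0, K]` is a finite random variable, hence bounded in probability. -/
lemma integ_incr_of_boundedVariation [IsProbabilityMeasure μ] {A : ℝ≥0 → Ω → ℝ}
    (hA : StronglyAdapted ℱ A) (hAc : ∀ ω, Continuous fun t => A t ω)
    (hv : ∀ ω, LocallyBoundedVariationOn (fun t => A t ω) Set.univ) :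
    Integ ℱ μ (fun _ => ⊤) T (incr A) := by
  obtain ⟨K, hK⟩ := exists_nat_ge T
  refine Integ.of_abs fun η hη => ?_
  set V : Ω → ℝ≥0∞ := fun ω => ⨆ j, ENNReal.ofReal (dyadicVar (fun t => A t ω) K j) with hV
  have hVm : Measurable V := by
    refine Measurable.iSup fun j => ENNReal.measurable_ofReal.comp ?_
    refine Finset.measurable_fun_sum _ fun k _ => ?_
    have hm : ∀ t, Measurable (A t) := fun t => ((hA t).mono (ℱ.le t)).measurable
    exact ((hm _).sub (hm _)).abs
  have hVfin : ∀ ω, V ω ≠ ∞ := fun ω => by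
    have h1 : eVariationOn (fun t => A t ω) (Set.univ ∩ Set.Icc 0 (K : ℝ≥0)) ≠ ∞ :=
      hv ω 0 K (Set.mem_univ _) (Set.mem_univ _)
    refine ne_top_of_le_ne_top h1 (iSup_le fun j => ?_)
    have h2 := eVariationOn.sum_le (f := fun t => A t ω) (n := K * 2 ^ j)
      (s := Set.univ ∩ Set.Icc 0 (K : ℝ≥0))
      (u := fun k : ℕ => min ((k : ℝ≥0) / 2 ^ j) K)
      (fun a b hab => min_le_min_right _ (by gcongr))
      (fun k => ⟨Set.mem_univ _, zero_le, min_le_right _ _⟩)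
    refine le_trans (le_of_eq ?_) h2
    rw [dyadicVar, ENNReal.ofReal_sum_of_nonneg fun _ _ => abs_nonneg _]
    refine Finset.sum_congr rfl fun k hk => ?_
    have hk' := Finset.mem_range.1 hk
    have e : ∀ m : ℕ, m ≤ K * 2 ^ j → min ((m : ℝ≥0) / 2 ^ j) K = (m : ℝ≥0) / 2 ^ j :=
      fun m hm => by
        refine min_eq_left ((div_le_iff₀ (by positivity)).2 ?_)
        exact_mod_cast hm
    rw [e k hk'.le, e (k + 1) hk', edist_dist, Real.dist_eq]
  obtain ⟨C, hC⟩ := exists_measure_lt_le (μ := μ) hVm hVfin hη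
  refine ⟨C + 1, by positivity, ?_⟩
  filter_upwards [eventually_isPartition T one_pos] with i hi
  refine le_trans (measure_mono fun ω hω => ?_) hC
  simp only [Set.mem_ofPred_eq, not_forall, not_le] at hω ⊢
  obtain ⟨t, ht, hlt⟩ := hω
  have h1 := sum_abs_le_iSup_dyadicVar (hAc ω) (K := K) (s := fun n => min (i.2.2 n) t)
    (fun a b hab => min_le_min_right _ (hi.mono hab)) (N := i.2.1)
    ((min_le_right _ _).trans (ht.1.trans hK))
  refine lt_of_lt_of_le ?_ h1
  rw [gridSum, abs_of_nonneg (Finset.sum_nonneg fun _ _ => abs_nonneg _)] at hlt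
  rw [← ENNReal.ofReal_natCast]
  have hlt' : (C : ℝ) + 1
      < ∑ n ∈ Finset.range i.2.1, |A (min (i.2.2 (n + 1)) t) ω - A (min (i.2.2 n) t) ω| := hlt
  have hC0 : (0 : ℝ) ≤ C := Nat.cast_nonneg C
  exact (ENNReal.ofReal_lt_ofReal_iff (by linarith)).2 (by linarith)

lemma IsContSemimartingale.isGoodIntegrator [IsProbabilityMeasure μ] {X : ℝ≥0 → Ω → ℝ}
    (hX : IsContSemimartingale ℱ μ X) : IsGoodIntegrator ℱ μ X := by
  obtain ⟨M, A, hM, hMc, hMl, hA, hAc, hAv, hXMA⟩ := hX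
  have h1 : IsGoodIntegrator ℱ μ M :=
    ⟨⟨hM, hMc⟩, fun T => integ_incr_of_local_martingale hMl hMc⟩
  have h2 : IsGoodIntegrator ℱ μ A :=
    ⟨⟨hA, hAc⟩, fun T => integ_incr_of_boundedVariation hA hAc hAv⟩
  have e : X = fun t ω => M t ω + A t ω := by ext t ω; exact hXMA t ω
  exact e ▸ h1.add h2

end Martingales

/-! ### Continuous adapted processes -/

section ContAdapted

set_option linter.unusedSectionVars false

variable {Ω : Type*} [mΩ : MeasurableSpace Ω] {ℱ : Filtration ℝ≥0 mΩ} {μ : Measure Ω}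
  {τ : Ω → WithTop ℝ≥0} {T : ℝ≥0} {η : ℝ≥0∞} {X Y Z : ℝ≥0 → Ω → ℝ}

lemma IsContAdapted.mul (hX : IsContAdapted ℱ X) (hY : IsContAdapted ℱ Y) :
    IsContAdapted ℱ (fun t ω => X t ω * Y t ω) :=
  ⟨hX.adapted.mul hY.adapted, fun ω => (hX.cont ω).mul (hY.cont ω)⟩

lemma IsContAdapted.sub (hX : IsContAdapted ℱ X) (hY : IsContAdapted ℱ Y) :
    IsContAdapted ℱ (fun t ω => X t ω - Y t ω) :=
  ⟨hX.adapted.sub hY.adapted, fun ω => (hX.cont ω).sub (hY.cont ω)⟩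

lemma isContAdapted_const (c : ℝ) : IsContAdapted ℱ (fun _ (_ : Ω) => c) :=
  ⟨stronglyAdapted_const _ _, fun _ => continuous_const⟩

lemma IsContAdapted.neg (hX : IsContAdapted ℱ X) : IsContAdapted ℱ (fun t ω => -X t ω) :=
  ⟨hX.adapted.neg, fun ω => (hX.cont ω).neg⟩

lemma IsContAdapted.comp {g : ℝ → ℝ} (hg : Continuous g) (hX : IsContAdapted ℱ X) :
    IsContAdapted ℱ (fun t ω => g (X t ω)) :=
  ⟨stronglyAdapted_comp hg hX.adapted, fun ω => hg.comp (hX.cont ω)⟩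

lemma IsContAdapted.sum {κ : Type*} {s : Finset κ} {X : κ → ℝ≥0 → Ω → ℝ}
    (hX : ∀ k, IsContAdapted ℱ (X k)) : IsContAdapted ℱ (fun t ω => ∑ k ∈ s, X k t ω) :=
  ⟨fun t => Finset.stronglyMeasurable_fun_sum s fun k _ => (hX k).adapted t,
    fun ω => continuous_finsetSum _ fun k _ => (hX k).cont ω⟩

lemma IsContAdapted.measurable (hX : IsContAdapted ℱ X) (t : ℝ≥0) : Measurable (X t) :=
  ((hX.adapted t).mono (ℱ.le t)).measurable

/-- A continuous process is bounded on `[0, T]` off an event of small probability. The exceptional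
events are replaced by measurable ones, which refer to a countable dense set of times only. -/
lemma IsContAdapted.exists_bound [IsProbabilityMeasure μ] (hX : IsContAdapted ℱ X) (T : ℝ≥0)
    (hη : 0 < η) : ∃ C : ℝ, 0 < C ∧ μ {ω | ¬ ∀ t ≤ T, |X t ω| ≤ C} ≤ η := by
  obtain ⟨D, hDc, hD⟩ := TopologicalSpace.exists_countable_dense ℝ≥0
  set B : ℕ → Set Ω := fun k => ⋃ t ∈ D, {ω | t < T + 1 ∧ (k : ℝ) < |X t ω|} with hB
  obtain ⟨k, hk⟩ : ∃ k, μ (B k) ≤ η := by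
    refine exists_measure_le_of_antitone (fun a b hab ω hω => ?_) (fun k => ?_) ?_ hη
    · simp only [hB, Set.mem_iUnion] at hω ⊢
      obtain ⟨t, ht, h1, h2⟩ := hω
      exact ⟨t, ht, h1, lt_of_le_of_lt (by exact_mod_cast hab) h2⟩
    · exact MeasurableSet.biUnion hDc fun t _ => (MeasurableSet.const _).inter
        (measurableSet_lt measurable_const (hX.measurable t).abs)
    · ext ω
      simp only [Set.mem_iInter, Set.mem_empty_iff_false, iff_false, not_forall]
      obtain ⟨C, hC⟩ := (isCompact_Icc (a := (0 : ℝ≥0)) (b := T + 1)).exists_bound_of_continuousOn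
        (hX.cont ω).continuousOn
      obtain ⟨k, hk⟩ := exists_nat_ge C
      refine ⟨k, fun hω => ?_⟩
      simp only [hB, Set.mem_iUnion] at hω
      obtain ⟨t, ht, h1, h2⟩ := hω
      have := hC t ⟨zero_le, h1.le⟩
      rw [Real.norm_eq_abs] at this
      linarith
  refine ⟨k + 1, by positivity, (measure_mono fun ω hω => ?_).trans hk⟩
  simp only [Set.mem_ofPred_eq, not_forall, not_le] at hω
  obtain ⟨t, ht, hlt⟩ := hω
  have hopen : IsOpen {s : ℝ≥0 | s < T + 1 ∧ (k : ℝ) < |X s ω|} :=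
    (isOpen_lt continuous_id continuous_const).inter
      (isOpen_lt continuous_const (hX.cont ω).abs)
  obtain ⟨s, hs, hsD⟩ := hD.exists_mem_open hopen
    ⟨t, ht.trans_lt (lt_add_one T), by linarith⟩
  exact Set.mem_biUnion hs hsD

/-- A continuous process is uniformly continuous on `[0, T]`, with a deterministic modulus, off an
event of small probability. -/
lemma IsContAdapted.exists_osc [IsProbabilityMeasure μ] (hX : IsContAdapted ℱ X) (T : ℝ≥0)
    {ε : ℝ} (hε : 0 < ε) (hη : 0 < η) : ∃ δ : ℝ, 0 < δ ∧
      μ {ω | ¬ ∀ s ≤ T, ∀ t ≤ T, |(s : ℝ) - t| ≤ δ → |X s ω - X t ω| < ε} ≤ η := by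
  obtain ⟨D, hDc, hD⟩ := TopologicalSpace.exists_countable_dense ℝ≥0
  set B : ℕ → Set Ω := fun k => ⋃ s ∈ D, ⋃ t ∈ D, {ω | (s < T + 1 ∧ t < T + 1 ∧
    |(s : ℝ) - t| < 1 / (k + 1)) ∧ ε / 2 < |X s ω - X t ω|} with hB
  obtain ⟨k, hk⟩ : ∃ k, μ (B k) ≤ η := by
    refine exists_measure_le_of_antitone (fun a b hab ω hω => ?_) (fun k => ?_) ?_ hη
    · simp only [hB, Set.mem_iUnion] at hω ⊢
      obtain ⟨s, hs, t, ht, ⟨h1, h2, h3⟩, h4⟩ := hω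
      exact ⟨s, hs, t, ht, ⟨h1, h2, h3.trans_le (one_div_le_one_div_of_le (by positivity)
        (by have : (a : ℝ) ≤ b := by exact_mod_cast hab
            linarith))⟩, h4⟩
    · exact MeasurableSet.biUnion hDc fun s _ => MeasurableSet.biUnion hDc fun t _ =>
        (MeasurableSet.const _).inter
        (measurableSet_lt measurable_const ((hX.measurable s).sub (hX.measurable t)).abs)
    · ext ω
      simp only [Set.mem_iInter, Set.mem_empty_iff_false, iff_false, not_forall]
      have huc := (isCompact_Icc (a := (0 : ℝ≥0)) (b := T + 1)).uniformContinuousOn_of_continuous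
        (hX.cont ω).continuousOn
      obtain ⟨δ, hδ, h⟩ := Metric.uniformContinuousOn_iff.1 huc (ε / 2) (half_pos hε)
      obtain ⟨k, hk⟩ := exists_nat_one_div_lt hδ
      refine ⟨k, fun hω => ?_⟩
      simp only [hB, Set.mem_iUnion] at hω
      obtain ⟨s, hs, t, ht, ⟨h1, h2, h3⟩, h4⟩ := hω
      have := h s ⟨zero_le, h1.le⟩ t ⟨zero_le, h2.le⟩ (by
        rw [NNReal.dist_eq]; exact h3.trans hk)
      rw [Real.dist_eq] at this
      linarith
  refine ⟨1 / (2 * (k + 1)), by positivity, (measure_mono fun ω hω => ?_).trans hk⟩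
  simp only [Set.mem_ofPred_eq, not_forall, not_lt] at hω
  obtain ⟨s, hs, t, ht, hst, hle⟩ := hω
  have hopen : IsOpen {x : ℝ≥0 × ℝ≥0 | (x.1 < T + 1 ∧ x.2 < T + 1 ∧
      |(x.1 : ℝ) - x.2| < 1 / (k + 1)) ∧ ε / 2 < |X x.1 ω - X x.2 ω|} := by
    have c1 : Continuous fun x : ℝ≥0 × ℝ≥0 => X x.1 ω := (hX.cont ω).comp continuous_fst
    have c2 : Continuous fun x : ℝ≥0 × ℝ≥0 => X x.2 ω := (hX.cont ω).comp continuous_snd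
    have c3 : Continuous fun x : ℝ≥0 × ℝ≥0 => |(x.1 : ℝ) - x.2| := by fun_prop
    exact ((isOpen_lt continuous_fst continuous_const).inter
      ((isOpen_lt continuous_snd continuous_const).inter (isOpen_lt c3 continuous_const))).inter
      (isOpen_lt continuous_const (c1.sub c2).abs)
  obtain ⟨⟨a, b⟩, hab, hm⟩ := (hD.prod hD).exists_mem_open hopen
    ⟨(s, t), ⟨hs.trans_lt (lt_add_one T), ht.trans_lt (lt_add_one T), hst.trans_lt (by
      rw [one_div_lt_one_div (by positivity) (by positivity)]
      linarith [(Nat.cast_nonneg k : (0 : ℝ) ≤ k)])⟩, by simp only; linarith⟩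
  exact Set.mem_biUnion hab.1 (Set.mem_biUnion hab.2 hm)

lemma IsContAdapted.whp_bound [IsProbabilityMeasure μ] (hX : IsContAdapted ℱ X) (T : ℝ≥0)
    (hη : 0 < η) : ∃ C : ℝ, 0 < C ∧ Whp μ T η fun _ ω => ∀ t ≤ T, |X t ω| ≤ C := by
  obtain ⟨C, hC, h⟩ := hX.exists_bound (μ := μ) T hη
  exact ⟨C, hC, Eventually.of_forall fun _ => h⟩

lemma IsContAdapted.bdd [IsProbabilityMeasure μ] (hX : IsContAdapted ℱ X) :
    Bdd μ τ T (fun _ => X) := fun η hη => by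
  obtain ⟨C, hC, h⟩ := hX.whp_bound (μ := μ) T hη
  exact ⟨C, hC, h.mono (Eventually.of_forall fun _ _ h t ht => h t ht.1)⟩

lemma abs_min_sub_min_le (a b c : ℝ≥0) :
    |((min a c : ℝ≥0) : ℝ) - (min b c : ℝ≥0)| ≤ |(a : ℝ) - b| := by
  rw [NNReal.coe_min, NNReal.coe_min]
  refine (abs_min_sub_min_le_max _ _ _ _).trans ?_
  rw [sub_self, abs_zero, max_eq_left (abs_nonneg _)]

lemma IsPartition.abs_min_sub_le {δ : ℝ} {N : ℕ} {σ : ℕ → ℝ≥0} (h : IsPartition T δ N σ) {n : ℕ}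
    (hn : n < N) (t : ℝ≥0) :
    |((min (σ (n + 1)) t : ℝ≥0) : ℝ) - (min (σ n) t : ℝ≥0)| ≤ δ := by
  refine (abs_min_sub_min_le _ _ _).trans ?_
  rw [abs_of_nonneg (sub_nonneg.2 (NNReal.coe_le_coe.2 (h.mono (Nat.le_succ n))))]
  exact h.mesh n hn

lemma IsContAdapted.unifSmall_incr [IsProbabilityMeasure μ] (hX : IsContAdapted ℱ X) :
    UnifSmall μ τ T (incr X) := fun ε hε η hη => by
  obtain ⟨δ, hδ, h⟩ := hX.exists_osc (μ := μ) T hε hη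
  filter_upwards [eventually_isPartition T hδ] with i hi
  refine (measure_mono ?_).trans h
  intro ω hω hp
  refine hω fun t ht n hn => ?_
  exact hp _ ((min_le_right _ _).trans ht.1) _ ((min_le_right _ _).trans ht.1)
    (hi.abs_min_sub_le hn t)

/-! ### Quadratic variation sums -/

lemma IsPartition.min_right {δ : ℝ} {N : ℕ} {σ : ℕ → ℝ≥0} (h : IsPartition T δ N σ) {t : ℝ≥0}
    (ht : t ≤ T) : min (σ N) t = t := by rw [h.right, min_eq_right ht]

lemma IsPartition.min_left {δ : ℝ} {N : ℕ} {σ : ℕ → ℝ≥0} (h : IsPartition T δ N σ) (t : ℝ≥0) :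
    min (σ 0) t = 0 := by rw [h.left, min_eq_left zero_le]

lemma gridSum_incr {δ : ℝ} {i : GridIndex} (hi : IsPartition T δ i.2.1 i.2.2) {t : ℝ≥0}
    (ht : t ≤ T) (X : ℝ≥0 → Ω → ℝ) (ω : Ω) : gridSum (incr X) i t ω = X t ω - X 0 ω := by
  simp only [gridSum, incr]
  rw [Finset.sum_range_sub (fun n => X (min (i.2.2 n) t) ω), hi.min_right ht, hi.min_left]

lemma incr_mul (X Y : ℝ≥0 → Ω → ℝ) (i : GridIndex) (n : ℕ) (t : ℝ≥0) (ω : Ω) :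
    incr (fun t ω => X t ω * Y t ω) i n t ω = leftVal X i n t ω * incr Y i n t ω
      + leftVal Y i n t ω * incr X i n t ω + incr X i n t ω * incr Y i n t ω := by
  simp only [incr, leftVal]; ring

/-- The discrete Itô formula `∑ (ΔX)² = X² - X₀² - 2 ∑ X ΔX`. -/
lemma gridSum_sq_incr {δ : ℝ} {i : GridIndex} (hi : IsPartition T δ i.2.1 i.2.2) {t : ℝ≥0}
    (ht : t ≤ T) (X : ℝ≥0 → Ω → ℝ) (ω : Ω) :
    gridSum (fun i n t ω => incr X i n t ω ^ 2) i t ω = X t ω * X t ω - X 0 ω * X 0 ω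
      - 2 * gridSum (fun i n t ω => leftVal X i n t ω * incr X i n t ω) i t ω := by
  rw [← gridSum_incr hi ht (fun t ω => X t ω * X t ω)]
  simp only [gridSum]
  rw [Finset.mul_sum, ← Finset.sum_sub_distrib]
  refine Finset.sum_congr rfl fun n _ => ?_
  rw [incr_mul]; ring

/-- The sums of squared increments of `X` are bounded in probability. -/
def HasBddQV (μ : Measure Ω) (X : ℝ≥0 → Ω → ℝ) : Prop :=
  ∀ T, Bdd μ (fun _ => ⊤) T (gridSum fun i n t ω => incr X i n t ω ^ 2)

lemma Bdd.of_top {S : GridIndex → ℝ≥0 → Ω → ℝ} (h : Bdd μ (fun _ => ⊤) T S) : Bdd μ τ T S :=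
  fun η hη => by
  obtain ⟨C, hC, hw⟩ := h η hη
  exact ⟨C, hC, hw.mono (Eventually.of_forall fun _ _ h t ht => h t ⟨ht.1, le_top⟩)⟩

lemma Small.of_top {S : GridIndex → ℝ≥0 → Ω → ℝ} (h : Small μ (fun _ => ⊤) T S) : Small μ τ T S :=
  fun ε hε η hη => (h ε hε η hη).mono
    (Eventually.of_forall fun _ _ h t ht => h t ⟨ht.1, le_top⟩)

/-- By the discrete Itô formula, since `X` itself is an integrand which is bounded in
probability. -/
lemma IsGoodIntegrator.hasBddQV [IsProbabilityMeasure μ] (hX : IsGoodIntegrator ℱ μ X) :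
    HasBddQV μ X := fun T => by
  have hb := hX.toIsContAdapted.bdd (μ := μ) (τ := fun _ => ⊤) (T := T)
  have h0 : Bdd μ (fun _ => ⊤) T (fun _ _ ω => X 0 ω) := fun η hη => by
    obtain ⟨C, hC, h⟩ := hX.toIsContAdapted.whp_bound (μ := μ) T hη
    exact ⟨C, hC, h.mono (Eventually.of_forall fun _ _ h t ht => h 0 zero_le)⟩
  have h1 := (hX.integ T).bdd (fun _ => hX.adapted) hb
  refine (((hb.mul hb).add (h0.mul h0).neg).add ((bdd_const (-2)).mul h1)).of_abs_le ?_
  filter_upwards [eventually_isPartition T one_pos] with i hi ω t ht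
  refine le_of_eq (congrArg _ ?_)
  rw [gridSum_sq_incr hi ht.1]; ring

lemma HasBddQV.of_abs_incr_le (hX : HasBddQV μ X)
    (h : ∀ T, ∀ η : ℝ≥0∞, 0 < η → ∃ C : ℝ, Whp μ T η fun _ ω => ∀ s ≤ T, ∀ t ≤ T,
      |Z s ω - Z t ω| ≤ C * |X s ω - X t ω|) : HasBddQV μ Z := fun T η hη => by
  obtain ⟨C, hw⟩ := h T _ (ENNReal.half_pos hη.ne')
  obtain ⟨K, hK, hw'⟩ := hX T _ (ENNReal.half_pos hη.ne')
  refine ⟨(C ^ 2 + 1) * K, by positivity, (hw.and hw').mono (Eventually.of_forall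
    fun i ω hω t ht => ?_)⟩
  have h2 := hω.2 t ht
  have e : ∀ X : ℝ≥0 → Ω → ℝ, |gridSum (fun i n t ω => incr X i n t ω ^ 2) i t ω|
      = ∑ n ∈ Finset.range i.2.1, incr X i n t ω ^ 2 := fun X =>
    abs_of_nonneg (Finset.sum_nonneg fun _ _ => sq_nonneg _)
  rw [e] at h2 ⊢
  calc _ ≤ ∑ n ∈ Finset.range i.2.1, C ^ 2 * incr X i n t ω ^ 2 := by
        refine Finset.sum_le_sum fun n _ => ?_
        have h3 := hω.1 (min (i.2.2 (n + 1)) t) ((min_le_right _ _).trans ht.1)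
          (min (i.2.2 n) t) ((min_le_right _ _).trans ht.1)
        have h4 := pow_le_pow_left₀ (abs_nonneg _) h3 2
        rw [mul_pow, sq_abs, sq_abs] at h4
        exact h4
    _ = C ^ 2 * ∑ n ∈ Finset.range i.2.1, incr X i n t ω ^ 2 := by rw [Finset.mul_sum]
    _ ≤ (C ^ 2 + 1) * K := by
        refine mul_le_mul (by linarith) h2 (Finset.sum_nonneg fun _ _ => sq_nonneg _)
          (by positivity)

lemma exists_lipschitz_of_contDiff {g : ℝ → ℝ} (hg : ContDiff ℝ 1 g) (R : ℝ) :
    ∃ C : ℝ, 0 ≤ C ∧ ∀ a b, |a| ≤ R → |b| ≤ R → |g a - g b| ≤ C * |a - b| := by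
  obtain ⟨C, hC⟩ := (isCompact_Icc (a := -R) (b := R)).exists_bound_of_continuousOn
    (hg.continuous_deriv le_rfl).continuousOn
  refine ⟨max C 0, le_max_right _ _, fun a b ha hb => ?_⟩
  have := (convex_Icc (-R) R).norm_image_sub_le_of_norm_deriv_le (f := g) (C := max C 0)
    (fun x _ => (hg.differentiable one_ne_zero).differentiableAt)
    (fun x hx => (hC x hx).trans (le_max_left _ _)) (abs_le.1 hb) (abs_le.1 ha)
  simpa only [Real.norm_eq_abs] using this

lemma HasBddQV.comp [IsProbabilityMeasure μ] {g : ℝ → ℝ} (hg : ContDiff ℝ 1 g)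
    (hXc : IsContAdapted ℱ X) (hX : HasBddQV μ X) : HasBddQV μ (fun t ω => g (X t ω)) := by
  refine hX.of_abs_incr_le fun T η hη => ?_
  obtain ⟨R, hR, h⟩ := hXc.whp_bound (μ := μ) T hη
  obtain ⟨C, hC, hCl⟩ := exists_lipschitz_of_contDiff hg R
  exact ⟨C, h.mono (Eventually.of_forall fun i ω hω s hs t ht => hCl _ _ (hω s hs) (hω t ht))⟩

lemma HasBddQV.mul [IsProbabilityMeasure μ] (hXc : IsContAdapted ℱ X) (hX : HasBddQV μ X)
    (hYc : IsContAdapted ℱ Y) (hY : HasBddQV μ Y) : HasBddQV μ (fun t ω => X t ω * Y t ω) :=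
  fun T η hη => by
  obtain ⟨A, hA, hAw⟩ := hXc.whp_bound (μ := μ) T (ENNReal.half_pos (ENNReal.half_pos hη.ne').ne')
  obtain ⟨B, hB, hBw⟩ := hYc.whp_bound (μ := μ) T (ENNReal.half_pos (ENNReal.half_pos hη.ne').ne')
  obtain ⟨K, hK, hKw⟩ := ((hX T).add (hY T)) _ (ENNReal.half_pos hη.ne')
  refine ⟨2 * (A ^ 2 + B ^ 2) * K, by positivity, ((hAw.and hBw).and hKw).mono
    (Eventually.of_forall fun i ω hω t ht => ?_)⟩
  obtain ⟨⟨hA', hB'⟩, hK'⟩ := hω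
  have h2 := (le_abs_self _).trans (hK' t ht)
  simp only [gridSum] at h2 ⊢
  rw [← Finset.sum_add_distrib] at h2
  rw [abs_of_nonneg (Finset.sum_nonneg fun _ _ => sq_nonneg _)]
  refine le_trans ?_ (mul_le_mul_of_nonneg_left h2 (by positivity))
  rw [Finset.mul_sum]
  refine Finset.sum_le_sum fun n _ => ?_
  have e : incr (fun t ω => X t ω * Y t ω) i n t ω = X (min (i.2.2 (n + 1)) t) ω * incr Y i n t ω
      + Y (min (i.2.2 n) t) ω * incr X i n t ω := by simp only [incr]; ring
  rw [e]
  have hx : X (min (i.2.2 (n + 1)) t) ω ^ 2 ≤ A ^ 2 :=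
    sq_le_sq.2 ((hA' _ ((min_le_right _ _).trans ht.1)).trans (le_abs_self A))
  have hy : Y (min (i.2.2 n) t) ω ^ 2 ≤ B ^ 2 :=
    sq_le_sq.2 ((hB' _ ((min_le_right _ _).trans ht.1)).trans (le_abs_self B))
  set x := X (min (i.2.2 (n + 1)) t) ω
  set y := Y (min (i.2.2 n) t) ω
  set a := incr Y i n t ω
  set b := incr X i n t ω
  have h5 : (x * a + y * b) ^ 2 ≤ 2 * (x ^ 2 * a ^ 2 + y ^ 2 * b ^ 2) := by
    nlinarith [sq_nonneg (x * a - y * b)]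
  have h6 : x ^ 2 * a ^ 2 ≤ A ^ 2 * a ^ 2 := by gcongr
  have h7 : y ^ 2 * b ^ 2 ≤ B ^ 2 * b ^ 2 := by gcongr
  nlinarith [mul_nonneg (sq_nonneg A) (sq_nonneg b), mul_nonneg (sq_nonneg B) (sq_nonneg a)]

lemma bdd_gridSum_abs_incr_mul (hX : HasBddQV μ X) (hY : HasBddQV μ Y) :
    Bdd μ τ T (gridSum fun i n t ω => |incr X i n t ω * incr Y i n t ω|) :=
  bdd_gridSum_abs_mul (hX T).of_top (hY T).of_top

/-- By the discrete product rule for increments. -/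
lemma IsGoodIntegrator.mul [IsProbabilityMeasure μ] (hX : IsGoodIntegrator ℱ μ X)
    (hY : IsGoodIntegrator ℱ μ Y) : IsGoodIntegrator ℱ μ (fun t ω => X t ω * Y t ω) where
  toIsContAdapted := hX.toIsContAdapted.mul hY.toIsContAdapted
  integ T := by
    have h1 := (hY.integ T).mul_leftVal (Y := fun _ => X) (fun _ => hX.adapted)
      hX.toIsContAdapted.bdd
    have h2 := (hX.integ T).mul_leftVal (Y := fun _ => Y) (fun _ => hY.adapted)
      hY.toIsContAdapted.bdd
    have h3 : Integ ℱ μ (fun _ => ⊤) T (fun i n t ω => incr X i n t ω * incr Y i n t ω) :=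
      Integ.of_abs (bdd_gridSum_abs_incr_mul hX.hasBddQV hY.hasBddQV)
    exact ((h1.add h2).add h3).congr fun i n t ω => incr_mul X Y i n t ω

end ContAdapted

/-! ### Time integrals and backward averages -/

section Averages

set_option linter.unusedSectionVars false

/-- The clamped time `min s t` extends to all real times a function which is only defined up to
`t`. -/
lemma stronglyMeasurable_integral_of_progressive_aux {Ω : Type*} {m : MeasurableSpace Ω}
    {t : ℝ≥0} {f : Set.Iic t × Ω → ℝ} (hf : StronglyMeasurable f) :
    StronglyMeasurable fun ω => ∫ s in (0 : ℝ)..t,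
      f (⟨min s.toNNReal t, Set.mem_Iic.2 (min_le_right _ _)⟩, ω) := by
  have hg : Measurable fun x : Ω × ℝ => ((⟨min x.2.toNNReal t, Set.mem_Iic.2 (min_le_right _ _)⟩, x.1) :
      Set.Iic t × Ω) := by
    refine Measurable.prodMk (Measurable.subtype_mk ?_) measurable_fst
    exact (measurable_snd.real_toNNReal).min measurable_const
  have h2 : StronglyMeasurable fun x : Ω × ℝ => f (⟨min x.2.toNNReal t, Set.mem_Iic.2 (min_le_right _ _)⟩, x.1) :=
    hf.comp_measurable hg
  simp only [intervalIntegral.integral_of_le (NNReal.coe_nonneg t)]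
  exact h2.integral_prod_right' (ν := volume.restrict (Set.Ioc (0 : ℝ) t))

variable {Ω : Type*} [mΩ : MeasurableSpace Ω] {ℱ : Filtration ℝ≥0 mΩ} {μ : Measure Ω}
  {τ : Ω → WithTop ℝ≥0} {T : ℝ≥0} {η : ℝ≥0∞} {X Y Z : ℝ≥0 → Ω → ℝ}

lemma stronglyMeasurable_integral_of_progressive {B : ℝ≥0 → Ω → ℝ}
    (hB : IsStronglyProgressive ℱ B) (t : ℝ≥0) :
    StronglyMeasurable[ℱ t] fun ω => ∫ s in (0 : ℝ)..t, B s.toNNReal ω := by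
  have h := @stronglyMeasurable_integral_of_progressive_aux Ω (ℱ t) t _ (hB t)
  refine (congrArg (@StronglyMeasurable Ω ℝ _ (ℱ t)) ?_).mp h
  ext ω
  refine intervalIntegral.integral_congr fun s hs => ?_
  rw [Set.uIcc_of_le (NNReal.coe_nonneg t)] at hs
  have : min s.toNNReal t = s.toNNReal := min_eq_left (Real.toNNReal_le_iff_le_coe.2 hs.2)
  simp only [this]

/-- The primitive `∫₀ᵗ Z ds`, where `Z` is extended to negative times by its initial value. -/
def timeInt (Z : ℝ≥0 → Ω → ℝ) (t : ℝ) (ω : Ω) : ℝ := ∫ s in (0 : ℝ)..t, Z s.toNNReal ω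

/-- The average of `Z` over `[t - h, t]`, where `Z` is extended to negative times by its initial
value. -/
def backAvg (h : ℝ) (Z : ℝ≥0 → Ω → ℝ) (t : ℝ≥0) (ω : Ω) : ℝ :=
  (timeInt Z t ω - timeInt Z (t - h) ω) / h

/-- The time derivative of `backAvg h Z`. -/
def backAvgDeriv (h : ℝ) (Z : ℝ≥0 → Ω → ℝ) (s : ℝ) (ω : Ω) : ℝ :=
  (Z s.toNNReal ω - Z (s - h).toNNReal ω) / h

lemma IsContAdapted.continuous_real (hZ : IsContAdapted ℱ Z) (ω : Ω) :
    Continuous fun s : ℝ => Z s.toNNReal ω := (hZ.cont ω).comp continuous_real_toNNReal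

lemma IsContAdapted.continuous_timeInt (hZ : IsContAdapted ℱ Z) (ω : Ω) :
    Continuous fun t : ℝ => timeInt Z t ω :=
  intervalIntegral.continuous_primitive
    (fun a b => (hZ.continuous_real ω).intervalIntegrable a b) 0

lemma IsContAdapted.continuous_backAvgDeriv (hZ : IsContAdapted ℱ Z) (h : ℝ) (ω : Ω) :
    Continuous fun s : ℝ => backAvgDeriv h Z s ω :=
  ((hZ.continuous_real ω).sub ((hZ.continuous_real ω).comp (continuous_id.sub
    continuous_const))).div_const h

lemma IsContAdapted.stronglyMeasurable_timeInt (hZ : IsContAdapted ℱ Z) {r : ℝ} {t : ℝ≥0}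
    (hr : r ≤ t) : StronglyMeasurable[ℱ t] fun ω => timeInt Z r ω := by
  rcases le_total 0 r with h0 | h0
  · have h := stronglyMeasurable_integral_of_progressive
      (hZ.adapted.isStronglyProgressive_of_continuous hZ.cont) r.toNNReal
    rw [Real.coe_toNNReal _ h0] at h
    exact h.mono (ℱ.mono (Real.toNNReal_le_iff_le_coe.2 hr))
  · have e : (fun ω => timeInt Z r ω) = fun ω => r * Z 0 ω := by
      ext ω
      have : timeInt Z r ω = ∫ _ in (0 : ℝ)..r, Z 0 ω := by
        refine intervalIntegral.integral_congr fun s hs => ?_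
        rw [Set.uIcc_of_ge h0] at hs
        simp only [Real.toNNReal_of_nonpos hs.2]
      rw [this, intervalIntegral.integral_const, sub_zero, smul_eq_mul]
    rw [e]
    exact ((hZ.adapted 0).mono (ℱ.mono zero_le)).const_mul r

lemma IsContAdapted.backAvg (hZ : IsContAdapted ℱ Z) {h : ℝ} (hh : 0 ≤ h) :
    IsContAdapted ℱ (backAvg h Z) where
  adapted t := by
    have h1 := (hZ.stronglyMeasurable_timeInt (le_refl (t : ℝ))).sub
      (hZ.stronglyMeasurable_timeInt (r := t - h) (t := t) (by linarith))
    have h2 := h1.mul_const h⁻¹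
    refine (congrArg (@StronglyMeasurable Ω ℝ _ (ℱ t)) ?_).mp h2
    ext ω
    simp only [SCH.backAvg, div_eq_mul_inv, Pi.sub_apply]
  cont ω := by
    have h1 := (hZ.continuous_timeInt ω).comp NNReal.continuous_coe
    have h2 := (hZ.continuous_timeInt ω).comp (NNReal.continuous_coe.sub (continuous_const (y := h)))
    exact (h1.sub h2).div_const h

lemma IsContAdapted.backAvg_sub (hZ : IsContAdapted ℱ Z) (h : ℝ) (a b : ℝ≥0) (ω : Ω) :
    SCH.backAvg h Z b ω - SCH.backAvg h Z a ω = ∫ s in (a : ℝ)..b, backAvgDeriv h Z s ω := by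
  have hi : ∀ a b : ℝ, IntervalIntegrable (fun s : ℝ => Z s.toNNReal ω) volume a b :=
    fun a b => (hZ.continuous_real ω).intervalIntegrable a b
  have hc : Continuous fun s : ℝ => Z (s - h).toNNReal ω :=
    (hZ.continuous_real ω).comp (continuous_id.sub continuous_const)
  have e1 : timeInt Z b ω - timeInt Z a ω = ∫ s in (a : ℝ)..b, Z s.toNNReal ω :=
    intervalIntegral.integral_interval_sub_left (hi _ _) (hi _ _)
  have e2 : timeInt Z (b - h) ω - timeInt Z (a - h) ω = ∫ s in (a : ℝ)..b, Z (s - h).toNNReal ω := by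
    rw [intervalIntegral.integral_comp_sub_right (fun s => Z s.toNNReal ω) h]
    exact intervalIntegral.integral_interval_sub_left (hi _ _) (hi _ _)
  simp only [backAvgDeriv]
  rw [intervalIntegral.integral_div, intervalIntegral.integral_sub (hi _ _)
    (hc.intervalIntegrable _ _), ← e1, ← e2]
  simp only [SCH.backAvg]
  ring

lemma IsContAdapted.backAvg_sub_self (hZ : IsContAdapted ℱ Z) {h : ℝ} (hh : 0 < h) (t : ℝ≥0)
    (ω : Ω) {ε : ℝ} (hε : ∀ s ≤ t, |(s : ℝ) - t| ≤ h → |Z s ω - Z t ω| ≤ ε) :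
    |Z t ω - SCH.backAvg h Z t ω| ≤ ε := by
  have hi : ∀ a b : ℝ, IntervalIntegrable (fun s : ℝ => Z s.toNNReal ω) volume a b :=
    fun a b => (hZ.continuous_real ω).intervalIntegrable a b
  have e1 : timeInt Z t ω - timeInt Z (t - h) ω = ∫ s in ((t : ℝ) - h)..t, Z s.toNNReal ω :=
    intervalIntegral.integral_interval_sub_left (hi _ _) (hi _ _)
  have e2 : ∫ s in ((t : ℝ) - h)..t, (Z s.toNNReal ω - Z t ω)
      = (timeInt Z t ω - timeInt Z (t - h) ω) - h * Z t ω := by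
    rw [intervalIntegral.integral_sub (hi _ _) intervalIntegrable_const, e1]
    simp
  have e3 : Z t ω - SCH.backAvg h Z t ω
      = -(∫ s in ((t : ℝ) - h)..t, (Z s.toNNReal ω - Z t ω)) / h := by
    rw [e2]
    simp only [SCH.backAvg]
    field_simp
    ring
  have e4 : |∫ s in ((t : ℝ) - h)..t, (Z s.toNNReal ω - Z t ω)| ≤ ε * h := by
    have := intervalIntegral.norm_integral_le_of_norm_le_const (a := (t : ℝ) - h) (b := t)
      (f := fun s => Z s.toNNReal ω - Z t ω) (C := ε) fun s hs => ?_
    · simpa [abs_of_pos hh] using this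
    · rw [Set.uIoc_of_le (by linarith)] at hs
      refine hε _ (Real.toNNReal_le_iff_le_coe.2 hs.2) ?_
      rw [Real.coe_toNNReal', abs_le]
      have := t.2
      constructor
      · linarith [hs.1, le_max_left s 0]
      · have : max s 0 ≤ t := max_le hs.2 t.2
        linarith
  rw [e3, abs_div, abs_neg, abs_of_pos hh, div_le_iff₀ hh]
  exact e4

lemma abs_backAvgDeriv_le {h : ℝ} (hh : 0 < h) {C : ℝ} {ω : Ω} (hC : ∀ t ≤ T, |Z t ω| ≤ C) {s : ℝ}
    (hs : s ≤ T) : |backAvgDeriv h Z s ω| ≤ 2 * C / h := by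
  rw [backAvgDeriv, abs_div, abs_of_pos hh]
  gcongr
  refine (abs_sub _ _).trans ?_
  have h1 := hC s.toNNReal (Real.toNNReal_le_iff_le_coe.2 hs)
  have h2 := hC (s - h).toNNReal (Real.toNNReal_le_iff_le_coe.2 (by linarith))
  linarith

lemma IsContAdapted.abs_backAvg_le (hZ : IsContAdapted ℱ Z) {h : ℝ} (hh : 0 < h) {C : ℝ} {ω : Ω}
    (hC : ∀ t ≤ T, |Z t ω| ≤ C) {t : ℝ≥0} (ht : t ≤ T) : |SCH.backAvg h Z t ω| ≤ 3 * C := by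
  have h1 := hZ.backAvg_sub_self hh t ω (ε := 2 * C) fun s hs _ => by
    have := abs_sub (Z s ω) (Z t ω)
    linarith [hC s (hs.trans ht), hC t ht]
  have h2 := abs_sub_abs_le_abs_sub (SCH.backAvg h Z t ω) (Z t ω)
  rw [abs_sub_comm] at h2
  linarith [hC t ht]

/-- The backward averages approximate `Z` uniformly in probability as the smoothing parameter tends
to `0`. -/
lemma IsContAdapted.small_sub_backAvg [IsProbabilityMeasure μ] (hZ : IsContAdapted ℱ Z) :
    Small μ τ T (fun i t ω => Z t ω - SCH.backAvg i.1 Z t ω) := fun ε hε η hη => by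
  obtain ⟨δ, hδ, hw⟩ := hZ.exists_osc (μ := μ) T (half_pos hε) hη
  refine eventually_gridFilter_iff.2 ?_
  filter_upwards [Ioo_mem_nhdsGT hδ] with h hh
  refine Eventually.of_forall fun π => (measure_mono ?_).trans hw
  intro ω hω hp
  refine hω fun t ht => ?_
  refine (hZ.backAvg_sub_self hh.1 t ω fun s hs hsh => ?_).trans_lt (half_lt_self hε)
  exact (hp s (hs.trans ht.1) t ht.1 (hsh.trans hh.2.le)).le

/-- A Riemann-sum estimate: replacing `x` on each partition interval by a nearby constant changes
`∫ x b` little. -/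
lemma abs_sum_sub_integral_le {δ : ℝ} {N : ℕ} {σ : ℕ → ℝ≥0} (hσ : IsPartition T δ N σ) {t : ℝ≥0}
    (ht : t ≤ T) {b x : ℝ → ℝ} {ξ : ℕ → ℝ} {ε C : ℝ}
    (hb : IntervalIntegrable b volume 0 t) (hbC : ∀ s : ℝ, 0 ≤ s → s ≤ t → |b s| ≤ C)
    (hx : Continuous x)
    (hξ : ∀ n < N, ∀ s : ℝ, (min (σ n) t : ℝ≥0) ≤ s → s ≤ (min (σ (n + 1)) t : ℝ≥0) →
      |ξ n - x s| ≤ ε) :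
    |∑ n ∈ Finset.range N, ξ n * (∫ s in ((min (σ n) t : ℝ≥0) : ℝ)..(min (σ (n + 1)) t : ℝ≥0), b s)
      - ∫ s in (0 : ℝ)..t, x s * b s| ≤ ε * C * t := by
  set a : ℕ → ℝ := fun n => (min (σ n) t : ℝ≥0) with ha
  have ha0 : a 0 = 0 := by simp [ha, hσ.left]
  have haN : a N = t := by simp only [ha, hσ.min_right ht]
  have ham : Monotone a := fun m n hmn =>
    NNReal.coe_le_coe.2 (min_le_min_right _ (hσ.mono hmn))
  have hat : ∀ n, a n ≤ t := fun n => NNReal.coe_le_coe.2 (min_le_right _ _)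
  have ha00 : ∀ n, 0 ≤ a n := fun n => NNReal.coe_nonneg _
  have hbi : ∀ n, IntervalIntegrable b volume (a n) (a (n + 1)) := fun n =>
    hb.mono_set (by
      rw [Set.uIcc_of_le (ham (Nat.le_succ n)), Set.uIcc_of_le (NNReal.coe_nonneg t)]
      exact Set.Icc_subset_Icc (ha00 n) (hat _))
  have hxb : ∀ n, IntervalIntegrable (fun s => x s * b s) volume (a n) (a (n + 1)) := fun n =>
    (hbi n).continuousOn_mul hx.continuousOn
  have e1 : ∫ s in (0 : ℝ)..t, x s * b s
      = ∑ n ∈ Finset.range N, ∫ s in a n..a (n + 1), x s * b s := by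
    rw [intervalIntegral.sum_integral_adjacent_intervals fun n _ => hxb n, ha0, haN]
  rw [e1, ← Finset.sum_sub_distrib]
  calc _ ≤ ∑ n ∈ Finset.range N, ε * C * (a (n + 1) - a n) := by
        refine (Finset.abs_sum_le_sum_abs _ _).trans (Finset.sum_le_sum fun n hn => ?_)
        rw [← intervalIntegral.integral_const_mul,
          ← intervalIntegral.integral_sub ((hbi n).const_mul _) (hxb n)]
        have := intervalIntegral.norm_integral_le_of_norm_le_const (a := a n) (b := a (n + 1))
          (f := fun s => ξ n * b s - x s * b s) (C := ε * C) fun s hs => ?_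
        · rwa [Real.norm_eq_abs, abs_of_nonneg (sub_nonneg.2 (ham (Nat.le_succ n)))] at this
        · rw [Set.uIoc_of_le (ham (Nat.le_succ n))] at hs
          rw [← sub_mul, Real.norm_eq_abs, abs_mul]
          have h1 := hξ n (Finset.mem_range.1 hn) s hs.1.le hs.2
          exact mul_le_mul h1 (hbC s ((ha00 n).trans hs.1.le) (hs.2.trans (hat _)))
            (abs_nonneg _) ((abs_nonneg _).trans h1)
    _ = ε * C * t := by
        rw [← Finset.mul_sum, Finset.sum_range_sub a, ha0, haN, sub_zero]

end Averages

/-! ### Limits uniform on compacts in probability -/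

section Ucp

set_option linter.unusedSectionVars false

variable {Ω : Type*} [mΩ : MeasurableSpace Ω] {ℱ : Filtration ℝ≥0 mΩ} {μ : Measure Ω}
  {τ : Ω → WithTop ℝ≥0} {T : ℝ≥0} {η : ℝ≥0∞} {X Y Z : ℝ≥0 → Ω → ℝ}
  {S S' : ℕ → (ℕ → ℝ≥0) → ℝ≥0 → Ω → ℝ} {I I' : ℝ≥0 → Ω → ℝ}

/-- Quantities which do not depend on the smoothing parameter are small along `gridFilter` exactly if
they are so along the partitions of vanishing mesh. -/
lemma tendstoUcp_iff_small : TendstoUcp μ τ S I ↔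
    ∀ T, Small μ τ T (fun i t ω => S i.2.1 i.2.2 t ω - I t ω) := by
  have key : ∀ (T : ℝ≥0) (ε : ℝ) (N : ℕ) (σ : ℕ → ℝ≥0),
      {ω | ∃ t : ℝ≥0, t ≤ T ∧ (t : WithTop ℝ≥0) ≤ τ ω ∧ ε ≤ |S N σ t ω - I t ω|}
        = {ω | ¬ ∀ t ∈ horizon τ T ω, |S N σ t ω - I t ω| < ε} := by
    intro T ε N σ
    ext ω
    simp only [Set.mem_ofPred_eq, horizon]
    push Not
    exact ⟨fun ⟨t, h1, h2, h3⟩ => ⟨t, ⟨h1, h2⟩, h3⟩, fun ⟨t, ⟨h1, h2⟩, h3⟩ => ⟨t, h1, h2, h3⟩⟩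
  constructor
  · intro h T ε hε η hη
    obtain ⟨δ, hδ, hw⟩ := h T ε hε η hη
    filter_upwards [eventually_isPartition T hδ] with i hi
    exact (key T ε _ _) ▸ hw _ _ hi
  · intro h T ε hε η hη
    have h1 := eventually_mesh_of_gridFilter (P := fun π =>
      μ {ω | ¬ ∀ t ∈ horizon τ T ω, |S π.1 π.2 t ω - I t ω| < ε} ≤ η) (h T ε hε η hη)
    obtain ⟨δ, hδ, hw⟩ := (hasBasis_meshFilter T).eventually_iff.1 h1
    exact ⟨δ, hδ, fun N σ hσ => (key T ε N σ).symm ▸ @hw (N, σ) hσ⟩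

lemma TendstoUcp.small (h : TendstoUcp μ τ S I) (T : ℝ≥0) :
    Small μ τ T (fun i t ω => S i.2.1 i.2.2 t ω - I t ω) := tendstoUcp_iff_small.1 h T

lemma TendstoUcp.of_small_sub (h : TendstoUcp μ τ S I)
    (h' : ∀ T, Small μ τ T (fun i t ω => S' i.2.1 i.2.2 t ω - S i.2.1 i.2.2 t ω)) :
    TendstoUcp μ τ S' I :=
  tendstoUcp_iff_small.2 fun T => ((h' T).add (h.small T)).congr <|
    Eventually.of_forall fun i ω t _ => by ring

lemma TendstoUcp.congr (h : TendstoUcp μ τ S I)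
    (h' : ∀ N σ (t : ℝ≥0) ω, Monotone σ → (t : WithTop ℝ≥0) ≤ τ ω → S' N σ t ω = S N σ t ω) :
    TendstoUcp μ τ S' I :=
  h.of_small_sub fun T => small_zero.congr <|
    (eventually_isPartition T one_pos).mono fun i hi ω t ht => by
      rw [h' _ _ _ _ hi.mono ht.2, sub_self]

lemma TendstoUcp.of_top (h : TendstoUcp μ (fun _ => ⊤) S I) : TendstoUcp μ τ S I :=
  tendstoUcp_iff_small.2 fun T => (h.small T).of_top

lemma TendstoUcp.add (h : TendstoUcp μ τ S I) (h' : TendstoUcp μ τ S' I') :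
    TendstoUcp μ τ (fun N σ t ω => S N σ t ω + S' N σ t ω) (fun t ω => I t ω + I' t ω) :=
  tendstoUcp_iff_small.2 fun T => ((h.small T).add (h'.small T)).congr <|
    Eventually.of_forall fun i ω t _ => by ring

lemma TendstoUcp.sub (h : TendstoUcp μ τ S I) (h' : TendstoUcp μ τ S' I') :
    TendstoUcp μ τ (fun N σ t ω => S N σ t ω - S' N σ t ω) (fun t ω => I t ω - I' t ω) :=
  tendstoUcp_iff_small.2 fun T => ((h.small T).sub (h'.small T)).congr <|
    Eventually.of_forall fun i ω t _ => by ring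

lemma tendstoUcp_sum {κ : Type*} {s : Finset κ} {S : κ → ℕ → (ℕ → ℝ≥0) → ℝ≥0 → Ω → ℝ}
    {I : κ → ℝ≥0 → Ω → ℝ} (h : ∀ k, TendstoUcp μ τ (S k) (I k)) :
    TendstoUcp μ τ (fun N σ t ω => ∑ k ∈ s, S k N σ t ω) (fun t ω => ∑ k ∈ s, I k t ω) :=
  tendstoUcp_iff_small.2 fun T => (Small.sum (s := s) fun k => (h k).small T).congr <|
    Eventually.of_forall fun i ω t _ => by rw [Finset.sum_sub_distrib]

lemma IsPartition.restrict {T' : ℝ≥0} {δ : ℝ} {N : ℕ} {σ : ℕ → ℝ≥0} (h : IsPartition T' δ N σ)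
    (hT : T ≤ T') : IsPartition T δ N (fun n => min (σ n) T) where
  mono := fun _ _ hmn => min_le_min_right _ (h.mono hmn)
  left := h.min_left T
  right := by simp only [h.right, min_eq_right hT]
  mesh n hn := (le_abs_self _).trans (h.abs_min_sub_le hn T)

/-- Completeness of convergence uniformly on compacts in probability: sums which form a Cauchy net
along the partitions of each `[0, T]`, and whose values up to time `T` only depend on the
partition up to time `T`, have a limit. -/
lemma exists_tendstoUcp_of_cauchy
    (hC : ∀ (T : ℝ≥0) (ε : ℝ), 0 < ε → ∀ η : ℝ≥0∞, 0 < η → ∃ δ : ℝ, 0 < δ ∧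
      ∀ N σ N' σ', IsPartition T δ N σ → IsPartition T δ N' σ' →
        μ {ω | ¬ ∀ t ≤ T, |S N σ t ω - S N' σ' t ω| < ε} ≤ η)
    (hS : ∀ (T : ℝ≥0) N σ t ω, t ≤ T → S N (fun n => min (σ n) T) t ω = S N σ t ω) :
    ∃ I, TendstoUcp μ (fun _ => ⊤) S I := by
  have hε : ∀ m : ℕ, (0 : ℝ) < (1 / 2) ^ m := fun m => by positivity
  have hη : ∀ m : ℕ, (0 : ℝ≥0∞) < 2⁻¹ ^ m := fun m =>
    ENNReal.pow_pos (ENNReal.inv_pos.2 ENNReal.ofNat_ne_top) m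
  choose δ hδ hδC using fun m : ℕ => hC m _ (hε m) _ (hη m)
  have hP : ∀ n : ℕ, ∃ d : ℝ, 0 < d ∧ d ≤ 1 / (n + 1) ∧ ∀ m ≤ n, d ≤ δ m := by
    intro n
    have h1 : ∀ᶠ d in 𝓝[>] (0 : ℝ), ∀ m ∈ Finset.range (n + 1), d ≤ δ m :=
      (Finset.eventually_all _).2 fun m _ =>
        (eventually_mem_set.2 (Ioo_mem_nhdsGT (hδ m))).mono fun d hd => hd.2.le
    have h2 : ∀ᶠ d in 𝓝[>] (0 : ℝ), d ∈ Set.Ioo (0 : ℝ) (1 / (n + 1)) :=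
      Ioo_mem_nhdsGT (by positivity)
    obtain ⟨d, h1, h2⟩ := (h1.and h2).exists
    exact ⟨d, h2.1, h2.2.le, fun m hm => h1 m (Finset.mem_range.2 (Nat.lt_succ_of_le hm))⟩
  choose d hd hd1 hdδ using hP
  choose N σ hσ using fun n : ℕ => exists_isPartition (n : ℝ≥0) (hd n)
  set x : ℕ → ℝ≥0 → Ω → ℝ := fun n => S (N n) (σ n) with hx
  -- the bad events of the geometrically fast subsequence
  set B : ℕ → Set Ω := fun m => {ω | ¬ ∀ t ≤ (m : ℝ≥0), |x m t ω - x (m + 1) t ω| < (1 / 2) ^ m}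
    with hB
  have hBm : ∀ m, μ (B m) ≤ 2⁻¹ ^ m := by
    intro m
    have h1 := hδC m (N m) (σ m) (N (m + 1)) (fun n => min (σ (m + 1) n) m)
      ((hσ m).mesh_mono (hdδ m m le_rfl))
      (((hσ (m + 1)).restrict (by exact_mod_cast Nat.le_succ m)).mesh_mono
        (hdδ (m + 1) m (Nat.le_succ m)))
    refine (measure_mono fun ω hω => ?_).trans h1
    simp only [hB, Set.mem_ofPred_eq] at hω ⊢
    refine fun h => hω fun t ht => ?_
    have := h t ht
    rwa [hS _ _ _ _ _ ht] at this
  refine ⟨fun t ω => limUnder atTop fun n => x n t ω, fun T ε hε' η hη' => ?_⟩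
  obtain ⟨δ', hδ', hC'⟩ := hC T (ε / 2) (half_pos hε') (η / 2) (ENNReal.half_pos hη'.ne')
  have hsum : ∑' m : ℕ, (2⁻¹ : ℝ≥0∞) ^ m ≠ ∞ := by
    rw [ENNReal.tsum_geometric, ENNReal.one_sub_inv_two, inv_inv]
    exact ENNReal.ofNat_ne_top
  have l1 : ∀ᶠ m : ℕ in atTop, ∑' k : ℕ, (2⁻¹ : ℝ≥0∞) ^ (k + m) < η / 2 :=
    (ENNReal.tendsto_sum_nat_add _ hsum).eventually (gt_mem_nhds (ENNReal.half_pos hη'.ne'))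
  have l2 : ∀ᶠ m : ℕ in atTop, 2 * (1 / 2 : ℝ) ^ m < ε / 2 := by
    have : Tendsto (fun m : ℕ => 2 * (1 / 2 : ℝ) ^ m) atTop (𝓝 (2 * 0)) :=
      (tendsto_pow_atTop_nhds_zero_of_lt_one (by norm_num) (by norm_num)).const_mul 2
    exact this.eventually (gt_mem_nhds (by linarith))
  have l3 : ∀ᶠ m : ℕ in atTop, (1 : ℝ) / (m + 1) < δ' :=
    tendsto_one_div_add_atTop_nhds_zero_nat.eventually (gt_mem_nhds hδ')
  have l4 : ∀ᶠ m : ℕ in atTop, T ≤ (m : ℝ≥0) :=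
    tendsto_natCast_atTop_atTop.eventually (eventually_ge_atTop T)
  obtain ⟨m, h1, h2, h3, h4⟩ := (l1.and (l2.and (l3.and l4))).exists
  refine ⟨δ', hδ', fun N' σ' hσ' => ?_⟩
  have hA := hC' N' σ' (N m) (fun n => min (σ m n) T) hσ'
    (((hσ m).restrict h4).mesh_mono ((hd1 m).trans h3.le))
  have hU : μ (⋃ k, B (k + m)) ≤ η / 2 :=
    (measure_iUnion_le _).trans ((ENNReal.tsum_le_tsum fun k => hBm _).trans h1.le)
  refine (measure_mono ?_).trans ((measure_union_le _ _).trans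
    ((add_le_add hA hU).trans (ENNReal.add_halves η).le))
  rintro ω ⟨t, htT, -, ht⟩
  by_contra hω
  simp only [Set.mem_union, Set.mem_iUnion, Set.mem_ofPred_eq, not_or, not_not, not_exists, hB]
    at hω
  have g1 := hω.1 t htT
  rw [hS _ _ _ _ _ htT] at g1
  have g2 : ∀ k, dist (x (k + m) t ω) (x (k + 1 + m) t ω) ≤ (1 / 2) ^ m * (1 / 2) ^ k := by
    intro k
    have := hω.2 k t (htT.trans (h4.trans (by exact_mod_cast Nat.le_add_left m k)))
    rw [Real.dist_eq, ← pow_add, add_comm m k, show k + 1 + m = k + m + 1 by ring]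
    exact this.le
  have hcau : CauchySeq fun k => x (k + m) t ω :=
    cauchySeq_of_le_geometric _ _ (by norm_num) g2
  have hlim : Tendsto (fun n => x n t ω) atTop (𝓝 (limUnder atTop fun n => x n t ω)) := by
    obtain ⟨l, hl⟩ := cauchySeq_tendsto_of_complete hcau
    exact tendsto_nhds_limUnder ⟨l, (tendsto_add_atTop_iff_nat (f := fun n => x n t ω) m).1 hl⟩
  have g3 := dist_le_of_le_geometric_of_tendsto₀ _ _ (by norm_num) g2
    ((tendsto_add_atTop_iff_nat m).2 hlim)
  rw [zero_add, Real.dist_eq] at g3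
  have g4 : |S N' σ' t ω - limUnder atTop fun n => x n t ω| < ε := by
    calc _ ≤ |S N' σ' t ω - x m t ω| + |x m t ω - limUnder atTop fun n => x n t ω| :=
          abs_sub_le _ _ _
      _ < ε / 2 + ε / 2 := by
          refine add_lt_add_of_lt_of_le g1 (g3.trans ?_)
          have : (1 / 2 : ℝ) ^ m / (1 - 1 / 2) = 2 * (1 / 2) ^ m := by ring
          rw [this]; exact h2.le
      _ = ε := add_halves ε
  exact absurd ht (not_le.2 g4)

/-- Sums which are approximated by quantities `L h` not depending on the partition converge. -/
lemma exists_tendstoUcp_of_small {L : ℝ → ℝ≥0 → Ω → ℝ}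
    (hL : ∀ T, Small μ (fun _ => ⊤) T (fun i t ω => S i.2.1 i.2.2 t ω - L i.1 t ω))
    (hS : ∀ (T : ℝ≥0) N σ t ω, t ≤ T → S N (fun n => min (σ n) T) t ω = S N σ t ω) :
    ∃ I, TendstoUcp μ (fun _ => ⊤) S I := by
  refine exists_tendstoUcp_of_cauchy (fun T ε hε η hη => ?_) hS
  obtain ⟨h, hh⟩ := (eventually_gridFilter_iff.1
    (hL T (ε / 2) (half_pos hε) (η / 2) (ENNReal.half_pos hη.ne'))).exists
  obtain ⟨δ, hδ, hw⟩ := (hasBasis_meshFilter T).eventually_iff.1 hh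
  refine ⟨δ, hδ, fun N σ N' σ' h1 h2 => ?_⟩
  refine measure_not_le_of_and (@hw (N, σ) h1) (@hw (N', σ') h2) fun ω g1 g2 t ht => ?_
  have e1 := g1 t ⟨ht, le_top⟩
  have e2 := g2 t ⟨ht, le_top⟩
  rw [abs_lt] at *
  constructor <;> linarith [e1.1, e1.2, e2.1, e2.2]

lemma leftSum_min (T : ℝ≥0) (N : ℕ) (σ : ℕ → ℝ≥0) {t : ℝ≥0} (ω : Ω) (ht : t ≤ T) :
    leftSum Y X N (fun n => min (σ n) T) t ω = leftSum Y X N σ t ω := by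
  simp only [leftSum, min_assoc, min_eq_right ht]

/-- Summation by parts against the smoothed integrand: its Riemann sums against `X` converge, for
a fixed smoothing scale, to an expression involving only an ordinary time integral. -/
lemma small_gridSum_backAvg [IsProbabilityMeasure μ] (hY : IsContAdapted ℱ Y)
    (hX : IsContAdapted ℱ X) :
    Small μ τ T (fun i t ω => gridSum (fun i n t ω => leftVal (backAvg i.1 Y) i n t ω
        * incr X i n t ω) i t ω - (backAvg i.1 Y t ω * X t ω - backAvg i.1 Y 0 ω * X 0 ω
          - ∫ s in (0 : ℝ)..t, X s.toNNReal ω * backAvgDeriv i.1 Y s ω)) := by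
  intro ε hε η hη
  have hη2 := ENNReal.half_pos hη.ne'
  obtain ⟨C, hC, hYC⟩ := hY.exists_bound (μ := μ) T hη2
  refine eventually_gridFilter_iff.2 ?_
  filter_upwards [self_mem_nhdsWithin] with h hh
  replace hh : 0 < h := hh
  set ε' : ℝ := ε / (2 * (2 * C / h) * (T + 1)) with hε'
  have hT : (0 : ℝ) ≤ T := T.2
  have hε'0 : 0 < ε' := by positivity
  obtain ⟨δ, hδ, hosc⟩ := hX.exists_osc (μ := μ) T hε'0 hη2
  filter_upwards [(hasBasis_meshFilter T).mem_of_mem hδ] with π hπ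
  replace hπ : IsPartition T δ π.1 π.2 := hπ
  refine measure_not_le_of_and hYC hosc fun ω g1 g2 t ht => ?_
  have hσ := abs_sum_sub_integral_le hπ ht.1 (b := fun s => backAvgDeriv h Y s ω)
    (x := fun s => X s.toNNReal ω) (ξ := fun n => X (min (π.2 (n + 1)) t) ω) (ε := ε')
    (C := 2 * C / h) ((hY.continuous_backAvgDeriv h ω).intervalIntegrable _ _)
    (fun s _ hst => abs_backAvgDeriv_le hh g1 (hst.trans (NNReal.coe_le_coe.2 ht.1)))
    (hX.continuous_real ω) (fun n hn s hs1 hs2 => by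
      have hs0 : 0 ≤ s := (NNReal.coe_nonneg _).trans hs1
      have hsT : s.toNNReal ≤ T := Real.toNNReal_le_iff_le_coe.2
        (hs2.trans (NNReal.coe_le_coe.2 ((min_le_right _ _).trans ht.1)))
      refine (g2 _ ((min_le_right _ _).trans ht.1) _ hsT ?_).le
      rw [Real.coe_toNNReal _ hs0, abs_of_nonneg (by linarith)]
      have := (le_abs_self _).trans (hπ.abs_min_sub_le hn t)
      linarith)
  have e : gridSum (fun i n t ω => leftVal (backAvg i.1 Y) i n t ω * incr X i n t ω) (h, π) t ω
      - (backAvg h Y t ω * X t ω - backAvg h Y 0 ω * X 0 ω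
          - ∫ s in (0 : ℝ)..t, X s.toNNReal ω * backAvgDeriv h Y s ω)
      = -(∑ n ∈ Finset.range π.1, X (min (π.2 (n + 1)) t) ω *
          (∫ s in ((min (π.2 n) t : ℝ≥0) : ℝ)..(min (π.2 (n + 1)) t : ℝ≥0), backAvgDeriv h Y s ω)
        - ∫ s in (0 : ℝ)..t, X s.toNNReal ω * backAvgDeriv h Y s ω) := by
    have e1 := gridSum_incr (i := (h, π)) hπ ht.1 (fun t ω => backAvg h Y t ω * X t ω) ω
    have e2 : gridSum (fun i n t ω => leftVal (backAvg i.1 Y) i n t ω * incr X i n t ω) (h, π) t ω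
        = gridSum (incr fun t ω => backAvg h Y t ω * X t ω) (h, π) t ω
          - ∑ n ∈ Finset.range π.1, X (min (π.2 (n + 1)) t) ω *
          (∫ s in ((min (π.2 n) t : ℝ≥0) : ℝ)..(min (π.2 (n + 1)) t : ℝ≥0),
            backAvgDeriv h Y s ω) := by
      simp only [gridSum]
      rw [← Finset.sum_sub_distrib]
      refine Finset.sum_congr rfl fun n _ => ?_
      rw [← hY.backAvg_sub]
      simp only [incr, leftVal]
      ring
    rw [e2, e1]
    ring
  rw [e, abs_neg]
  refine hσ.trans_lt ?_
  have e3 : ε' * (2 * C / h) * (t : ℝ) ≤ ε' * (2 * C / h) * T := by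
    have : (t : ℝ) ≤ T := NNReal.coe_le_coe.2 ht.1
    gcongr
  have e4 : ε' * (2 * C / h) * (T + 1) = ε / 2 := by
    rw [hε']
    field_simp
  have e5 : 0 < ε' * (2 * C / h) := by positivity
  nlinarith

/-- The left-point sums of a continuous adapted process against a good integrator converge. -/
lemma IsGoodIntegrator.exists_tendstoUcp_leftSum [IsProbabilityMeasure μ]
    (hX : IsGoodIntegrator ℱ μ X) (hY : IsContAdapted ℱ Y) :
    ∃ I, TendstoUcp μ (fun _ => ⊤) (leftSum Y X) I := by
  refine exists_tendstoUcp_of_small (L := fun h t ω => backAvg h Y t ω * X t ω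
    - backAvg h Y 0 ω * X 0 ω - ∫ s in (0 : ℝ)..t, X s.toNNReal ω * backAvgDeriv h Y s ω)
    (fun T => ?_) fun T N σ t ω ht => leftSum_min T N σ ω ht
  -- `|i.1|` instead of `i.1`, so that the integrand is adapted for every index
  have h1 := (hX.integ T).small (H := fun i t ω => Y t ω - backAvg |i.1| Y t ω)
    (fun i => (hY.sub (hY.backAvg (abs_nonneg _))).adapted)
    ((hY.small_sub_backAvg (μ := μ)).congr <| (eventually_smoothing_pos T).mono
      fun i hi ω t _ => by rw [abs_of_pos hi])
  refine (h1.add (small_gridSum_backAvg hY hX.toIsContAdapted)).congr <|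
    (eventually_smoothing_pos T).mono fun i hi ω t _ => ?_
  have : leftSum Y X i.2.1 i.2.2 t ω
      = gridSum (fun i n t ω => leftVal (fun t ω => Y t ω - backAvg |i.1| Y t ω) i n t ω
          * incr X i n t ω) i t ω
        + gridSum (fun i n t ω => leftVal (backAvg i.1 Y) i n t ω * incr X i n t ω) i t ω := by
    simp only [leftSum, gridSum, incr, leftVal, abs_of_pos hi]
    rw [← Finset.sum_add_distrib]
    exact Finset.sum_congr rfl fun n _ => by ring
  rw [this]
  ring

/-- Weighted sums of products of increments of good integrators converge: by the discrete product
rule they are combinations of left-point sums. The smoothing parameter of the grid index, here `0`,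
plays no role. -/
lemma IsGoodIntegrator.exists_tendstoUcp_mul_mul [IsProbabilityMeasure μ]
    (hX : IsGoodIntegrator ℱ μ X) (hY : IsGoodIntegrator ℱ μ Y) (hZ : IsContAdapted ℱ Z) :
    ∃ I, TendstoUcp μ (fun _ => ⊤) (fun N σ => gridSum
      (fun i n t ω => leftVal Z i n t ω * (incr X i n t ω * incr Y i n t ω)) (0, N, σ)) I := by
  obtain ⟨I₁, h1⟩ := (hX.mul hY).exists_tendstoUcp_leftSum hZ
  obtain ⟨I₂, h2⟩ := hY.exists_tendstoUcp_leftSum (hZ.mul hX.toIsContAdapted)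
  obtain ⟨I₃, h3⟩ := hX.exists_tendstoUcp_leftSum (hZ.mul hY.toIsContAdapted)
  refine ⟨_, ((h1.sub h2).sub h3).congr fun N σ t ω _ _ => ?_⟩
  simp only [leftSum, gridSum, incr, leftVal, ← Finset.sum_sub_distrib]
  exact Finset.sum_congr rfl fun n _ => by ring

lemma exists_mem_uIcc_deriv_mul_eq {g : ℝ → ℝ} (hg : Differentiable ℝ g) (x y : ℝ) :
    ∃ c ∈ Set.uIcc x y, deriv g c * (y - x) = g y - g x := by
  rcases lt_trichotomy x y with hxy | hxy | hxy
  · obtain ⟨c, hc, h⟩ := exists_deriv_eq_slope g hxy hg.continuous.continuousOn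
      hg.differentiableOn
    refine ⟨c, Set.Icc_subset_uIcc (Set.Ioo_subset_Icc_self hc), ?_⟩
    rw [h, div_mul_cancel₀ _ (sub_ne_zero.2 hxy.ne')]
  · exact ⟨x, Set.left_mem_uIcc, by simp [hxy]⟩
  · obtain ⟨c, hc, h⟩ := exists_deriv_eq_slope g hxy hg.continuous.continuousOn
      hg.differentiableOn
    refine ⟨c, Set.Icc_subset_uIcc' (Set.Ioo_subset_Icc_self hc), ?_⟩
    rw [h]
    field_simp [sub_ne_zero.2 hxy.ne']
    ring

/-- First-order Taylor expansion along the increments of a continuous process: the relative error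
is uniformly small. -/
lemma IsContAdapted.exists_incr_comp [IsProbabilityMeasure μ] (hX : IsContAdapted ℱ X)
    {g : ℝ → ℝ} (hg : ContDiff ℝ 1 g) : ∃ a : GridIndex → ℕ → ℝ≥0 → Ω → ℝ,
      (∀ T, UnifSmall μ τ T a) ∧ ∀ i n t ω, incr (fun t ω => g (X t ω)) i n t ω
        = leftVal (fun t ω => deriv g (X t ω)) i n t ω * incr X i n t ω
          + a i n t ω * incr X i n t ω := by
  refine ⟨fun i n t ω => if incr X i n t ω = 0 then 0 else
    incr (fun t ω => g (X t ω)) i n t ω / incr X i n t ω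
      - leftVal (fun t ω => deriv g (X t ω)) i n t ω, fun T ε hε η hη => ?_, fun i n t ω => ?_⟩
  · have hη2 := ENNReal.half_pos hη.ne'
    obtain ⟨C, hC, hw⟩ := hX.whp_bound (μ := μ) T hη2
    have huc : UniformContinuousOn (deriv g) (Set.Icc (-C) C) :=
      isCompact_Icc.uniformContinuousOn_of_continuous
        (hg.continuous_deriv le_rfl).continuousOn
    obtain ⟨δ, hδ, hd⟩ := Metric.uniformContinuousOn_iff.1 huc ε hε
    refine (hw.and (hX.unifSmall_incr (τ := τ) δ hδ (η / 2) hη2)).mono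
      (Eventually.of_forall fun i ω h t ht n hn => ?_)
    have hb : ∀ s, |X (min s t) ω| ≤ C := fun s => h.1 _ ((min_le_right _ _).trans ht.1)
    have hs := h.2 t ht n hn
    beta_reduce
    split_ifs with h0
    · simpa using hε
    simp only [incr, leftVal] at h0 hs ⊢
    set x := X (min (i.2.2 n) t) ω
    set y := X (min (i.2.2 (n + 1)) t) ω
    have hdiff : Differentiable ℝ g := hg.differentiable one_ne_zero
    obtain ⟨c, hc, hcd⟩ := exists_mem_uIcc_deriv_mul_eq hdiff x y
    rw [← hcd, mul_div_cancel_right₀ _ h0]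
    have hx := abs_le.1 (hb (i.2.2 n))
    have hy := abs_le.1 (hb (i.2.2 (n + 1)))
    have hcI : c ∈ Set.Icc (-C) C :=
      (Set.uIcc_subset_Icc (Set.mem_Icc.2 hx) (Set.mem_Icc.2 hy)) hc
    refine hd c hcI x hx ?_
    rw [Real.dist_eq]
    exact (Set.abs_sub_left_of_mem_uIcc hc).trans_lt hs
  · beta_reduce
    split_ifs with h0
    · have : X (min (i.2.2 (n + 1)) t) ω = X (min (i.2.2 n) t) ω := sub_eq_zero.1 h0
      rw [h0]
      simp [incr, this]
    · field_simp
      ring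

/-- The sums of products of increments of `p h(q)` and a good integrator converge, even though
`h(q)` need not be a semimartingale when `h` is only `C¹`. -/
lemma exists_tendstoUcp_covSum [IsProbabilityMeasure μ] {p q W : ℝ≥0 → Ω → ℝ}
    (hp : IsGoodIntegrator ℱ μ p) (hq : IsGoodIntegrator ℱ μ q) (hW : IsGoodIntegrator ℱ μ W)
    {g : ℝ → ℝ} (hg : ContDiff ℝ 1 g) :
    ∃ I, TendstoUcp μ (fun _ => ⊤) (covSum (fun t ω => p t ω * g (q t ω)) W) I := by
  obtain ⟨a, ha, hag⟩ := hq.toIsContAdapted.exists_incr_comp (μ := μ) (τ := fun _ => ⊤) hg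
  have hgq : IsContAdapted ℱ (fun t ω => g (q t ω)) := hq.toIsContAdapted.comp hg.continuous
  obtain ⟨I₁, h1⟩ := hq.exists_tendstoUcp_mul_mul hW (hp.toIsContAdapted.mul
    (hq.toIsContAdapted.comp (hg.continuous_deriv le_rfl)))
  obtain ⟨I₂, h2⟩ := hp.exists_tendstoUcp_mul_mul hW hgq
  refine ⟨_, (h1.add h2).of_small_sub fun T => ?_⟩
  have s1 := small_gridSum_mul_of_unifSmall (ha T) (bdd_gridSum_leftVal_mul
    (Y := fun _ => p) hp.toIsContAdapted.bdd
    (bdd_gridSum_abs_incr_mul hq.hasBddQV hW.hasBddQV))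
  have s2 := small_gridSum_mul_of_unifSmall (hp.toIsContAdapted.unifSmall_incr (μ := μ)
    (τ := fun _ => ⊤) (T := T)) (bdd_gridSum_abs_incr_mul
      (hq.hasBddQV.comp hg hq.toIsContAdapted) hW.hasBddQV)
  refine (s1.add s2).congr (Eventually.of_forall fun i ω t _ => ?_)
  simp only [covSum, gridSum, ← Finset.sum_add_distrib, ← Finset.sum_sub_distrib]
  refine Finset.sum_congr rfl fun n _ => ?_
  have e := hag i n t ω
  have e2 := incr_mul p (fun t ω => g (q t ω)) i n t ω
  have e3 : leftVal (fun t ω => p t ω * deriv g (q t ω)) i n t ω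
      = leftVal p i n t ω * leftVal (fun t ω => deriv g (q t ω)) i n t ω := rfl
  change incr (fun t ω => p t ω * g (q t ω)) i n t ω * incr W i n t ω
    - (leftVal (fun t ω => p t ω * deriv g (q t ω)) i n t ω * (incr q i n t ω * incr W i n t ω)
      + leftVal (fun t ω => g (q t ω)) i n t ω * (incr p i n t ω * incr W i n t ω)) = _
  rw [e2, e3]
  linear_combination (leftVal p i n t ω * incr W i n t ω) * e

end Ucp

/-! ### Stratonovich calculus -/

section Stratonovich

set_option linter.unusedSectionVars false

variable {Ω : Type*} [mΩ : MeasurableSpace Ω] {ℱ : Filtration ℝ≥0 mΩ} {μ : Measure Ω}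
  {τ : Ω → WithTop ℝ≥0} {T : ℝ≥0} {η : ℝ≥0∞} {X Y Z : ℝ≥0 → Ω → ℝ}

/-- The trapezoidal sums `∑ ½ (Z_{σ_i} + Z_{σ_{i+1}}) (X_{σ_{i+1}} - X_{σ_i})`, whose limit is the
Stratonovich integral. -/
def trapSum (Z X : ℝ≥0 → Ω → ℝ) (N : ℕ) (σ : ℕ → ℝ≥0) (t : ℝ≥0) (ω : Ω) : ℝ :=
  leftSum Z X N σ t ω + 1 / 2 * covSum Z X N σ t ω

/-- The mean of the values of `X` at the two ends of the `n`-th partition interval. -/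
def midVal (X : ℝ≥0 → Ω → ℝ) (i : GridIndex) (n : ℕ) (t : ℝ≥0) (ω : Ω) : ℝ :=
  leftVal X i n t ω + 1 / 2 * incr X i n t ω

lemma trapSum_eq_gridSum (Z X : ℝ≥0 → Ω → ℝ) (i : GridIndex) (t : ℝ≥0) (ω : Ω) :
    trapSum Z X i.2.1 i.2.2 t ω
      = gridSum (fun i n t ω => midVal Z i n t ω * incr X i n t ω) i t ω := by
  simp only [trapSum, leftSum, covSum, gridSum, midVal, incr, leftVal, Finset.mul_sum,
    ← Finset.sum_add_distrib]
  exact Finset.sum_congr rfl fun n _ => by ring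

lemma UnifSmall.mul {a b : GridIndex → ℕ → ℝ≥0 → Ω → ℝ} (ha : UnifSmall μ τ T a)
    (hb : UnifSmall μ τ T b) : UnifSmall μ τ T (fun i n t ω => a i n t ω * b i n t ω) :=
  fun ε hε η hη => by
  have hη2 := ENNReal.half_pos hη.ne'
  refine ((ha ε hε _ hη2).and (hb 1 one_pos _ hη2)).mono
    (Eventually.of_forall fun i ω h t ht n hn => ?_)
  rw [abs_mul]
  have h1 := h.1 t ht n hn
  have h2 := h.2 t ht n hn
  nlinarith [abs_nonneg (a i n t ω), abs_nonneg (b i n t ω)]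

/-- The trapezoidal rule for a `C²` function: the error is `o((y - x)²)`, uniformly on compacts. -/
lemma abs_trapezoid_le {g : ℝ → ℝ} (hg : ContDiff ℝ 2 g) (C : ℝ) {ε : ℝ} (hε : 0 < ε) :
    ∃ δ : ℝ, 0 < δ ∧ ∀ x y, |x| ≤ C → |y| ≤ C → |y - x| < δ →
      |g y - g x - 1 / 2 * (deriv g x + deriv g y) * (y - x)| ≤ ε * (y - x) ^ 2 := by
  have hg1 : ContDiff ℝ 1 (deriv g) := by
    have : ContDiff ℝ (1 + 1) g := by simpa [one_add_one_eq_two] using hg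
    exact ((contDiff_succ_iff_deriv).1 this).2.2
  have hd0 : Differentiable ℝ g := hg.differentiable two_ne_zero
  have hd1 : Differentiable ℝ (deriv g) := hg1.differentiable one_ne_zero
  have huc : UniformContinuousOn (deriv (deriv g)) (Set.Icc (-C) C) :=
    isCompact_Icc.uniformContinuousOn_of_continuous (hg1.continuous_deriv le_rfl).continuousOn
  obtain ⟨δ, hδ, hd⟩ := Metric.uniformContinuousOn_iff.1 huc ε hε
  refine ⟨δ, hδ, fun x y hx hy hxy => ?_⟩
  have hsub : Set.uIcc x y ⊆ Set.Icc (-C) C :=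
    Set.uIcc_subset_Icc (Set.mem_Icc.2 (abs_le.1 hx)) (Set.mem_Icc.2 (abs_le.1 hy))
  set G : ℝ → ℝ := fun s => g s - g x - 1 / 2 * (deriv g x + deriv g s) * (s - x) with hG
  have hder : ∀ s, HasDerivAt G (1 / 2 * (deriv g s - deriv g x)
      - 1 / 2 * deriv (deriv g) s * (s - x)) s := by
    intro s
    have h1 := ((hd0 s).hasDerivAt.sub_const (g x)).sub
      ((((hd1 s).hasDerivAt.const_add (deriv g x)).const_mul (1 / 2)).mul
        ((hasDerivAt_id s).sub_const x))
    refine h1.congr_deriv ?_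
    simp only [id]
    ring
  have hbound : ∀ s ∈ Set.uIcc x y, ‖1 / 2 * (deriv g s - deriv g x)
      - 1 / 2 * deriv (deriv g) s * (s - x)‖ ≤ ε * |y - x| := by
    intro s hs
    obtain ⟨c, hc, hcd⟩ := exists_mem_uIcc_deriv_mul_eq hd1 x s
    have hsx : |s - x| ≤ |y - x| := Set.abs_sub_left_of_mem_uIcc hs
    have hcs : |c - s| ≤ |s - x| := by
      rw [abs_sub_comm c s]
      exact Set.abs_sub_right_of_mem_uIcc hc
    have h1 := (hd c (hsub ((Set.uIcc_subset_uIcc_left hs) hc)) s (hsub hs) (by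
      rw [Real.dist_eq]; exact (hcs.trans hsx).trans_lt hxy)).le
    rw [Real.dist_eq] at h1
    rw [← hcd, Real.norm_eq_abs, show 1 / 2 * (deriv (deriv g) c * (s - x))
      - 1 / 2 * deriv (deriv g) s * (s - x)
      = 1 / 2 * ((deriv (deriv g) c - deriv (deriv g) s) * (s - x)) by ring, abs_mul, abs_mul,
      abs_of_pos (by norm_num : (0 : ℝ) < 1 / 2)]
    have := mul_le_mul h1 hsx (abs_nonneg _) hε.le
    nlinarith [mul_nonneg hε.le (abs_nonneg (y - x))]
  have := (convex_uIcc x y).norm_image_sub_le_of_norm_hasDerivWithin_le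
    (fun s _ => (hder s).hasDerivWithinAt) hbound Set.left_mem_uIcc Set.right_mem_uIcc
  simp only [hG, sub_self, mul_zero, sub_zero, Real.norm_eq_abs] at this
  rwa [mul_assoc ε, abs_mul_abs_self, ← pow_two] at this

/-- Second-order expansion along the increments of a continuous process, in trapezoidal form. -/
lemma IsContAdapted.exists_incr_comp_trapezoid [IsProbabilityMeasure μ] (hX : IsContAdapted ℱ X)
    {g : ℝ → ℝ} (hg : ContDiff ℝ 2 g) : ∃ a : GridIndex → ℕ → ℝ≥0 → Ω → ℝ,
      (∀ T, UnifSmall μ τ T a) ∧ ∀ i n t ω, incr (fun t ω => g (X t ω)) i n t ω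
        = midVal (fun t ω => deriv g (X t ω)) i n t ω * incr X i n t ω
          + a i n t ω * (incr X i n t ω * incr X i n t ω) := by
  refine ⟨fun i n t ω => if incr X i n t ω = 0 then 0 else
    (incr (fun t ω => g (X t ω)) i n t ω - midVal (fun t ω => deriv g (X t ω)) i n t ω
      * incr X i n t ω) / incr X i n t ω ^ 2, fun T ε hε η hη => ?_, fun i n t ω => ?_⟩
  · have hη2 := ENNReal.half_pos hη.ne'
    obtain ⟨C, hC, hw⟩ := hX.whp_bound (μ := μ) T hη2
    obtain ⟨δ, hδ, hd⟩ := abs_trapezoid_le hg C (half_pos hε)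
    refine (hw.and (hX.unifSmall_incr (τ := τ) δ hδ (η / 2) hη2)).mono
      (Eventually.of_forall fun i ω h t ht n hn => ?_)
    have hb : ∀ s, |X (min s t) ω| ≤ C := fun s => h.1 _ ((min_le_right _ _).trans ht.1)
    have hs := hd _ _ (hb (i.2.2 n)) (hb (i.2.2 (n + 1))) (h.2 t ht n hn)
    beta_reduce
    split_ifs with h0
    · simpa using hε
    have hpos : 0 < incr X i n t ω ^ 2 := by positivity
    rw [abs_div, abs_of_pos hpos, div_lt_iff₀ hpos]
    refine lt_of_le_of_lt ?_ (mul_lt_mul_of_pos_right (half_lt_self hε) hpos)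
    refine le_trans (le_of_eq (congrArg _ ?_)) hs
    simp only [incr, midVal, leftVal]
    ring
  · beta_reduce
    split_ifs with h0
    · have : X (min (i.2.2 (n + 1)) t) ω = X (min (i.2.2 n) t) ω := sub_eq_zero.1 h0
      rw [h0]
      simp [incr, this]
    · field_simp
      ring

/-- The Stratonovich chain rule `d(p F(q)) = F(q) ∘ dp + p F'(q) ∘ dq`, at the level of sums. -/
lemma small_mul_comp_sub_trapSum [IsProbabilityMeasure μ] {p q : ℝ≥0 → Ω → ℝ}
    (hp : IsGoodIntegrator ℱ μ p) (hq : IsGoodIntegrator ℱ μ q) {F : ℝ → ℝ}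
    (hF : ContDiff ℝ 2 F) :
    Small μ τ T (fun i t ω => p t ω * F (q t ω) - p 0 ω * F (q 0 ω)
      - trapSum (fun t ω => F (q t ω)) p i.2.1 i.2.2 t ω
      - trapSum (fun t ω => p t ω * deriv F (q t ω)) q i.2.1 i.2.2 t ω) := by
  have hF1 : ContDiff ℝ 1 (deriv F) := by
    have : ContDiff ℝ (1 + 1) F := by simpa [one_add_one_eq_two] using hF
    exact ((contDiff_succ_iff_deriv).1 this).2.2
  obtain ⟨a, ha, hag⟩ := hq.toIsContAdapted.exists_incr_comp_trapezoid (μ := μ) (τ := τ) hF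
  have hqq := bdd_gridSum_abs_incr_mul (τ := τ) (T := T) hq.hasBddQV hq.hasBddQV
  have hpu := hp.toIsContAdapted.unifSmall_incr (μ := μ) (τ := τ) (T := T)
  have s1 := small_gridSum_mul_of_unifSmall (ha T) (bdd_gridSum_leftVal_mul
    (Y := fun _ => p) hp.toIsContAdapted.bdd hqq)
  have s2 := small_gridSum_mul_of_unifSmall (hpu.mul (ha T)) hqq
  have s3 := small_gridSum_mul_of_unifSmall hpu (bdd_gridSum_abs_incr_mul
    (hq.hasBddQV.comp hF1 hq.toIsContAdapted) hq.hasBddQV)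
  refine ((s1.add (s2.mul_bdd (bdd_const (1 / 2)))).sub (s3.mul_bdd (bdd_const (1 / 4)))).congr <|
    (eventually_isPartition T one_pos).mono fun i hi ω t ht => ?_
  rw [← gridSum_incr hi ht.1 (fun t ω => p t ω * F (q t ω)) ω, trapSum_eq_gridSum,
    trapSum_eq_gridSum]
  simp only [gridSum, Finset.sum_mul, ← Finset.sum_add_distrib, ← Finset.sum_sub_distrib]
  refine Finset.sum_congr rfl fun n _ => ?_
  have e := hag i n t ω
  rw [midVal] at e
  rw [midVal, midVal, incr_mul p (fun t ω => F (q t ω)), incr_mul p (fun t ω => deriv F (q t ω)),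
    show leftVal (fun t ω => p t ω * deriv F (q t ω)) i n t ω
      = leftVal p i n t ω * leftVal (fun t ω => deriv F (q t ω)) i n t ω from rfl]
  linear_combination (leftVal p i n t ω + 1 / 2 * incr p i n t ω) * e

/-- The terms `e i n` behave like increments over the `n`-th partition interval: stopped at the
partition point `σ m`, they are unchanged if the interval lies before it and vanish otherwise. -/
def IsLocal (e : GridIndex → ℕ → ℝ≥0 → Ω → ℝ) : Prop :=
  ∀ i, Monotone i.2.2 → ∀ m n t ω, e i n (min (i.2.2 m) t) ω = if n < m then e i n t ω else 0

lemma IsLocal.gridSum_min {e : GridIndex → ℕ → ℝ≥0 → Ω → ℝ} (he : IsLocal e) {i : GridIndex}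
    (hi : Monotone i.2.2) {m : ℕ} (hm : m ≤ i.2.1) (t : ℝ≥0) (ω : Ω) :
    gridSum e i (min (i.2.2 m) t) ω = ∑ n ∈ Finset.range m, e i n t ω := by
  simp only [gridSum, he i hi]
  rw [← Finset.sum_filter]
  congr 1
  ext n
  simp only [Finset.mem_filter, Finset.mem_range]
  omega

lemma IsLocal.incr_gridSum {e : GridIndex → ℕ → ℝ≥0 → Ω → ℝ} (he : IsLocal e) {i : GridIndex}
    (hi : Monotone i.2.2) {n : ℕ} (hn : n < i.2.1) (t : ℝ≥0) (ω : Ω) :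
    incr (gridSum e i) i n t ω = e i n t ω := by
  rw [incr, he.gridSum_min hi hn, he.gridSum_min hi hn.le, Finset.sum_range_succ]
  ring

lemma IsLocal.gridSum_zero {e : GridIndex → ℕ → ℝ≥0 → Ω → ℝ} (he : IsLocal e) {i : GridIndex}
    {δ : ℝ} (hi : IsPartition T δ i.2.1 i.2.2) (ω : Ω) : gridSum e i 0 ω = 0 := by
  have h := he.gridSum_min hi.mono (Nat.zero_le _) 0 ω
  rwa [hi.left, min_self, Finset.sum_range_zero] at h

/-- If the sums `E` of good increments are uniformly small, so are the sums of their squares, because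
`∑ e² = E² - 2 ∑ E e`. -/
lemma IsLocal.small_gridSum_sq {e : GridIndex → ℕ → ℝ≥0 → Ω → ℝ} (he : IsLocal e)
    (hint : Integ ℱ μ τ T e) (hE : Small μ τ T (gridSum e))
    (had : ∀ i, StronglyAdapted ℱ (gridSum e i)) :
    Small μ τ T (gridSum fun i n t ω => e i n t ω ^ 2) := by
  refine ((hE.mul_bdd hE.bdd).sub ((hint.small had hE).mul_bdd (bdd_const 2))).congr <|
    (eventually_isPartition T one_pos).mono fun i hi ω t ht => ?_
  have h := gridSum_sq_incr hi ht.1 (gridSum e i) ω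
  rw [he.gridSum_zero hi] at h
  have e1 : gridSum (fun i n t ω => e i n t ω ^ 2) i t ω
      = gridSum (fun j n t ω => incr (gridSum e i) j n t ω ^ 2) i t ω :=
    Finset.sum_congr rfl fun n hn => by
      beta_reduce
      rw [he.incr_gridSum hi.mono (Finset.mem_range.1 hn)]
  have e2 : gridSum (fun j n t ω => leftVal (gridSum e i) j n t ω * incr (gridSum e i) j n t ω) i t ω
      = gridSum (fun i n t ω => leftVal (gridSum e i) i n t ω * e i n t ω) i t ω :=
    Finset.sum_congr rfl fun n hn => by
      beta_reduce
      rw [he.incr_gridSum hi.mono (Finset.mem_range.1 hn)]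
  rw [e1, h, e2]
  ring

/-- If the sums of the increments `e` are uniformly small, so are their sums against a smoothed
process, by summation by parts. -/
lemma IsLocal.small_gridSum_backAvg [IsProbabilityMeasure μ] {e : GridIndex → ℕ → ℝ≥0 → Ω → ℝ}
    (he : IsLocal e) (hE : Small μ τ T (gridSum e))
    (hdep : ∀ h h' π t ω, gridSum e (h, π) t ω = gridSum e (h', π) t ω)
    (hZ : IsContAdapted ℱ Z) :
    Small μ τ T (gridSum fun i n t ω => leftVal (backAvg i.1 Z) i n t ω * e i n t ω) := by
  intro ε hε η hη
  have hη2 := ENNReal.half_pos hη.ne'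
  obtain ⟨C, hC, hZC⟩ := hZ.exists_bound (μ := μ) T hη2
  refine eventually_gridFilter_iff.2 ?_
  filter_upwards [self_mem_nhdsWithin] with h hh
  replace hh : 0 < h := hh
  have hT : (0 : ℝ) ≤ T := T.2
  set ε' : ℝ := ε / (2 * (3 * C + 2 * C / h * T + 1)) with hε'
  have hε'0 : 0 < ε' := by positivity
  obtain ⟨h0, hw⟩ := (eventually_gridFilter_iff.1 (hE ε' hε'0 _ hη2)).exists
  filter_upwards [hw, (hasBasis_meshFilter T).mem_of_mem one_pos] with π g2 hπ
  replace hπ : IsPartition T 1 π.1 π.2 := hπ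
  refine measure_not_le_of_and hZC g2 fun ω g1 g2 t ht => ?_
  have gE : ∀ s ∈ horizon τ T ω, |gridSum e (h, π) s ω| ≤ ε' := fun s hs => by
    rw [hdep h h0]
    exact (g2 s hs).le
  have hσ := abs_sum_sub_integral_le hπ ht.1 (b := fun s => backAvgDeriv h Z s ω)
    (x := fun _ => 0) (ξ := fun n => gridSum e (h, π) (min (π.2 (n + 1)) t) ω) (ε := ε')
    (C := 2 * C / h) ((hZ.continuous_backAvgDeriv h ω).intervalIntegrable _ _)
    (fun s _ hst => abs_backAvgDeriv_le hh g1 (hst.trans (NNReal.coe_le_coe.2 ht.1)))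
    continuous_const (fun n _ s _ _ => by
      rw [sub_zero]
      exact gE _ (min_mem_horizon ht))
  simp only [zero_mul, intervalIntegral.integral_zero, sub_zero] at hσ
  have e1 := gridSum_incr (i := (h, π)) hπ ht.1
    (fun t ω => backAvg h Z t ω * gridSum e (h, π) t ω) ω
  rw [he.gridSum_zero (i := (h, π)) hπ, mul_zero, sub_zero] at e1
  have e2 : gridSum (fun i n t ω => leftVal (backAvg i.1 Z) i n t ω * e i n t ω) (h, π) t ω
      = gridSum (incr fun t ω => backAvg h Z t ω * gridSum e (h, π) t ω) (h, π) t ω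
        - ∑ n ∈ Finset.range π.1, gridSum e (h, π) (min (π.2 (n + 1)) t) ω *
        (∫ s in ((min (π.2 n) t : ℝ≥0) : ℝ)..(min (π.2 (n + 1)) t : ℝ≥0),
          backAvgDeriv h Z s ω) := by
    rw [gridSum, gridSum, ← Finset.sum_sub_distrib]
    refine Finset.sum_congr rfl fun n hn => ?_
    rw [← hZ.backAvg_sub, ← he.incr_gridSum (i := (h, π)) hπ.mono (Finset.mem_range.1 hn)]
    simp only [incr, leftVal]
    ring
  rw [e2, e1]
  have e3 : |backAvg h Z t ω * gridSum e (h, π) t ω| ≤ 3 * C * ε' := by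
    rw [abs_mul]
    exact mul_le_mul (hZ.abs_backAvg_le hh g1 ht.1) (gE t ht) (abs_nonneg _) (by positivity)
  refine (abs_sub _ _).trans_lt ?_
  have e4 : ε' * (2 * C / h) * (t : ℝ) ≤ ε' * (2 * C / h) * T := by
    have : (t : ℝ) ≤ T := NNReal.coe_le_coe.2 ht.1
    gcongr
  have e5 : ε' * (3 * C + 2 * C / h * T + 1) = ε / 2 := by
    rw [hε']
    field_simp
  nlinarith

/-- If the sums of good increments `e` are uniformly small, so are the sums of `e` against the
trapezoidal values of a continuous process `Z` of bounded quadratic variation: the left values of `Z`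
are replaced by backward averages, and the increments of `Z` are treated by the Cauchy–Schwarz
inequality. -/
lemma IsLocal.small_gridSum_midVal_mul [IsProbabilityMeasure μ]
    {e : GridIndex → ℕ → ℝ≥0 → Ω → ℝ} (he : IsLocal e)
    (hint : Integ ℱ μ τ T e) (hE : Small μ τ T (gridSum e))
    (had : ∀ i, StronglyAdapted ℱ (gridSum e i))
    (hdep : ∀ h h' π t ω, gridSum e (h, π) t ω = gridSum e (h', π) t ω)
    (hZ : IsContAdapted ℱ Z) (hZq : HasBddQV μ Z) :
    Small μ τ T (gridSum fun i n t ω => midVal Z i n t ω * e i n t ω) := by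
  have s1 := hint.small (H := fun i t ω => Z t ω - backAvg |i.1| Z t ω)
    (fun i => (hZ.sub (hZ.backAvg (abs_nonneg _))).adapted)
    ((hZ.small_sub_backAvg (μ := μ)).congr <| (eventually_smoothing_pos T).mono
      fun i hi ω t _ => by rw [abs_of_pos hi])
  have s2 := he.small_gridSum_backAvg hE hdep hZ
  have s3 := small_gridSum_mul_of_sq (he.small_gridSum_sq hint hE had) ((hZq T).of_top (τ := τ))
  refine ((s1.add s2).add (s3.mul_bdd (bdd_const (1 / 2)))).congr <|
    (eventually_smoothing_pos T).mono fun i hi ω t _ => ?_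
  simp only [gridSum, Finset.sum_mul, ← Finset.sum_add_distrib]
  refine Finset.sum_congr rfl fun n _ => ?_
  simp only [midVal, leftVal, abs_of_pos hi]
  ring

/-- The density `b` of a drift `∫ b ds`: a progressively measurable process with locally integrable
paths, bounded in probability on compact time intervals. Continuity is not required, because `K'`
jumps. -/
structure IsDrift (ℱ : Filtration ℝ≥0 mΩ) (μ : Measure Ω) (b : ℝ≥0 → Ω → ℝ) : Prop where
  progressive : IsStronglyProgressive ℱ b
  integrable : ∀ ω (r s : ℝ), IntervalIntegrable (fun s : ℝ => b s.toNNReal ω) volume r s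
  bounded : ∀ (T : ℝ≥0) (η : ℝ≥0∞), 0 < η → ∃ C : ℝ, 0 < C ∧ μ {ω | ¬ ∀ s ≤ T, |b s ω| ≤ C} ≤ η

lemma IsDrift.incr_timeInt {b : ℝ≥0 → Ω → ℝ} (hb : IsDrift ℱ μ b) (i : GridIndex) (n : ℕ)
    (t : ℝ≥0) (ω : Ω) : incr (fun t ω => timeInt b t ω) i n t ω
      = ∫ s in ((min (i.2.2 n) t : ℝ≥0) : ℝ)..(min (i.2.2 (n + 1)) t : ℝ≥0), b s.toNNReal ω :=
  intervalIntegral.integral_interval_sub_left (hb.integrable _ _ _) (hb.integrable _ _ _)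

lemma IsDrift.bdd_gridSum_abs_incr {b : ℝ≥0 → Ω → ℝ} (hb : IsDrift ℱ μ b) :
    Bdd μ τ T (gridSum fun i n t ω => |incr (fun t ω => timeInt b t ω) i n t ω|) := by
  intro η hη
  obtain ⟨C, hC, hw⟩ := hb.bounded T η hη
  have hT : (0 : ℝ) ≤ T := T.2
  refine ⟨C * T + 1, by positivity, ?_⟩
  filter_upwards [eventually_isPartition T one_pos] with i hi
  refine (measure_mono fun ω hω => ?_).trans hw
  refine fun h => hω fun t ht => ?_
  have ham : Monotone fun n => ((min (i.2.2 n) t : ℝ≥0) : ℝ) := fun m n hmn =>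
    NNReal.coe_le_coe.2 (min_le_min_right _ (hi.mono hmn))
  have h1 : gridSum (fun i n t ω => |incr (fun t ω => timeInt b t ω) i n t ω|) i t ω
      ≤ ∑ n ∈ Finset.range i.2.1, C * (((min (i.2.2 (n + 1)) t : ℝ≥0) : ℝ)
        - (min (i.2.2 n) t : ℝ≥0)) := by
    refine Finset.sum_le_sum fun n _ => ?_
    beta_reduce
    rw [hb.incr_timeInt]
    have := intervalIntegral.norm_integral_le_of_norm_le_const
      (a := ((min (i.2.2 n) t : ℝ≥0) : ℝ)) (b := (min (i.2.2 (n + 1)) t : ℝ≥0))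
      (f := fun s => b s.toNNReal ω) (C := C) fun s hs => ?_
    · rwa [Real.norm_eq_abs, abs_of_nonneg (sub_nonneg.2 (ham (Nat.le_succ n)))] at this
    · rw [Set.uIoc_of_le (ham (Nat.le_succ n))] at hs
      exact h _ (Real.toNNReal_le_iff_le_coe.2 (hs.2.trans
        (NNReal.coe_le_coe.2 ((min_le_right _ _).trans ht.1))))
  rw [← Finset.mul_sum, Finset.sum_range_sub (fun n => ((min (i.2.2 n) t : ℝ≥0) : ℝ)),
    hi.min_right ht.1, hi.min_left, NNReal.coe_zero, sub_zero] at h1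
  rw [abs_of_nonneg (Finset.sum_nonneg fun _ _ => abs_nonneg _)]
  have : (t : ℝ) ≤ T := NNReal.coe_le_coe.2 ht.1
  nlinarith

/-- The trapezoidal sums of a continuous process against `∫ b ds` are Riemann sums. -/
lemma IsDrift.small_gridSum_midVal_mul [IsProbabilityMeasure μ] {b : ℝ≥0 → Ω → ℝ}
    (hb : IsDrift ℱ μ b) (hZ : IsContAdapted ℱ Z) :
    Small μ τ T (fun i t ω => gridSum (fun i n t ω => midVal Z i n t ω
      * incr (fun t ω => timeInt b t ω) i n t ω) i t ω
        - ∫ s in (0 : ℝ)..t, Z s.toNNReal ω * b s.toNNReal ω) := by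
  intro ε hε η hη
  have hη2 := ENNReal.half_pos hη.ne'
  obtain ⟨C, hC, hbC⟩ := hb.bounded T _ hη2
  have hT : (0 : ℝ) ≤ T := T.2
  set ε' : ℝ := ε / (2 * C * (T + 1)) with hε'
  have hε'0 : 0 < ε' := by positivity
  obtain ⟨δ, hδ, hosc⟩ := hZ.exists_osc (μ := μ) T hε'0 hη2
  filter_upwards [eventually_isPartition T hδ] with i hi
  refine measure_not_le_of_and hbC hosc fun ω g1 g2 t ht => ?_
  have hσ := abs_sum_sub_integral_le hi ht.1 (b := fun s => b s.toNNReal ω)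
    (x := fun s => Z s.toNNReal ω) (ξ := fun n => midVal Z i n t ω) (ε := ε')
    (C := C) (hb.integrable _ _ _)
    (fun s _ hst => g1 _ (Real.toNNReal_le_iff_le_coe.2 (hst.trans (NNReal.coe_le_coe.2 ht.1))))
    (hZ.continuous_real ω) (fun n hn s hs1 hs2 => by
      have hs0 : 0 ≤ s := (NNReal.coe_nonneg _).trans hs1
      have hsT : s.toNNReal ≤ T := Real.toNNReal_le_iff_le_coe.2
        (hs2.trans (NNReal.coe_le_coe.2 ((min_le_right _ _).trans ht.1)))
      have hm := (le_abs_self _).trans (hi.abs_min_sub_le hn t)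
      have k1 := g2 (min (i.2.2 (n + 1)) t) ((min_le_right _ _).trans ht.1) _ hsT (by
        rw [Real.coe_toNNReal _ hs0, abs_of_nonneg (by linarith)]
        linarith)
      have k2 := g2 (min (i.2.2 n) t) ((min_le_right _ _).trans ht.1) _ hsT (by
        rw [Real.coe_toNNReal _ hs0, abs_of_nonpos (by linarith)]
        linarith)
      simp only [midVal, leftVal, incr]
      rw [abs_lt] at k1 k2
      rw [abs_le]
      constructor <;> linarith [k1.1, k1.2, k2.1, k2.2])
  simp only [gridSum, hb.incr_timeInt]
  refine hσ.trans_lt ?_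
  have e3 : ε' * C * (t : ℝ) ≤ ε' * C * T := by
    have : (t : ℝ) ≤ T := NNReal.coe_le_coe.2 ht.1
    gcongr
  have e4 : ε' * C * (T + 1) = ε / 2 := by
    rw [hε']
    field_simp
  have e5 : 0 < ε' * C := by positivity
  nlinarith

lemma isLocal_incr (X : ℝ≥0 → Ω → ℝ) : IsLocal (incr X) := by
  intro i hi m n t ω
  simp only [incr]
  split_ifs with h
  · rw [← min_assoc, ← min_assoc, min_eq_left (hi (Nat.succ_le_of_lt h)), min_eq_left (hi h.le)]
  · push Not at h
    rw [← min_assoc, ← min_assoc, min_eq_right (hi (h.trans (Nat.le_succ n))),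
      min_eq_right (hi h), sub_self]

lemma isLocal_midVal_mul_incr (Y X : ℝ≥0 → Ω → ℝ) :
    IsLocal fun i n t ω => midVal Y i n t ω * incr X i n t ω := by
  intro i hi m n t ω
  simp only [isLocal_incr X i hi m n t ω]
  split_ifs with h
  · simp only [midVal, incr, leftVal]
    rw [← min_assoc, ← min_assoc, min_eq_left (hi (Nat.succ_le_of_lt h)), min_eq_left (hi h.le)]
  · rw [mul_zero]

/-- The trapezoidal weight is the left value plus half an increment, whose product with the
increment of `X` has bounded total absolute value. -/
lemma integ_midVal_mul_incr [IsProbabilityMeasure μ] (hX : IsGoodIntegrator ℱ μ X)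
    (hY : IsContAdapted ℱ Y) (hYq : HasBddQV μ Y) :
    Integ ℱ μ τ T (fun i n t ω => midVal Y i n t ω * incr X i n t ω) := by
  have h1 := (hX.integ T).of_top.mul_leftVal (τ := τ) (Y := fun _ => Y) (fun _ => hY.adapted)
    hY.bdd
  have h2 : Integ ℱ μ τ T (fun i n t ω => 1 / 2 * incr Y i n t ω * incr X i n t ω) := by
    refine Integ.of_abs (((bdd_gridSum_abs_incr_mul hYq hX.hasBddQV).mul
      (bdd_const (1 / 2))).of_abs_le (Eventually.of_forall fun i ω t _ => le_of_eq ?_))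
    congr 1
    simp only [gridSum, Finset.sum_mul]
    refine Finset.sum_congr rfl fun n _ => ?_
    rw [mul_assoc, abs_mul (1 / 2), abs_of_pos (by norm_num : (0 : ℝ) < 1 / 2), mul_comm]
  exact (h1.add h2).congr fun i n t ω => by simp only [midVal]; ring

/-- Associativity of the Stratonovich integral: if `dX = b dt + ∑ⱼ Yⱼ ∘ dWⱼ` on `[0, τ]`, then
`Z ∘ dX = Z b dt + ∑ⱼ (Z Yⱼ) ∘ dWⱼ` there, at the level of sums. -/
lemma small_trapSum_sub [IsProbabilityMeasure μ] {ι : Type*} [Fintype ι]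
    (hX : IsGoodIntegrator ℱ μ X) {b : ℝ≥0 → Ω → ℝ} (hb : IsDrift ℱ μ b)
    {V W : ι → ℝ≥0 → Ω → ℝ} (hV : ∀ j, IsContAdapted ℱ (V j)) (hVq : ∀ j, HasBddQV μ (V j))
    (hW : ∀ j, IsGoodIntegrator ℱ μ (W j))
    (hE : Small μ τ T (fun i t ω => X t ω - X 0 ω - timeInt b t ω
      - ∑ j, trapSum (V j) (W j) i.2.1 i.2.2 t ω))
    (hZ : IsContAdapted ℱ Z) (hZq : HasBddQV μ Z) :
    Small μ τ T (fun i t ω => trapSum Z X i.2.1 i.2.2 t ω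
      - (∫ s in (0 : ℝ)..t, Z s.toNNReal ω * b s.toNNReal ω)
      - ∑ j, trapSum (fun t ω => Z t ω * V j t ω) (W j) i.2.1 i.2.2 t ω) := by
  -- the local errors of the trapezoidal approximation of the equation
  set e : GridIndex → ℕ → ℝ≥0 → Ω → ℝ := fun i n t ω => incr X i n t ω
    - incr (fun t ω => timeInt b t ω) i n t ω - ∑ j, midVal (V j) i n t ω * incr (W j) i n t ω
    with he
  have hloc : IsLocal e := by
    intro i hi m n t ω
    have h1 := isLocal_incr X i hi m n t ω
    have h2 := isLocal_incr (fun t ω => timeInt b t ω) i hi m n t ω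
    have h3 : ∑ j, midVal (V j) i n (min (i.2.2 m) t) ω * incr (W j) i n (min (i.2.2 m) t) ω
        = ∑ j, if n < m then midVal (V j) i n t ω * incr (W j) i n t ω else 0 :=
      Finset.sum_congr rfl fun j _ => isLocal_midVal_mul_incr (V j) (W j) i hi m n t ω
    simp only [he]
    rw [h1, h2, h3]
    split_ifs <;> simp
  have hint : Integ ℱ μ τ T e :=
    (((hX.integ T).of_top.sub (Integ.of_abs hb.bdd_gridSum_abs_incr)).sub
      (Integ.sum fun j => integ_midVal_mul_incr (hW j) (hV j) (hVq j)))
  have hsum : ∀ i t ω, gridSum e i t ω = gridSum (incr X) i t ω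
      - gridSum (incr fun t ω => timeInt b t ω) i t ω
      - ∑ j, trapSum (V j) (W j) i.2.1 i.2.2 t ω := by
    intro i t ω
    simp only [trapSum_eq_gridSum]
    simp only [gridSum, he, Finset.sum_sub_distrib]
    rw [Finset.sum_comm]
  have hA : ∀ t : ℝ≥0, StronglyMeasurable[ℱ t] fun ω => timeInt b t ω := fun t =>
    stronglyMeasurable_integral_of_progressive hb.progressive t
  have hincr : ∀ {Y : ℝ≥0 → Ω → ℝ}, StronglyAdapted ℱ Y → ∀ (i : GridIndex) n t,
      StronglyMeasurable[ℱ t] fun ω => incr Y i n t ω := fun hY i n t =>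
    ((hY _).mono (ℱ.mono (min_le_right _ _))).sub ((hY _).mono (ℱ.mono (min_le_right _ _)))
  have had : ∀ i, StronglyAdapted ℱ (gridSum e i) := by
    intro i t
    refine Finset.stronglyMeasurable_fun_sum _ fun n _ => ?_
    refine ((hincr hX.adapted i n t).sub (hincr (Y := fun t ω => timeInt b t ω) hA i n t)).sub
      (Finset.stronglyMeasurable_fun_sum _ fun j _ => ?_)
    exact ((((hV j).adapted _).mono (ℱ.mono (min_le_right _ _))).add
      ((hincr (hV j).adapted i n t).const_mul _)).mul (hincr (hW j).adapted i n t)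
  have hE' : Small μ τ T (gridSum e) := hE.congr <|
    (eventually_isPartition T one_pos).mono fun i hi ω t ht => by
      rw [hsum, gridSum_incr hi ht.1, gridSum_incr hi ht.1]
      simp [timeInt]
  have s1 := hloc.small_gridSum_midVal_mul hint hE' had (fun _ _ _ _ _ => rfl) hZ hZq
  have s2 := hb.small_gridSum_midVal_mul (μ := μ) (τ := τ) (T := T) hZ
  have s3 : ∀ j, Small μ τ T (gridSum fun i n t ω => incr (W j) i n t ω
      * (incr Z i n t ω * incr (V j) i n t ω)) := fun j =>
    small_gridSum_mul_of_unifSmall (hW j).toIsContAdapted.unifSmall_incr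
      (bdd_gridSum_abs_incr_mul hZq (hVq j))
  refine ((s1.add s2).sub ((Small.sum (s := Finset.univ) s3).mul_bdd (bdd_const (1 / 4)))).congr <|
    Eventually.of_forall fun i ω t _ => ?_
  -- the mean of a product is the product of the means up to `¼ ΔZ ΔV`
  have k1 : ∀ j, trapSum (fun t ω => Z t ω * V j t ω) (W j) i.2.1 i.2.2 t ω
      = gridSum (fun i n t ω => midVal Z i n t ω * (midVal (V j) i n t ω * incr (W j) i n t ω)) i t ω
        + gridSum (fun i n t ω => incr (W j) i n t ω
          * (incr Z i n t ω * incr (V j) i n t ω)) i t ω * (1 / 4) := by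
    intro j
    rw [trapSum_eq_gridSum]
    simp only [gridSum, Finset.sum_mul, ← Finset.sum_add_distrib]
    refine Finset.sum_congr rfl fun n _ => ?_
    rw [midVal, incr_mul, midVal, midVal,
      show leftVal (fun t ω => Z t ω * V j t ω) i n t ω
        = leftVal Z i n t ω * leftVal (V j) i n t ω from rfl]
    ring
  have k2 : gridSum (fun i n t ω => midVal Z i n t ω * e i n t ω) i t ω
      = trapSum Z X i.2.1 i.2.2 t ω
        - gridSum (fun i n t ω => midVal Z i n t ω
          * incr (fun t ω => timeInt b t ω) i n t ω) i t ω
        - ∑ j, gridSum (fun i n t ω => midVal Z i n t ω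
          * (midVal (V j) i n t ω * incr (W j) i n t ω)) i t ω := by
    rw [trapSum_eq_gridSum]
    simp only [gridSum, he, mul_sub, Finset.mul_sum, Finset.sum_sub_distrib]
    rw [Finset.sum_comm]
  rw [k2, Finset.sum_congr rfl fun j _ => k1 j, Finset.sum_add_distrib, Finset.sum_mul]
  ring

end Stratonovich

/-! ### The periodic Green's function -/

section Kernel

set_option linter.unusedSectionVars false

variable {α L : ℝ}

/-- The restriction of `greenK` to a period, extended to the whole line by its formula. -/
def kerA (α L s : ℝ) : ℝ :=
  (1 / (2 * (1 - Real.exp (-L / α)))) * (Real.exp (-s / α) + Real.exp (-L / α) * Real.exp (s / α))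

/-- The derivative of `kerA`. -/
def kerB (α L s : ℝ) : ℝ :=
  (1 / (2 * α * (1 - Real.exp (-L / α)))) *
    (-Real.exp (-s / α) + Real.exp (-L / α) * Real.exp (s / α))

lemma one_sub_exp_pos (hα : 0 < α) (hL : 0 < L) : 0 < 1 - Real.exp (-L / α) := by
  have : Real.exp (-L / α) < 1 := by
    rw [← Real.exp_zero]
    exact Real.exp_lt_exp.2 (by rw [neg_div]; exact neg_neg_of_pos (by positivity))
  linarith

lemma hasDerivAt_exp_div (α s : ℝ) :
    HasDerivAt (fun s : ℝ => Real.exp (s / α)) (Real.exp (s / α) / α) s := by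
  have := ((hasDerivAt_id s).div_const α).exp
  refine this.congr_deriv ?_
  simp only [id]; ring

lemma hasDerivAt_exp_neg_div (α s : ℝ) :
    HasDerivAt (fun s : ℝ => Real.exp (-s / α)) (-Real.exp (-s / α) / α) s := by
  have := ((hasDerivAt_id s).neg.div_const α).exp
  refine this.congr_deriv ?_
  simp only [id, Pi.neg_apply]; ring

lemma hasDerivAt_kerA (hα : 0 < α) (hL : 0 < L) (s : ℝ) :
    HasDerivAt (kerA α L) (kerB α L s) s := by
  have h := ((hasDerivAt_exp_neg_div α s).add
    ((hasDerivAt_exp_div α s).const_mul (Real.exp (-L / α)))).const_mul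
    (1 / (2 * (1 - Real.exp (-L / α))))
  refine h.congr_deriv ?_
  have := (one_sub_exp_pos hα hL).ne'
  simp only [kerB]
  field_simp

lemma hasDerivAt_kerB (hα : 0 < α) (hL : 0 < L) (s : ℝ) :
    HasDerivAt (kerB α L) (kerA α L s / α ^ 2) s := by
  have h := ((hasDerivAt_exp_neg_div α s).neg.add
    ((hasDerivAt_exp_div α s).const_mul (Real.exp (-L / α)))).const_mul
    (1 / (2 * α * (1 - Real.exp (-L / α))))
  refine h.congr_deriv ?_
  have := (one_sub_exp_pos hα hL).ne'
  simp only [kerA]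
  field_simp

lemma continuous_kerA : Continuous (kerA α L) := by unfold kerA; fun_prop

lemma continuous_kerB : Continuous (kerB α L) := by unfold kerB; fun_prop

lemma kerA_sub (s : ℝ) : kerA α L (L - s) = kerA α L s := by
  simp only [kerA]
  rw [← Real.exp_add, ← Real.exp_add, add_comm]
  congr 3 <;> ring

lemma kerB_sub (s : ℝ) : kerB α L (L - s) = -kerB α L s := by
  simp only [kerB]
  rw [← Real.exp_add, ← Real.exp_add, show -(L - s) / α = -L / α + s / α by ring,
    show -L / α + (L - s) / α = -s / α by ring]
  ring

lemma kerA_period : kerA α L L = kerA α L 0 := by simpa using kerA_sub (α := α) (L := L) 0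

lemma kerB_zero (hα : 0 < α) (hL : 0 < L) : kerB α L 0 = -(1 / (2 * α)) := by
  have := (one_sub_exp_pos hα hL).ne'
  simp only [kerB, neg_zero, zero_div, Real.exp_zero]
  generalize Real.exp (-L / α) = E at this ⊢
  field_simp
  ring

lemma kerB_period (hα : 0 < α) (hL : 0 < L) : kerB α L L = 1 / (2 * α) := by
  have := kerB_sub (α := α) (L := L) 0
  rw [sub_zero, kerB_zero hα hL, neg_neg] at this
  exact this

lemma pmod_eq (hL : 0 < L) (x : ℝ) : pmod L x = L * Int.fract (x / L) := by
  rw [pmod, Int.fract, mul_sub, mul_div_cancel₀ _ hL.ne']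

lemma pmod_nonneg (hL : 0 < L) (x : ℝ) : 0 ≤ pmod L x := by
  rw [pmod_eq hL]; exact mul_nonneg hL.le (Int.fract_nonneg _)

lemma pmod_lt (hL : 0 < L) (x : ℝ) : pmod L x < L := by
  rw [pmod_eq hL]
  exact mul_lt_of_lt_one_right hL (Int.fract_lt_one _)

lemma periodic_pmod (hL : 0 < L) : Function.Periodic (pmod L) L := fun x => by
  rw [pmod_eq hL, pmod_eq hL, add_div, div_self hL.ne', Int.fract_add_one]

lemma pmod_of_mem (hL : 0 < L) {x : ℝ} (h0 : 0 ≤ x) (h1 : x < L) : pmod L x = x := by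
  rw [pmod_eq hL, Int.fract_eq_self.2 ⟨by positivity, (div_lt_one hL).2 h1⟩,
    mul_div_cancel₀ _ hL.ne']

lemma greenK_eq (x : ℝ) : greenK α L x = kerA α L (pmod L x) := rfl

lemma periodic_greenK (hL : 0 < L) : Function.Periodic (greenK α L) L := fun x => by
  rw [greenK_eq, greenK_eq, periodic_pmod hL]

lemma periodic_greenKx (hL : 0 < L) : Function.Periodic (greenKx α L) L := fun x => by
  simp only [greenKx, periodic_pmod hL x]

lemma greenK_of_mem (hL : 0 < L) {x : ℝ} (h0 : 0 ≤ x) (h1 : x ≤ L) :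
    greenK α L x = kerA α L x := by
  rcases h1.lt_or_eq with h1 | rfl
  · rw [greenK_eq, pmod_of_mem hL h0 h1]
  · have := periodic_greenK (α := α) hL 0
    rw [zero_add] at this
    rw [this, greenK_eq, pmod_of_mem hL le_rfl hL, kerA_period]

lemma greenKx_of_mem (hL : 0 < L) {x : ℝ} (h0 : 0 < x) (h1 : x < L) :
    greenKx α L x = kerB α L x := by
  rw [greenKx, pmod_of_mem hL h0.le h1, if_neg h0.ne', kerB]

lemma greenKx_zero (hL : 0 < L) : greenKx α L 0 = 0 := by
  rw [greenKx, pmod_of_mem hL le_rfl hL, if_pos rfl]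

lemma exists_sub_mem_Ico (hL : 0 < L) (x a : ℝ) : ∃ n : ℤ, x - n * L ∈ Set.Ico a (a + L) := by
  obtain ⟨n, hn, -⟩ := existsUnique_sub_zsmul_mem_Ico hL x a
  exact ⟨n, by simpa using hn⟩

lemma greenK_neg (hL : 0 < L) (x : ℝ) : greenK α L (-x) = greenK α L x := by
  obtain ⟨n, hn⟩ := exists_sub_mem_Ico hL x 0
  rw [zero_add] at hn
  have e1 : greenK α L x = greenK α L (x - n * L) := ((periodic_greenK hL).sub_int_mul_eq n).symm
  have e2 : greenK α L (-x) = greenK α L (L - (x - n * L)) := by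
    rw [show L - (x - n * L) = -x + ((n + 1 : ℤ) : ℝ) * L by push_cast; ring]
    exact ((periodic_greenK hL).int_mul (n + 1) (-x)).symm
  rw [e1, e2, greenK_of_mem hL hn.1 hn.2.le, greenK_of_mem hL (by linarith [hn.2])
    (by linarith [hn.1]), kerA_sub]

lemma greenKx_neg (hL : 0 < L) (x : ℝ) : greenKx α L (-x) = -greenKx α L x := by
  obtain ⟨n, hn⟩ := exists_sub_mem_Ico hL x 0
  rw [zero_add] at hn
  have e1 : greenKx α L x = greenKx α L (x - n * L) :=
    ((periodic_greenKx hL).sub_int_mul_eq n).symm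
  have e2 : greenKx α L (-x) = greenKx α L (L - (x - n * L)) := by
    rw [show L - (x - n * L) = -x + ((n + 1 : ℤ) : ℝ) * L by push_cast; ring]
    exact ((periodic_greenKx hL).int_mul (n + 1) (-x)).symm
  rw [e1, e2]
  rcases hn.1.eq_or_lt with h | h
  · have := periodic_greenKx (α := α) hL 0
    rw [zero_add] at this
    rw [← h, sub_zero, this, greenKx_zero hL, neg_zero]
  · rw [greenKx_of_mem hL h hn.2, greenKx_of_mem hL (by linarith [hn.2]) (by linarith), kerB_sub]

lemma continuous_greenK (hL : 0 < L) : Continuous (greenK α L) := by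
  have h : ContinuousOn (fun s => kerA α L (L * s)) (Set.Icc (0 : ℝ) 1) :=
    (continuous_kerA.comp (continuous_const.mul continuous_id)).continuousOn
  have h2 := (h.comp_fract'' (by simp [kerA_period])).comp (continuous_id.div_const L)
  refine h2.congr fun x => ?_
  simp only [Function.comp, id, greenK_eq, pmod_eq hL]

lemma measurable_greenKx : Measurable (greenKx α L) := by
  have h : Measurable (pmod L) := by
    unfold pmod
    exact measurable_id.sub (measurable_const.mul
      (measurable_from_top.comp (Int.measurable_floor.comp (measurable_id.div_const L))))
  unfold greenKx
  refine Measurable.ite (h (measurableSet_singleton 0)) measurable_const ?_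
  fun_prop

lemma abs_greenK_le (hL : 0 < L) : ∃ C, 0 < C ∧ ∀ x, |greenK α L x| ≤ C := by
  obtain ⟨C, hC⟩ := isCompact_Icc.exists_bound_of_continuousOn (s := Set.Icc 0 L)
    (continuous_kerA (α := α) (L := L)).continuousOn
  exact ⟨max C 1, by positivity, fun x => (hC _ ⟨pmod_nonneg hL x, (pmod_lt hL x).le⟩).trans
    (le_max_left _ _)⟩

lemma abs_greenKx_le (hL : 0 < L) : ∃ C, 0 < C ∧ ∀ x, |greenKx α L x| ≤ C := by
  obtain ⟨C, hC⟩ := isCompact_Icc.exists_bound_of_continuousOn (s := Set.Icc 0 L)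
    (continuous_kerB (α := α) (L := L)).continuousOn
  refine ⟨max C 1, by positivity, fun x => ?_⟩
  rw [greenKx]
  split_ifs
  · simp
  · exact (hC _ ⟨pmod_nonneg hL x, (pmod_lt hL x).le⟩).trans (le_max_left _ _)

lemma hasDerivAt_greenK (hα : 0 < α) (hL : 0 < L) {x : ℝ} (hx : ∀ n : ℤ, x ≠ n * L) :
    HasDerivAt (greenK α L) (greenKx α L x) x := by
  obtain ⟨n, hn⟩ := exists_sub_mem_Ico hL x 0
  rw [zero_add] at hn
  have h0 : 0 < x - n * L := lt_of_le_of_ne hn.1 fun h => hx n (by linarith)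
  have h1 : HasDerivAt (fun y => kerA α L (y - n * L)) (kerB α L (x - n * L)) x :=
    (hasDerivAt_kerA hα hL _).comp_sub_const x (n * L)
  rw [← (periodic_greenKx hL).sub_int_mul_eq n, greenKx_of_mem hL h0 hn.2]
  refine h1.congr_of_eventuallyEq ?_
  filter_upwards [Ioo_mem_nhds (show n * L < x by linarith) (show x < n * L + L by linarith [hn.2])]
    with y hy
  rw [← (periodic_greenK hL).sub_int_mul_eq n, greenK_of_mem hL (by linarith [hy.1])
    (by linarith [hy.2])]

/-- On a period starting at `a`, split at `b`, two translates of the kernel are given by the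
formulas `kerA`, `kerB`. -/
lemma greenK_pieces (hL : 0 < L) {a b y : ℝ} (hab : b < a + L) :
    (a < y → y < b → greenK α L (y - a) = kerA α L (y - a) ∧
      greenKx α L (y - a) = kerB α L (y - a) ∧
      greenK α L (y - b) = kerA α L (y - (b - L)) ∧
      greenKx α L (y - b) = kerB α L (y - (b - L))) ∧
    (b < y → y < a + L → a ≤ b → greenK α L (y - a) = kerA α L (y - a) ∧
      greenKx α L (y - a) = kerB α L (y - a) ∧
      greenK α L (y - b) = kerA α L (y - b) ∧
      greenKx α L (y - b) = kerB α L (y - b)) := by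
  refine ⟨fun h1 h2 => ⟨?_, ?_, ?_, ?_⟩, fun h1 h2 h3 => ⟨?_, ?_, ?_, ?_⟩⟩
  · exact greenK_of_mem hL (by linarith) (by linarith)
  · exact greenKx_of_mem hL (by linarith) (by linarith)
  · rw [← periodic_greenK hL, show y - b + L = y - (b - L) by ring]
    exact greenK_of_mem hL (by linarith) (by linarith)
  · rw [← periodic_greenKx hL, show y - b + L = y - (b - L) by ring]
    exact greenKx_of_mem hL (by linarith) (by linarith)
  · exact greenK_of_mem hL (by linarith) (by linarith)
  · exact greenKx_of_mem hL (by linarith) (by linarith)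
  · exact greenK_of_mem hL (by linarith) (by linarith)
  · exact greenKx_of_mem hL (by linarith) (by linarith)

lemma ae_restrict_Ioc_of_forall_Ioo {a b : ℝ} {P : ℝ → Prop} (h : ∀ x, a < x → x < b → P x) :
    ∀ᵐ x ∂volume.restrict (Set.Ioc a b), P x := by
  rw [← Measure.restrict_congr_set Ioo_ae_eq_Ioc]
  exact (ae_restrict_iff' measurableSet_Ioo).2 (ae_of_all _ fun x hx => h x hx.1 hx.2)

lemma intervalIntegral_congr_Ioo {a b : ℝ} (hab : a ≤ b) {f g : ℝ → ℝ}
    (h : ∀ x, a < x → x < b → f x = g x) : ∫ x in a..b, f x = ∫ x in a..b, g x := by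
  rw [intervalIntegral.integral_of_le hab, intervalIntegral.integral_of_le hab]
  exact integral_congr_ae (ae_restrict_Ioc_of_forall_Ioo h)

lemma Periodic.integral_shift {f : ℝ → ℝ} (hf : Function.Periodic f L) (a : ℝ) :
    ∫ x in (0 : ℝ)..L, f x = ∫ x in a..a + L, f x := by
  simpa using hf.intervalIntegral_add_eq 0 a

end Kernel

/-! ### Periodic Sobolev functions -/

section Sobolev

set_option linter.unusedSectionVars false

variable {α L : ℝ} {Φ g : ℝ → ℝ}

/-- `Φ` is an `L`-periodic absolutely continuous function with the `L`-periodic, locally integrable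
derivative `g`. -/
structure IsPeriodicPrimitive (L : ℝ) (Φ g : ℝ → ℝ) : Prop where
  periodic : Function.Periodic Φ L
  periodic_deriv : Function.Periodic g L
  integrable : ∀ a b, IntervalIntegrable g volume a b
  sub_eq : ∀ a b, Φ b - Φ a = ∫ x in a..b, g x

lemma IsPeriodicPrimitive.continuous (h : IsPeriodicPrimitive L Φ g) : Continuous Φ := by
  have e : Φ = fun x => Φ 0 + ∫ t in (0 : ℝ)..x, g t := by
    ext x; rw [← h.sub_eq]; ring
  rw [e]
  exact continuous_const.add (intervalIntegral.continuous_primitive h.integrable 0)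

/-- Integration by parts of an absolutely continuous function against a `C¹` function. -/
lemma IsPeriodicPrimitive.integral_mul (h : IsPeriodicPrimitive L Φ g) {ψ ψ' : ℝ → ℝ}
    (hψ : ∀ x, HasDerivAt ψ (ψ' x) x) (hψ' : Continuous ψ') (a b : ℝ) :
    ∫ x in a..b, g x * ψ x = Φ b * ψ b - Φ a * ψ a - ∫ x in a..b, Φ x * ψ' x := by
  have e : Φ = fun x => Φ a + ∫ t in a..x, g t := by
    ext x; rw [← h.sub_eq]; ring
  have hac : AbsolutelyContinuousOnInterval Φ a b := by
    have h1 := (h.integrable a b).absolutelyContinuousOnInterval_intervalIntegral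
      (c := a) Set.left_mem_uIcc
    have h2 : AbsolutelyContinuousOnInterval (fun _ : ℝ => Φ a) a b :=
      (contDiff_const (n := 1)).contDiffOn.absolutelyContinuousOnInterval
    rw [e]
    exact h2.fun_add h1
  have hψac : AbsolutelyContinuousOnInterval ψ a b := by
    have : ContDiff ℝ 1 ψ := contDiff_one_iff_deriv.2
      ⟨fun x => (hψ x).differentiableAt, by
        rw [show deriv ψ = ψ' from funext fun x => (hψ x).deriv]; exact hψ'⟩
    exact this.contDiffOn.absolutelyContinuousOnInterval
  have h1 := hac.integral_mul_deriv_eq_deriv_mul hψac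
  have h2 : ∫ x in a..b, deriv Φ x * ψ x = ∫ x in a..b, g x * ψ x := by
    refine intervalIntegral.integral_congr_ae ?_
    filter_upwards [(h.integrable a b).ae_hasDerivAt_integral] with x hx hxm
    have h3 := hx (Set.uIoc_subset_uIcc hxm) a Set.left_mem_uIcc
    rw [e, (h3.const_add (Φ a)).deriv]
  have h4 : ∫ x in a..b, Φ x * deriv ψ x = ∫ x in a..b, Φ x * ψ' x := by
    rw [show deriv ψ = ψ' from funext fun x => (hψ x).deriv]
  rw [h2, h4] at h1
  linarith

/-- The periodic extension of a smooth function supported inside a period is smooth. -/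
lemma contDiff_comp_pmod (hL : 0 < L) {θ : ℝ → ℝ} (hθ : ContDiff ℝ ((⊤ : ℕ∞) : WithTop ℕ∞) θ)
    (hs : tsupport θ ⊆ Set.Ioo 0 L) :
    ContDiff ℝ ((⊤ : ℕ∞) : WithTop ℕ∞) fun x => θ (pmod L x) := by
  have hz : ∀ x, x ∉ Set.Ioo 0 L → θ x = 0 := fun x hx =>
    image_eq_zero_of_notMem_tsupport fun h => hx (hs h)
  refine contDiff_iff_contDiffAt.2 fun x => ?_
  obtain ⟨n, hn⟩ := exists_sub_mem_Ico hL x 0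
  rw [zero_add] at hn
  -- around `x` only two translates of `θ` contribute
  have h1 : ContDiff ℝ ((⊤ : ℕ∞) : WithTop ℕ∞) fun y => θ (y - n * L) + θ (y - n * L + L) :=
    (hθ.comp (contDiff_id.sub contDiff_const)).add
      (hθ.comp ((contDiff_id.sub contDiff_const).add contDiff_const))
  refine h1.contDiffAt.congr_of_eventuallyEq ?_
  filter_upwards [Ioo_mem_nhds (show n * L - L < x by linarith [hn.1])
    (show x < n * L + L by linarith [hn.2])] with y hy
  rcases le_or_gt (n * L) y with h | h
  · rw [← (periodic_pmod hL).sub_int_mul_eq n, pmod_of_mem hL (by linarith) (by linarith [hy.2]),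
      hz (y - n * L + L) (fun hm => by linarith [hm.2]), add_zero]
  · have e : pmod L y = pmod L (y - n * L + L) := by
      rw [periodic_pmod hL, (periodic_pmod hL).sub_int_mul_eq n]
    rw [e, pmod_of_mem hL (by linarith [hy.1]) (by linarith),
      hz (y - n * L) (fun hm => by linarith [hm.1]), zero_add]

/-- The du Bois-Reymond lemma on the circle: a function orthogonal to the derivatives of all smooth
periodic functions is almost everywhere constant. -/
lemma exists_ae_eq_const (hL : 0 < L) {h : ℝ → ℝ} (hi : IntervalIntegrable h volume 0 L)
    (ho : ∀ ψ : ℝ → ℝ, ContDiff ℝ ((⊤ : ℕ∞) : WithTop ℕ∞) ψ → Function.Periodic ψ L →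
      ∫ x in (0 : ℝ)..L, h x * deriv ψ x = 0) :
    ∃ c, ∀ᵐ x ∂volume.restrict (Set.Ioc 0 L), h x = c := by
  set c : ℝ := (∫ x in (0 : ℝ)..L, h x) / L with hc
  have hi' : IntegrableOn h (Set.Ioo 0 L) :=
    ((intervalIntegrable_iff_integrableOn_Ioc_of_le hL.le).1 hi).mono_set Set.Ioo_subset_Ioc_self
  have key : ∀ᵐ x, x ∈ Set.Ioo 0 L → h x - c = 0 := by
    refine isOpen_Ioo.ae_eq_zero_of_integral_contDiff_smul_eq_zero
      ((hi'.sub (integrableOn_const (by simp))).locallyIntegrableOn) ?_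
    intro θ hθ hcs hs
    have hz : ∀ x, x ∉ Set.Ioo 0 L → θ x = 0 := fun x hx =>
      image_eq_zero_of_notMem_tsupport fun h => hx (hs h)
    have hper : ContDiff ℝ ((⊤ : ℕ∞) : WithTop ℕ∞) fun x => θ (pmod L x) :=
      contDiff_comp_pmod hL hθ hs
    have hperc := hper.continuous
    have hii : ∀ a b, IntervalIntegrable (fun x => θ (pmod L x)) volume a b := fun a b =>
      hperc.intervalIntegrable a b
    set m : ℝ := (∫ x in (0 : ℝ)..L, θ (pmod L x)) / L with hm
    -- a periodic primitive of the periodic extension of `θ` minus its mean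
    set ψ : ℝ → ℝ := fun x => (∫ y in (0 : ℝ)..x, θ (pmod L y)) - m * x with hψ
    have hd : ∀ x, HasDerivAt ψ (θ (pmod L x) - m) x := fun x => by
      have := (intervalIntegral.integral_hasDerivAt_right (hii 0 x)
        hperc.aestronglyMeasurable.stronglyMeasurableAtFilter hperc.continuousAt).sub
        ((hasDerivAt_id x).const_mul m)
      rw [mul_one] at this
      exact this
    have hdψ : deriv ψ = fun x => θ (pmod L x) - m := funext fun x => (hd x).deriv
    have hsm : ContDiff ℝ ((⊤ : ℕ∞) : WithTop ℕ∞) ψ := by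
      rw [contDiff_infty_iff_deriv, hdψ]
      exact ⟨fun x => (hd x).differentiableAt, hper.sub contDiff_const⟩
    have hpp : Function.Periodic (fun x => θ (pmod L x)) L := fun x => by
      simp only [periodic_pmod hL x]
    have hpψ : Function.Periodic ψ L := fun x => by
      have e := intervalIntegral.integral_add_adjacent_intervals (hii 0 x) (hii x (x + L))
      rw [← Periodic.integral_shift hpp x] at e
      simp only [hψ]
      rw [← e, hm]
      field_simp
      ring
    have h1 := ho ψ hsm hpψ
    rw [hdψ] at h1
    have e1 : ∫ x, θ x • (h x - c) = ∫ x in (0 : ℝ)..L, θ (pmod L x) * (h x - c) := by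
      rw [intervalIntegral.integral_of_le hL.le, ← Measure.restrict_congr_set Ioo_ae_eq_Ioc,
        ← setIntegral_eq_integral_of_forall_compl_eq_zero (s := Set.Ioo 0 L) fun x hx => by
          rw [hz x hx, zero_smul]]
      refine setIntegral_congr_fun measurableSet_Ioo fun x hx => ?_
      simp only [pmod_of_mem hL hx.1.le hx.2, smul_eq_mul]
    have hθh : IntervalIntegrable (fun x => h x * θ (pmod L x)) volume 0 L :=
      hi.mul_continuousOn hperc.continuousOn
    have e2 : ∫ x in (0 : ℝ)..L, θ (pmod L x) * (h x - c)
        = (∫ x in (0 : ℝ)..L, h x * θ (pmod L x)) - c * (m * L) := by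
      rw [← intervalIntegral.integral_congr (f := fun x => h x * θ (pmod L x)
        - c * θ (pmod L x)) (fun x _ => by ring),
        intervalIntegral.integral_sub hθh ((hii 0 L).const_mul c),
        intervalIntegral.integral_const_mul, hm, div_mul_cancel₀ _ hL.ne']
    have e3 : ∫ x in (0 : ℝ)..L, h x * (θ (pmod L x) - m)
        = (∫ x in (0 : ℝ)..L, h x * θ (pmod L x)) - (c * L) * m := by
      rw [← intervalIntegral.integral_congr (f := fun x => h x * θ (pmod L x)
        - h x * m) (fun x _ => by ring),
        intervalIntegral.integral_sub hθh (hi.mul_const m),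
        intervalIntegral.integral_mul_const, hc, div_mul_cancel₀ _ hL.ne']
    rw [e1, e2]
    rw [e3] at h1
    linarith
  refine ⟨c, ?_⟩
  rw [← Measure.restrict_congr_set Ioo_ae_eq_Ioc]
  refine (ae_restrict_iff' measurableSet_Ioo).2 ?_
  filter_upwards [key] with x hx hxm
  exact sub_eq_zero.1 (hx hxm)

lemma HasPeriodicWeakDeriv.intervalIntegrable (hL : 0 < L) {φ φx : ℝ → ℝ}
    (h : HasPeriodicWeakDeriv L φ φx) : IntervalIntegrable φ volume 0 L ∧
      IntervalIntegrable φx volume 0 L := by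
  have : IsFiniteMeasure (volume.restrict (Set.Ioc 0 L)) := ⟨by simp⟩
  rw [intervalIntegrable_iff_integrableOn_Ioc_of_le hL.le,
    intervalIntegrable_iff_integrableOn_Ioc_of_le hL.le]
  exact ⟨h.memLp.integrable (by norm_num), h.memLp_deriv.integrable (by norm_num)⟩

/-- A periodic Sobolev function has a periodic absolutely continuous representative. -/
lemma HasPeriodicWeakDeriv.exists_primitive (hL : 0 < L) {φ φx : ℝ → ℝ}
    (h : HasPeriodicWeakDeriv L φ φx) : ∃ Φ g, IsPeriodicPrimitive L Φ g ∧
      (∀ᵐ x ∂volume.restrict (Set.Ioc 0 L), φ x = Φ x) ∧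
      (∀ᵐ x ∂volume.restrict (Set.Ioc 0 L), φx x = g x) := by
  obtain ⟨hi, hix⟩ := h.intervalIntegrable hL
  set g : ℝ → ℝ := fun x => φx (pmod L x) with hg
  have hgx : ∀ᵐ x ∂volume.restrict (Set.Ioc 0 L), φx x = g x :=
    ae_restrict_Ioc_of_forall_Ioo fun x h0 h1 => by simp only [hg, pmod_of_mem hL h0.le h1]
  have hper : Function.Periodic g L := fun x => by simp only [hg, periodic_pmod hL x]
  have hg0 : IntervalIntegrable g volume 0 L := by
    rw [intervalIntegrable_iff_integrableOn_Ioc_of_le hL.le] at hix ⊢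
    exact (integrable_congr hgx).1 hix
  have hgi : ∀ a b, IntervalIntegrable g volume a b := hper.intervalIntegrable₀ hL.ne' hg0
  have hint : ∀ ψ : ℝ → ℝ, ∫ x in (0 : ℝ)..L, φx x * ψ x = ∫ x in (0 : ℝ)..L, g x * ψ x := by
    intro ψ
    rw [intervalIntegral.integral_of_le hL.le, intervalIntegral.integral_of_le hL.le]
    refine integral_congr_ae (hgx.mono fun x hx => ?_)
    simp only [hx]
  have hmean : ∫ x in (0 : ℝ)..L, g x = 0 := by
    have := h.integral_eq (fun _ => 1) contDiff_const (fun _ => rfl)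
    rw [hint] at this
    simpa using this
  set Ψ : ℝ → ℝ := fun x => ∫ y in (0 : ℝ)..x, g y with hΨ
  have hprim : IsPeriodicPrimitive L Ψ g := by
    refine ⟨fun x => ?_, hper, hgi, fun a b =>
      intervalIntegral.integral_interval_sub_left (hgi _ _) (hgi _ _)⟩
    have e := intervalIntegral.integral_add_adjacent_intervals (hgi 0 x) (hgi x (x + L))
    rw [← Periodic.integral_shift hper x, hmean, add_zero] at e
    exact e.symm
  obtain ⟨c, hc⟩ := exists_ae_eq_const hL (h := fun x => φ x - Ψ x)
    (hi.sub (hprim.continuous.intervalIntegrable _ _)) fun ψ hψ hψp => by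
      have hd : ∀ x, HasDerivAt ψ (deriv ψ x) x := fun x =>
        (hψ.differentiable (by simp) x).hasDerivAt
      have hdc : Continuous (deriv ψ) := hψ.continuous_deriv (by simp)
      have e1 := h.integral_eq ψ hψ hψp
      have e2 := hprim.integral_mul hd hdc 0 L
      have e3 : Ψ L = Ψ 0 := by simpa using hprim.periodic 0
      have e4 : ψ L = ψ 0 := by simpa using hψp 0
      rw [hint, e2, e3, e4] at e1
      simp only [sub_mul]
      rw [intervalIntegral.integral_sub (hi.mul_continuousOn hdc.continuousOn)
        (g := fun x => Ψ x * deriv ψ x) ((hprim.continuous.mul hdc).intervalIntegrable _ _), e1]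
      ring
  refine ⟨fun x => c + Ψ x, g, ⟨fun x => ?_, hper, hgi, fun a b => ?_⟩, ?_, hgx⟩
  · simp only [hprim.periodic x]
  · rw [← hprim.sub_eq]; ring
  · filter_upwards [hc] with x hx
    linarith

end Sobolev

/-! ### Pairings with the kernel -/

section Pairing

set_option linter.unusedSectionVars false

variable {α L : ℝ} {Φ g : ℝ → ℝ}

/-- The pairing `∫ Φ(x) K(x - q) dx` over a period, as a function of `q`. -/
def pairing (α L : ℝ) (Φ : ℝ → ℝ) (q : ℝ) : ℝ := ∫ x in q..q + L, Φ x * kerA α L (x - q)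

/-- The derivative `-∫ Φ(x) K'(x - q) dx` of `pairing`. -/
def pairingDeriv (α L : ℝ) (Φ : ℝ → ℝ) (q : ℝ) : ℝ := -∫ x in q..q + L, Φ x * kerB α L (x - q)

/-- The dependence on `q` of the exponentials is factored out, which leaves primitives of continuous
functions. -/
lemma integral_mul_exp (hΦ : Continuous Φ) (a b q : ℝ) :
    ∫ x in q..q + L, Φ x * (a * Real.exp (-(x - q) / α) + b * Real.exp ((x - q) / α))
      = a * Real.exp (q / α) * ((∫ x in (0 : ℝ)..q + L, Φ x * Real.exp (-x / α))
          - ∫ x in (0 : ℝ)..q, Φ x * Real.exp (-x / α))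
        + b * Real.exp (-q / α) * ((∫ x in (0 : ℝ)..q + L, Φ x * Real.exp (x / α))
          - ∫ x in (0 : ℝ)..q, Φ x * Real.exp (x / α)) := by
  have c1 : Continuous fun x => Φ x * Real.exp (-x / α) := by fun_prop
  have c2 : Continuous fun x => Φ x * Real.exp (x / α) := by fun_prop
  rw [intervalIntegral.integral_interval_sub_left (c1.intervalIntegrable _ _)
    (c1.intervalIntegrable _ _), intervalIntegral.integral_interval_sub_left
    (c2.intervalIntegrable _ _) (c2.intervalIntegrable _ _),
    ← intervalIntegral.integral_const_mul, ← intervalIntegral.integral_const_mul,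
    ← intervalIntegral.integral_add ((c1.intervalIntegrable _ _).const_mul _)
      ((c2.intervalIntegrable _ _).const_mul _)]
  refine intervalIntegral.integral_congr fun x _ => ?_
  rw [show -(x - q) / α = q / α + -x / α by ring, show (x - q) / α = -q / α + x / α by ring,
    Real.exp_add, Real.exp_add]
  ring

lemma hasDerivAt_integral_mul_exp (hΦ : Continuous Φ) (a b q : ℝ) :
    HasDerivAt (fun q => ∫ x in q..q + L, Φ x * (a * Real.exp (-(x - q) / α)
        + b * Real.exp ((x - q) / α)))
      (Φ (q + L) * (a * Real.exp (-L / α) + b * Real.exp (L / α)) - Φ q * (a + b)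
        + ∫ x in q..q + L, Φ x * (a / α * Real.exp (-(x - q) / α)
          + -(b / α) * Real.exp ((x - q) / α))) q := by
  have c1 : Continuous fun x => Φ x * Real.exp (-x / α) := by fun_prop
  have c2 : Continuous fun x => Φ x * Real.exp (x / α) := by fun_prop
  have d : ∀ {f : ℝ → ℝ}, Continuous f → ∀ y, HasDerivAt (fun y => ∫ x in (0 : ℝ)..y, f x) (f y) y :=
    fun hf y => intervalIntegral.integral_hasDerivAt_right (hf.intervalIntegrable _ _)
      hf.aestronglyMeasurable.stronglyMeasurableAtFilter hf.continuousAt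
  have h1 := ((hasDerivAt_exp_div α q).const_mul a).mul
    (((d c1 (q + L)).comp_add_const q L).sub (d c1 q))
  have h2 := ((hasDerivAt_exp_neg_div α q).const_mul b).mul
    (((d c2 (q + L)).comp_add_const q L).sub (d c2 q))
  have e : (fun q => ∫ x in q..q + L, Φ x * (a * Real.exp (-(x - q) / α)
        + b * Real.exp ((x - q) / α))) = _ := funext fun q => integral_mul_exp hΦ a b q
  rw [e]
  refine (h1.add h2).congr_deriv ?_
  rw [integral_mul_exp hΦ, Pi.sub_apply, Pi.sub_apply]
  have e1 : Real.exp (-(q + L) / α) = Real.exp (-q / α) * Real.exp (-L / α) := by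
    rw [← Real.exp_add]; congr 1; ring
  have e2 : Real.exp ((q + L) / α) = Real.exp (q / α) * Real.exp (L / α) := by
    rw [← Real.exp_add]; congr 1; ring
  have e3 : Real.exp (q / α) * Real.exp (-q / α) = 1 := by
    rw [← Real.exp_add, ← Real.exp_zero]; congr 1; ring
  rw [e1, e2]
  linear_combination (Φ (q + L) * (a * Real.exp (-L / α) + b * Real.exp (L / α))
    - Φ q * (a + b)) * e3

/-- The boundary terms cancel because `K` takes the same value at both ends of a period. -/
lemma hasDerivAt_pairing (hα : 0 < α) (hL : 0 < L) (hΦ : Continuous Φ)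
    (hp : Function.Periodic Φ L) (q : ℝ) :
    HasDerivAt (pairing α L Φ) (pairingDeriv α L Φ q) q := by
  set c : ℝ := 1 / (2 * (1 - Real.exp (-L / α))) with hc
  have h := hasDerivAt_integral_mul_exp (α := α) (L := L) hΦ c (c * Real.exp (-L / α)) q
  have e : pairing α L Φ = fun q => ∫ x in q..q + L, Φ x * (c * Real.exp (-(x - q) / α)
        + c * Real.exp (-L / α) * Real.exp ((x - q) / α)) := by
    ext q
    exact intervalIntegral.integral_congr fun x _ => by simp only [kerA, hc]; ring
  rw [e]
  refine h.congr_deriv ?_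
  have e2 : ∫ x in q..q + L, Φ x * (c / α * Real.exp (-(x - q) / α)
          + -(c * Real.exp (-L / α) / α) * Real.exp ((x - q) / α)) = pairingDeriv α L Φ q := by
    rw [pairingDeriv, ← intervalIntegral.integral_neg]
    refine intervalIntegral.integral_congr fun x _ => ?_
    have := (one_sub_exp_pos hα hL).ne'
    simp only [kerB, hc]
    field_simp
    ring
  have e3 : Real.exp (-L / α) * Real.exp (L / α) = 1 := by
    rw [← Real.exp_add, ← Real.exp_zero]; congr 1; ring
  rw [e2, hp q]
  linear_combination (Φ q * c) * e3

/-- The kernel is the Green's function of `1 - α² ∂²`: the pairing `F` solves `F - α² F'' = α Φ`. The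
term `α Φ` comes from the jump of `K'`. -/
lemma hasDerivAt_pairingDeriv (hα : 0 < α) (hL : 0 < L) (hΦ : Continuous Φ)
    (hp : Function.Periodic Φ L) (q : ℝ) :
    HasDerivAt (pairingDeriv α L Φ) ((pairing α L Φ q - α * Φ q) / α ^ 2) q := by
  set c : ℝ := 1 / (2 * α * (1 - Real.exp (-L / α))) with hc
  have hne := (one_sub_exp_pos hα hL).ne'
  have h := (hasDerivAt_integral_mul_exp (α := α) (L := L) hΦ (-c) (c * Real.exp (-L / α)) q).neg
  have e : pairingDeriv α L Φ = -fun q => ∫ x in q..q + L, Φ x * (-c * Real.exp (-(x - q) / α)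
        + c * Real.exp (-L / α) * Real.exp ((x - q) / α)) := by
    ext q
    rw [pairingDeriv, Pi.neg_apply]
    congr 1
    exact intervalIntegral.integral_congr fun x _ => by simp only [kerB, hc]; ring
  rw [e]
  refine h.congr_deriv ?_
  have e2 : ∫ x in q..q + L, Φ x * (-c / α * Real.exp (-(x - q) / α)
          + -(c * Real.exp (-L / α) / α) * Real.exp ((x - q) / α))
          = -(pairing α L Φ q / α ^ 2) := by
    rw [pairing, ← intervalIntegral.integral_div, ← intervalIntegral.integral_neg]
    refine intervalIntegral.integral_congr fun x _ => ?_
    simp only [kerA, hc]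
    field_simp
    ring
  have e3 : Real.exp (-L / α) * Real.exp (L / α) = 1 := by
    rw [← Real.exp_add, ← Real.exp_zero]; congr 1; ring
  have e4 : 2 * c * (1 - Real.exp (-L / α)) = 1 / α := by
    rw [hc]
    generalize Real.exp (-L / α) = E at hne ⊢
    field_simp
  rw [e2, hp q, show (pairing α L Φ q - α * Φ q) / α ^ 2 = pairing α L Φ q / α ^ 2 - Φ q * (1 / α)
    by field_simp, ← e4]
  linear_combination (-(Φ q * c)) * e3

lemma deriv_pairing (hα : 0 < α) (hL : 0 < L) (hΦ : Continuous Φ) (hp : Function.Periodic Φ L) :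
    deriv (pairing α L Φ) = pairingDeriv α L Φ :=
  funext fun q => (hasDerivAt_pairing hα hL hΦ hp q).deriv

/-- The pairing gains two derivatives over `Φ`, which is what makes the Stratonovich chain rule
applicable to the position of the peak. -/
lemma contDiff_pairing (hα : 0 < α) (hL : 0 < L) (hΦ : Continuous Φ)
    (hp : Function.Periodic Φ L) : ContDiff ℝ 2 (pairing α L Φ) := by
  have hd : Differentiable ℝ (pairing α L Φ) := fun q =>
    (hasDerivAt_pairing hα hL hΦ hp q).differentiableAt
  have h1 : ContDiff ℝ (1 + 1) (pairing α L Φ) := by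
    refine contDiff_succ_iff_deriv.2 ⟨hd, by simp, ?_⟩
    rw [deriv_pairing hα hL hΦ hp]
    refine contDiff_one_iff_deriv.2 ⟨fun q =>
      (hasDerivAt_pairingDeriv hα hL hΦ hp q).differentiableAt, ?_⟩
    rw [show deriv (pairingDeriv α L Φ) = fun q => (pairing α L Φ q - α * Φ q) / α ^ 2 from
      funext fun q => (hasDerivAt_pairingDeriv hα hL hΦ hp q).deriv]
    exact (hd.continuous.sub (continuous_const.mul hΦ)).div_const _
  simpa [one_add_one_eq_two] using h1

lemma integral_mul_greenK (hL : 0 < L) (hp : Function.Periodic Φ L) (q : ℝ) :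
    ∫ x in (0 : ℝ)..L, Φ x * greenK α L (x - q) = pairing α L Φ q := by
  have hper : Function.Periodic (fun x => Φ x * greenK α L (x - q)) L := fun x => by
    beta_reduce
    rw [hp, show x + L - q = x - q + L by ring, periodic_greenK hL]
  rw [Periodic.integral_shift hper q]
  exact intervalIntegral_congr_Ioo (by linarith) fun x h0 h1 => by
    rw [greenK_of_mem hL (by linarith) (by linarith)]

lemma integral_mul_greenKx (hL : 0 < L) (hp : Function.Periodic Φ L) (q : ℝ) :
    ∫ x in (0 : ℝ)..L, Φ x * greenKx α L (x - q) = -pairingDeriv α L Φ q := by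
  have hper : Function.Periodic (fun x => Φ x * greenKx α L (x - q)) L := fun x => by
    beta_reduce
    rw [hp, show x + L - q = x - q + L by ring, periodic_greenKx hL]
  rw [Periodic.integral_shift hper q, pairingDeriv, neg_neg]
  exact intervalIntegral_congr_Ioo (by linarith) fun x h0 h1 => by
    rw [greenKx_of_mem hL (by linarith) (by linarith)]

lemma hasDerivAt_kerA_sub (hα : 0 < α) (hL : 0 < L) (r x : ℝ) :
    HasDerivAt (fun x => kerA α L (x - r)) (kerB α L (x - r)) x :=
  (hasDerivAt_kerA hα hL _).comp_sub_const x r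

lemma hasDerivAt_kerB_sub (hα : 0 < α) (hL : 0 < L) (r x : ℝ) :
    HasDerivAt (fun x => kerB α L (x - r)) (kerA α L (x - r) / α ^ 2) x :=
  (hasDerivAt_kerB hα hL _).comp_sub_const x r

lemma IsPeriodicPrimitive.integral_deriv_mul_greenK (hα : 0 < α) (hL : 0 < L)
    (h : IsPeriodicPrimitive L Φ g) (q : ℝ) :
    ∫ x in (0 : ℝ)..L, g x * greenK α L (x - q) = pairingDeriv α L Φ q := by
  rw [integral_mul_greenK hL h.periodic_deriv, pairing,
    h.integral_mul (hasDerivAt_kerA_sub hα hL q)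
      (continuous_kerB.comp (continuous_id.sub continuous_const)), h.periodic q,
    add_sub_cancel_left, sub_self, kerA_period, pairingDeriv]
  ring

lemma periodic_pairing (hL : 0 < L) (hp : Function.Periodic Φ L) :
    Function.Periodic (pairing α L Φ) L := fun q => by
  rw [← integral_mul_greenK hL hp, ← integral_mul_greenK hL hp]
  refine intervalIntegral.integral_congr fun x _ => ?_
  rw [← periodic_greenK hL (x - (q + L)), show x - (q + L) + L = x - q by ring]

lemma periodic_pairingDeriv (hL : 0 < L) (hp : Function.Periodic Φ L) :
    Function.Periodic (pairingDeriv α L Φ) L := fun q => by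
  rw [← neg_inj, ← integral_mul_greenKx hL hp, ← integral_mul_greenKx hL hp]
  refine intervalIntegral.integral_congr fun x _ => ?_
  rw [← periodic_greenKx hL (x - (q + L)), show x - (q + L) + L = x - q by ring]

lemma continuous_pairingDeriv (hα : 0 < α) (hL : 0 < L) (hΦ : Continuous Φ)
    (hp : Function.Periodic Φ L) : Continuous (pairingDeriv α L Φ) :=
  continuous_iff_continuousAt.2 fun q => (hasDerivAt_pairingDeriv hα hL hΦ hp q).continuousAt

lemma continuous_greenK_sub (hL : 0 < L) (q : ℝ) : Continuous fun x => greenK α L (x - q) :=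
  (continuous_greenK hL).comp (continuous_id.sub continuous_const)

lemma measurable_greenKx_sub (q : ℝ) : Measurable fun x => greenKx α L (x - q) :=
  measurable_greenKx.comp (measurable_id.sub measurable_const)

lemma intervalIntegrable_of_abs_le {f : ℝ → ℝ} (hm : Measurable f) {C : ℝ} (hC : ∀ x, |f x| ≤ C)
    (a b : ℝ) : IntervalIntegrable f volume a b :=
  (intervalIntegrable_const (c := C)).mono_fun hm.aestronglyMeasurable
    (ae_of_all _ fun x => by
      exact (hC x).trans (le_abs_self C))

lemma intervalIntegrable_greenKx (hL : 0 < L) (q a b : ℝ) :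
    IntervalIntegrable (fun x => greenKx α L (x - q)) volume a b := by
  obtain ⟨C, -, hC⟩ := abs_greenKx_le (α := α) hL
  exact intervalIntegrable_of_abs_le (measurable_greenKx_sub q) (fun x => hC _) a b

lemma intervalIntegrable_greenKx_mul (hL : 0 < L) (q r a b : ℝ) :
    IntervalIntegrable (fun x => greenKx α L (x - q) * greenKx α L (x - r)) volume a b := by
  obtain ⟨C, hC0, hC⟩ := abs_greenKx_le (α := α) hL
  refine intervalIntegrable_of_abs_le (C := C * C)
    ((measurable_greenKx_sub q).mul (measurable_greenKx_sub r)) (fun x => ?_) a b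
  rw [Pi.mul_apply, abs_mul]
  exact mul_le_mul (hC _) (hC _) (abs_nonneg _) hC0.le

/-- The energy identity on an interval where the kernels are smooth: the integrand is an exact
derivative. -/
lemma IsPeriodicPrimitive.integral_flux_piece (hα : 0 < α) (hL : 0 < L)
    (h : IsPeriodicPrimitive L Φ g) (r₁ r₂ s t : ℝ) {P : ℝ → ℝ}
    (hP : P = fun x => 1 / 2 * (Φ x * (kerA α L (x - r₁) * kerA α L (x - r₂)))
      + α / 2 * (pairingDeriv α L Φ x * (kerB α L (x - r₁) * kerA α L (x - r₂)
        + kerA α L (x - r₁) * kerB α L (x - r₂))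
        - pairing α L Φ x * (kerB α L (x - r₁) * kerB α L (x - r₂)))) :
    1 / 2 * (∫ x in s..t, g x * (kerA α L (x - r₁) * kerA α L (x - r₂)))
      + 1 / α * (∫ x in s..t, (kerA α L (x - r₁) * kerA α L (x - r₂)
        + α ^ 2 / 2 * (kerB α L (x - r₁) * kerB α L (x - r₂))) * pairingDeriv α L Φ x)
      = P t - P s := by
  have cA : ∀ r, Continuous fun x => kerA α L (x - r) := fun r =>
    continuous_kerA.comp (continuous_id.sub continuous_const)
  have cB : ∀ r, Continuous fun x => kerB α L (x - r) := fun r =>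
    continuous_kerB.comp (continuous_id.sub continuous_const)
  have cF := continuous_pairingDeriv hα hL h.continuous h.periodic
  have d1 := fun x => (hasDerivAt_kerA_sub hα hL r₁ x)
  have d2 := fun x => (hasDerivAt_kerA_sub hα hL r₂ x)
  have d3 := fun x => (hasDerivAt_kerB_sub hα hL r₁ x)
  have d4 := fun x => (hasDerivAt_kerB_sub hα hL r₂ x)
  have d12 : ∀ x, HasDerivAt (fun x => kerA α L (x - r₁) * kerA α L (x - r₂))
      (kerB α L (x - r₁) * kerA α L (x - r₂) + kerA α L (x - r₁) * kerB α L (x - r₂)) x :=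
    fun x => (d1 x).mul (d2 x)
  have c12 : Continuous fun x => kerB α L (x - r₁) * kerA α L (x - r₂)
      + kerA α L (x - r₁) * kerB α L (x - r₂) :=
    ((cB r₁).mul (cA r₂)).add ((cA r₁).mul (cB r₂))
  have i1 := h.integral_mul d12 c12 s t
  set G : ℝ → ℝ := fun x => α / 2 * (pairingDeriv α L Φ x * (kerB α L (x - r₁) * kerA α L (x - r₂)
        + kerA α L (x - r₁) * kerB α L (x - r₂))
        - pairing α L Φ x * (kerB α L (x - r₁) * kerB α L (x - r₂))) with hG
  have dG : ∀ x, HasDerivAt G (1 / α * ((kerA α L (x - r₁) * kerA α L (x - r₂)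
        + α ^ 2 / 2 * (kerB α L (x - r₁) * kerB α L (x - r₂))) * pairingDeriv α L Φ x)
        - 1 / 2 * (Φ x * (kerB α L (x - r₁) * kerA α L (x - r₂)
        + kerA α L (x - r₁) * kerB α L (x - r₂)))) x := by
    intro x
    have e := (((hasDerivAt_pairingDeriv hα hL h.continuous h.periodic x).mul
      (((d3 x).mul (d2 x)).add ((d1 x).mul (d4 x)))).sub
      ((hasDerivAt_pairing hα hL h.continuous h.periodic x).mul ((d3 x).mul (d4 x)))).const_mul
      (α / 2)
    refine e.congr_deriv ?_
    simp only [Pi.mul_apply, Pi.add_apply]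
    field_simp
    ring
  have cI : Continuous fun x => 1 / α * ((kerA α L (x - r₁) * kerA α L (x - r₂)
        + α ^ 2 / 2 * (kerB α L (x - r₁) * kerB α L (x - r₂))) * pairingDeriv α L Φ x) :=
    continuous_const.mul ((((cA r₁).mul (cA r₂)).add
      (continuous_const.mul ((cB r₁).mul (cB r₂)))).mul cF)
  have cJ : Continuous fun x => 1 / 2 * (Φ x * (kerB α L (x - r₁) * kerA α L (x - r₂)
        + kerA α L (x - r₁) * kerB α L (x - r₂))) :=
    continuous_const.mul (h.continuous.mul c12)
  have i2 := intervalIntegral.integral_eq_sub_of_hasDerivAt (a := s) (b := t) (fun x _ => dG x)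
    ((cI.sub cJ).intervalIntegrable _ _)
  rw [intervalIntegral.integral_sub (cI.intervalIntegrable _ _) (cJ.intervalIntegrable _ _),
    intervalIntegral.integral_const_mul, intervalIntegral.integral_const_mul] at i2
  rw [i1, hP]
  simp only [hG] at i2
  linarith

/-- The contribution of a pair of peakons to the flux, tested against `g = Φ'`. On the two arcs
between the peaks the integrand is an exact derivative, so that only the jumps of `K'` at the peaks
contribute. -/
lemma IsPeriodicPrimitive.integral_flux_pair (hα : 0 < α) (hL : 0 < L)
    (h : IsPeriodicPrimitive L Φ g) (a b : ℝ) :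
    1 / 2 * (∫ x in (0 : ℝ)..L, g x * (greenK α L (x - a) * greenK α L (x - b)))
      + 1 / α * (∫ x in (0 : ℝ)..L, (greenK α L (x - a) * greenK α L (x - b)
        + α ^ 2 / 2 * (greenKx α L (x - a) * greenKx α L (x - b))) * pairingDeriv α L Φ x)
      = 1 / 2 * (greenK α L (a - b) * (pairingDeriv α L Φ a + pairingDeriv α L Φ b)
        - greenKx α L (a - b) * (pairing α L Φ a - pairing α L Φ b)) := by
  -- all terms are periodic in `b`, so that `b` may be moved to `[a, a + L)`
  wlog hb : b ∈ Set.Ico a (a + L) generalizing b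
  · obtain ⟨n, hn⟩ := exists_sub_mem_Ico hL b a
    have := this (b - n * L) hn
    have s1 : ∀ x, greenK α L (x - (b - n * L)) = greenK α L (x - b) := fun x => by
      rw [show x - (b - n * L) = x - b + n * L by ring]
      exact (periodic_greenK hL).int_mul n _
    have s2 : ∀ x, greenKx α L (x - (b - n * L)) = greenKx α L (x - b) := fun x => by
      rw [show x - (b - n * L) = x - b + n * L by ring]
      exact (periodic_greenKx hL).int_mul n _
    simp only [s1, s2] at this
    rwa [(periodic_pairing hL h.periodic).sub_int_mul_eq n,
      (periodic_pairingDeriv hL h.periodic).sub_int_mul_eq n] at this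
  obtain ⟨hab, hba⟩ := hb
  have hpF := periodic_pairingDeriv (α := α) hL h.periodic
  have cF := continuous_pairingDeriv hα hL h.continuous h.periodic
  have sh : ∀ x r, greenK α L (x + L - r) = greenK α L (x - r) := fun x r => by
    rw [show x + L - r = x - r + L by ring, periodic_greenK hL]
  have shx : ∀ x r, greenKx α L (x + L - r) = greenKx α L (x - r) := fun x r => by
    rw [show x + L - r = x - r + L by ring, periodic_greenKx hL]
  have p1 : Function.Periodic (fun x => g x * (greenK α L (x - a) * greenK α L (x - b))) L :=
    fun x => by simp only [sh, h.periodic_deriv x]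
  have p2 : Function.Periodic (fun x => (greenK α L (x - a) * greenK α L (x - b)
        + α ^ 2 / 2 * (greenKx α L (x - a) * greenKx α L (x - b))) * pairingDeriv α L Φ x) L :=
    fun x => by simp only [sh, shx, hpF x]
  have cK := (continuous_greenK_sub (α := α) hL a).mul (continuous_greenK_sub (α := α) hL b)
  have n1 : ∀ s t, IntervalIntegrable (fun x => g x * (greenK α L (x - a) * greenK α L (x - b)))
      volume s t := fun s t => (h.integrable s t).mul_continuousOn cK.continuousOn
  have n2 : ∀ s t, IntervalIntegrable (fun x => (greenK α L (x - a) * greenK α L (x - b)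
        + α ^ 2 / 2 * (greenKx α L (x - a) * greenKx α L (x - b))) * pairingDeriv α L Φ x)
      volume s t := fun s t => ((cK.intervalIntegrable s t).add
        ((intervalIntegrable_greenKx_mul hL a b s t).const_mul _)).mul_continuousOn cF.continuousOn
  rw [Periodic.integral_shift p1 a, Periodic.integral_shift p2 a,
    ← intervalIntegral.integral_add_adjacent_intervals (n1 a b) (n1 b _),
    ← intervalIntegral.integral_add_adjacent_intervals (n2 a b) (n2 b _)]
  have hpc := fun y => greenK_pieces (α := α) (a := a) (y := y) hL hba
  rw [intervalIntegral_congr_Ioo hab (f := fun x => g x * (greenK α L (x - a) * greenK α L (x - b)))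
      (g := fun x => g x * (kerA α L (x - a)
      * kerA α L (x - (b - L)))) (fun x h0 h1 => by
        obtain ⟨k1, k2, k3, k4⟩ := (hpc x).1 h0 h1
        rw [k1, k3]),
    intervalIntegral_congr_Ioo hba.le (f := fun x => g x * (greenK α L (x - a) * greenK α L (x - b)))
      (g := fun x => g x * (kerA α L (x - a)
      * kerA α L (x - b))) (fun x h0 h1 => by
        obtain ⟨k1, k2, k3, k4⟩ := (hpc x).2 h0 h1 hab
        rw [k1, k3]),
    intervalIntegral_congr_Ioo hab (f := fun x => (greenK α L (x - a) * greenK α L (x - b)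
      + α ^ 2 / 2 * (greenKx α L (x - a) * greenKx α L (x - b))) * pairingDeriv α L Φ x)
      (g := fun x => (kerA α L (x - a) * kerA α L (x - (b - L))
      + α ^ 2 / 2 * (kerB α L (x - a) * kerB α L (x - (b - L)))) * pairingDeriv α L Φ x)
      (fun x h0 h1 => by
        obtain ⟨k1, k2, k3, k4⟩ := (hpc x).1 h0 h1
        rw [k1, k2, k3, k4]),
    intervalIntegral_congr_Ioo hba.le (f := fun x => (greenK α L (x - a) * greenK α L (x - b)
      + α ^ 2 / 2 * (greenKx α L (x - a) * greenKx α L (x - b))) * pairingDeriv α L Φ x)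
      (g := fun x => (kerA α L (x - a) * kerA α L (x - b)
      + α ^ 2 / 2 * (kerB α L (x - a) * kerB α L (x - b))) * pairingDeriv α L Φ x)
      (fun x h0 h1 => by
        obtain ⟨k1, k2, k3, k4⟩ := (hpc x).2 h0 h1 hab
        rw [k1, k2, k3, k4])]
  have i1 := h.integral_flux_piece hα hL a (b - L) a b rfl
  have i2 := h.integral_flux_piece hα hL a b b (a + L) rfl
  have eK : greenK α L (a - b) = kerA α L (b - a) := by
    rw [← greenK_neg hL, neg_sub]
    exact greenK_of_mem hL (by linarith) (by linarith)
  have eB : greenKx α L (a - b) * (pairing α L Φ a - pairing α L Φ b)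
      = -kerB α L (b - a) * (pairing α L Φ a - pairing α L Φ b) := by
    rcases hab.eq_or_lt with rfl | hlt
    · rw [sub_self (pairing α L Φ a), mul_zero, mul_zero]
    · rw [← neg_sub b a, greenKx_neg hL, greenKx_of_mem hL (by linarith) (by linarith)]
  have f1 : kerA α L (a - (b - L)) = kerA α L (b - a) := by
    rw [← kerA_sub]; congr 1; ring
  have f2 : kerB α L (a - (b - L)) = -kerB α L (b - a) := by
    rw [← kerB_sub]; congr 1; ring
  have f3 : kerA α L (a + L - b) = kerA α L (b - a) := by
    rw [← kerA_sub]; congr 1; ring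
  have f4 : kerB α L (a + L - b) = -kerB α L (b - a) := by
    rw [← kerB_sub]; congr 1; ring
  simp only [sub_self, sub_sub_cancel, add_sub_cancel_left, kerA_period, kerB_period hα hL,
    kerB_zero hα hL, f1, f2, f3, f4, h.periodic a, periodic_pairing hL h.periodic a, hpF a]
    at i1 i2
  rw [eK, eB]
  have hα' : α * (1 / (2 * α)) = 1 / 2 := by field_simp
  linear_combination i1 + i2 + (kerA α L (b - a) * (pairingDeriv α L Φ a + pairingDeriv α L Φ b)
    + kerB α L (b - a) * (pairing α L Φ a - pairing α L Φ b)) * hα'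

end Pairing

/-! ### Superpositions of peakons -/

section Peakons

set_option linter.unusedSectionVars false

variable {α L : ℝ} {Φ g ξ φ φx : ℝ → ℝ} {κ : Type*} [Fintype κ]

/-- The derivative of `∑ₖ Pₖ K(x - Qₖ)` off the peaks, with the mean of the one-sided derivatives at
the peaks. -/
def multiPeakonDeriv (α L : ℝ) (P Q : κ → ℝ) (x : ℝ) : ℝ := ∑ k, P k * greenKx α L (x - Q k)

lemma ae_ne_add_int_mul (Q : ℝ) : ∀ᵐ x : ℝ, ∀ n : ℤ, x ≠ Q + n * L :=
  ae_all_iff.2 fun n => by simp [ae_iff, measure_singleton]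

lemma hasDerivAt_peakon (hα : 0 < α) (hL : 0 < L) (P : ℝ) {Q x : ℝ} (hx : ∀ n : ℤ, x ≠ Q + n * L) :
    HasDerivAt (peakon α L P Q) (P * greenKx α L (x - Q)) x :=
  ((hasDerivAt_greenK hα hL (x := x - Q) fun n h => hx n (by linarith)).comp_sub_const x Q).const_mul
    P

lemma ae_hasDerivAt_sum_peakon (hα : 0 < α) (hL : 0 < L) (P Q : κ → ℝ) :
    ∀ᵐ x : ℝ, HasDerivAt (fun y => ∑ k, peakon α L (P k) (Q k) y) (multiPeakonDeriv α L P Q x) x :=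
  by
  filter_upwards [ae_all_iff.2 fun k => ae_ne_add_int_mul (L := L) (Q k)] with x hx
  exact HasDerivAt.fun_sum fun k _ => hasDerivAt_peakon hα hL (P k) (hx k)

/-- The source `2 v ξ' + α² v' ξ''` of the convolution term, for the unit peakon at `Q`. -/
def peakonSource (α L : ℝ) (ξ : ℝ → ℝ) (Q y : ℝ) : ℝ :=
  2 * greenK α L (y - Q) * deriv ξ y + α ^ 2 * greenKx α L (y - Q) * deriv (deriv ξ) y

lemma ContDiff.deriv_of_two {f : ℝ → ℝ} (hf : ContDiff ℝ 2 f) : ContDiff ℝ 1 (deriv f) := by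
  have : ContDiff ℝ (1 + 1) f := by simpa [one_add_one_eq_two] using hf
  exact (contDiff_succ_iff_deriv.1 this).2.2

lemma Periodic.deriv {f : ℝ → ℝ} (hf : Function.Periodic f L) : Function.Periodic (deriv f) L :=
  fun x => by
  rw [← deriv_comp_add_const, show (fun x => f (x + L)) = f from funext hf]

lemma intervalIntegrable_peakonSource (hL : 0 < L) (hξ : ContDiff ℝ 2 ξ) (Q a b : ℝ) :
    IntervalIntegrable (peakonSource α L ξ Q) volume a b := by
  have c1 : Continuous (deriv ξ) := (ContDiff.deriv_of_two hξ).continuous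
  have c2 : Continuous (deriv (deriv ξ)) := (ContDiff.deriv_of_two hξ).continuous_deriv le_rfl
  exact (((continuous_const.mul (continuous_greenK_sub hL Q)).mul c1).intervalIntegrable a b).add
    (((intervalIntegrable_greenKx hL Q a b).const_mul _).mul_continuousOn c2.continuousOn)

/-- On an interval where both kernels are smooth, the convolution integrand is an exact
derivative. -/
lemma integral_kerA_mul_source (hα : 0 < α) (hL : 0 < L) (hξ : ContDiff ℝ 2 ξ) (r Q s t : ℝ)
    {G : ℝ → ℝ} (hG : G = fun y => α ^ 2 * (kerA α L (y - r) * kerB α L (y - Q)) * deriv ξ y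
      + kerA α L (y - r) * kerA α L (y - Q) * ξ y
      - α ^ 2 * (kerB α L (y - r) * kerB α L (y - Q)) * ξ y) :
    ∫ y in s..t, kerA α L (y - r) * (2 * kerA α L (y - Q) * deriv ξ y
      + α ^ 2 * kerB α L (y - Q) * deriv (deriv ξ) y) = G t - G s := by
  have cA : ∀ r, Continuous fun x => kerA α L (x - r) := fun r =>
    continuous_kerA.comp (continuous_id.sub continuous_const)
  have cB : ∀ r, Continuous fun x => kerB α L (x - r) := fun r =>
    continuous_kerB.comp (continuous_id.sub continuous_const)
  have hξ1 := ContDiff.deriv_of_two hξ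
  have c1 : Continuous (deriv ξ) := hξ1.continuous
  have c2 : Continuous (deriv (deriv ξ)) := hξ1.continuous_deriv le_rfl
  refine intervalIntegral.integral_eq_sub_of_hasDerivAt (fun y _ => ?_) (Continuous.intervalIntegrable
    ((cA r).mul (((continuous_const.mul (cA Q)).mul c1).add
      ((continuous_const.mul (cB Q)).mul c2))) _ _)
  have d1 := hasDerivAt_kerA_sub hα hL r y
  have d2 := hasDerivAt_kerA_sub hα hL Q y
  have d3 := hasDerivAt_kerB_sub hα hL r y
  have d4 := hasDerivAt_kerB_sub hα hL Q y
  have d5 := (hξ.differentiable two_ne_zero y).hasDerivAt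
  have d6 := (hξ1.differentiable one_ne_zero y).hasDerivAt
  have e := (((((d1.mul d4).const_mul (α ^ 2)).mul d6)).add ((d1.mul d2).mul d5)).sub
    (((d3.mul d4).const_mul (α ^ 2)).mul d5)
  rw [hG]
  refine e.congr_deriv ?_
  simp only [Pi.mul_apply]
  field_simp
  ring

/-- The convolution identity for the unit peakon. The circle is cut at `x` and at `Q`; on both arcs
the integrand is an exact derivative, and the boundary terms come from the jumps of `K'`. -/
lemma greenConv_peakonSource (hα : 0 < α) (hL : 0 < L) (hξ : ContDiff ℝ 2 ξ)
    (hp : Function.Periodic ξ L) {Q x : ℝ} (hx : ∀ n : ℤ, x ≠ Q + n * L) :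
    greenConv α L (peakonSource α L ξ Q) x = greenK α L (x - Q) * deriv ξ Q
      + greenKx α L (x - Q) * ξ Q - greenKx α L (x - Q) * ξ x := by
  -- both sides are periodic in `x`, which may be moved to `(Q, Q + L)`
  wlog hb : x ∈ Set.Ioo Q (Q + L) generalizing x
  · obtain ⟨n, hn⟩ := exists_sub_mem_Ico hL x Q
    have hx' : ∀ m : ℤ, x - n * L ≠ Q + m * L := fun m h => hx (m + n) (by push_cast; linarith)
    have := this hx' ⟨lt_of_le_of_ne hn.1 fun h => hx' 0 (by simpa using h.symm), hn.2⟩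
    have s1 : ∀ y, greenK α L (x - n * L - y) = greenK α L (x - y) := fun y => by
      rw [show x - n * L - y = x - y - n * L by ring]
      exact (periodic_greenK hL).sub_int_mul_eq n
    have s2 : ∀ y, greenKx α L (x - n * L - y) = greenKx α L (x - y) := fun y => by
      rw [show x - n * L - y = x - y - n * L by ring]
      exact (periodic_greenKx hL).sub_int_mul_eq n
    simp only [greenConv, s1, s2, hp.sub_int_mul_eq n] at this
    exact this
  obtain ⟨hQx, hxL⟩ := hb
  have hp1 := Periodic.deriv hp
  have hp2 := Periodic.deriv hp1
  have hper : Function.Periodic (fun y => greenK α L (x - y) * peakonSource α L ξ Q y) L := by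
    intro y
    have e1 : greenK α L (x - (y + L)) = greenK α L (x - y) := by
      rw [← periodic_greenK hL (x - (y + L))]; congr 1; ring
    simp only [peakonSource, e1, hp1 y, hp2 y, show y + L - Q = y - Q + L by ring,
      periodic_greenK hL (y - Q), periodic_greenKx hL (y - Q)]
  have hi : ∀ s t, IntervalIntegrable (fun y => greenK α L (x - y) * peakonSource α L ξ Q y)
      volume s t := fun s t => (intervalIntegrable_peakonSource hL hξ Q s t).continuousOn_mul
        ((continuous_greenK hL).comp (continuous_const.sub continuous_id)).continuousOn
  have hpc := fun y => greenK_pieces (α := α) (a := Q) (b := x) (y := y) hL hxL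
  have hev : ∀ y, greenK α L (x - y) = greenK α L (y - x) := fun y => by
    rw [← greenK_neg hL, neg_sub]
  rw [greenConv, Periodic.integral_shift hper Q,
    ← intervalIntegral.integral_add_adjacent_intervals (hi Q x) (hi x _)]
  rw [intervalIntegral_congr_Ioo hQx.le
      (f := fun y => greenK α L (x - y) * peakonSource α L ξ Q y)
      (g := fun y => kerA α L (y - (x - L)) * (2 * kerA α L (y - Q) * deriv ξ y
      + α ^ 2 * kerB α L (y - Q) * deriv (deriv ξ) y)) (fun y h0 h1 => by
        obtain ⟨k1, k2, k3, -⟩ := (hpc y).1 h0 h1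
        rw [hev, peakonSource, k1, k2, k3]),
    intervalIntegral_congr_Ioo hxL.le
      (f := fun y => greenK α L (x - y) * peakonSource α L ξ Q y)
      (g := fun y => kerA α L (y - x) * (2 * kerA α L (y - Q) * deriv ξ y
      + α ^ 2 * kerB α L (y - Q) * deriv (deriv ξ) y)) (fun y h0 h1 => by
        obtain ⟨k1, k2, k3, -⟩ := (hpc y).2 h0 h1 hQx.le
        rw [hev, peakonSource, k1, k2, k3]),
    integral_kerA_mul_source hα hL hξ _ _ _ _ rfl, integral_kerA_mul_source hα hL hξ _ _ _ _ rfl,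
    greenK_of_mem hL (by linarith) (by linarith), greenKx_of_mem hL (by linarith) (by linarith)]
  have f1 : kerA α L (Q - (x - L)) = kerA α L (x - Q) := by
    rw [← kerA_sub]; congr 1; ring
  have f2 : kerB α L (Q - (x - L)) = -kerB α L (x - Q) := by
    rw [← kerB_sub]; congr 1; ring
  have f3 : kerA α L (Q + L - x) = kerA α L (x - Q) := by
    rw [← kerA_sub]; congr 1; ring
  have f4 : kerB α L (Q + L - x) = -kerB α L (x - Q) := by
    rw [← kerB_sub]; congr 1; ring
  simp only [sub_self, sub_sub_cancel, add_sub_cancel_left, kerA_period, kerB_period hα hL,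
    kerB_zero hα hL, f1, f2, f3, f4, hp Q, hp1 Q]
  field_simp
  ring

lemma integral_sum_const_mul (c : κ → ℝ) {f : κ → ℝ → ℝ} {a b : ℝ}
    (hf : ∀ k, IntervalIntegrable (f k) volume a b) :
    ∫ x in a..b, ∑ k, c k * f k x = ∑ k, c k * ∫ x in a..b, f k x := by
  rw [intervalIntegral.integral_finsetSum fun k _ => (hf k).const_mul _]
  exact Finset.sum_congr rfl fun k _ => intervalIntegral.integral_const_mul _ _

lemma intervalIntegrable_sum_const_mul (c : κ → ℝ) {f : κ → ℝ → ℝ} {a b : ℝ}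
    (hf : ∀ k, IntervalIntegrable (f k) volume a b) :
    IntervalIntegrable (fun x => ∑ k, c k * f k x) volume a b := by
  simp only [intervalIntegrable_iff] at hf ⊢
  exact integrable_finsetSum _ fun k _ => (hf k).const_mul _

lemma sum_sq_eq (a : κ → ℝ) : (∑ k, a k) ^ 2 = ∑ z : κ × κ, a z.1 * a z.2 := by
  rw [pow_two, Finset.sum_mul_sum, Fintype.sum_prod_type]

lemma greenConv_congr_ae {f h : ℝ → ℝ} (hfh : ∀ᵐ y : ℝ, f y = h y) (x : ℝ) :
    greenConv α L f x = greenConv α L h x := by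
  rw [greenConv, greenConv]
  congr 1
  exact intervalIntegral.integral_congr_ae (hfh.mono fun y hy _ => by rw [hy])

lemma greenConv_sum (hL : 0 < L) (P : κ → ℝ) {f : κ → ℝ → ℝ}
    (hf : ∀ k, IntervalIntegrable (f k) volume 0 L) (x : ℝ) :
    greenConv α L (fun y => ∑ k, P k * f k y) x = ∑ k, P k * greenConv α L (f k) x := by
  have hi : ∀ k, IntervalIntegrable (fun y => greenK α L (x - y) * f k y) volume 0 L :=
    fun k => (hf k).continuousOn_mul ((continuous_greenK hL).comp
      (continuous_const.sub continuous_id)).continuousOn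
  simp only [greenConv, Finset.mul_sum]
  rw [intervalIntegral.integral_congr (g := fun y => ∑ k, P k * (greenK α L (x - y) * f k y))
    fun y _ => Finset.sum_congr rfl fun k _ => by ring,
    integral_sum_const_mul P hi, Finset.mul_sum]
  exact Finset.sum_congr rfl fun k _ => by ring

/-- The noise coefficient of a superposition of peakons: by the convolution identity, it is the
infinitesimal motion of the peakons. -/
lemma noiseCoeff_eq (hα : 0 < α) (hL : 0 < L) (hξ : ContDiff ℝ 2 ξ) (hp : Function.Periodic ξ L)
    (P Q : κ → ℝ) {vx : ℝ → ℝ} (hvx : ∀ᵐ x : ℝ, vx x = multiPeakonDeriv α L P Q x) :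
    ∀ᵐ x : ℝ, noiseCoeff α L ξ (fun y => ∑ k, peakon α L (P k) (Q k) y) vx x
      = ∑ k, P k * (greenK α L (x - Q k) * deriv ξ (Q k) + greenKx α L (x - Q k) * ξ (Q k)) := by
  filter_upwards [hvx, ae_all_iff.2 fun k => ae_ne_add_int_mul (L := L) (Q k)] with x hx hxQ
  have e : greenConv α L (fun y => 2 * (∑ k, peakon α L (P k) (Q k) y) * deriv ξ y
      + α ^ 2 * vx y * deriv (deriv ξ) y) x
      = ∑ k, P k * greenConv α L (peakonSource α L ξ (Q k)) x := by
    rw [← greenConv_sum hL P fun k => intervalIntegrable_peakonSource hL hξ (Q k) 0 L]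
    refine greenConv_congr_ae (hvx.mono fun y hy => ?_) x
    rw [hy]
    simp only [multiPeakonDeriv, peakon, peakonSource, Finset.mul_sum, Finset.sum_mul,
      ← Finset.sum_add_distrib]
    exact Finset.sum_congr rfl fun k _ => by ring
  rw [noiseCoeff, e, hx, multiPeakonDeriv, Finset.sum_mul, ← Finset.sum_add_distrib]
  refine Finset.sum_congr rfl fun k _ => ?_
  rw [greenConv_peakonSource hα hL hξ hp (hxQ k)]
  ring

lemma integral_congr_ae_Ioc (hL : 0 < L) {f h : ℝ → ℝ}
    (hfh : ∀ᵐ x ∂volume.restrict (Set.Ioc 0 L), f x = h x) :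
    ∫ x in (0 : ℝ)..L, f x = ∫ x in (0 : ℝ)..L, h x := by
  rw [intervalIntegral.integral_of_le hL.le, intervalIntegral.integral_of_le hL.le]
  exact integral_congr_ae hfh

/-- A superposition of peakons tested against `φ`. -/
lemma integral_mul_sum_peakon (hL : 0 < L) (h : IsPeriodicPrimitive L Φ g)
    (hφ : ∀ᵐ x ∂volume.restrict (Set.Ioc 0 L), φ x = Φ x) (P Q : κ → ℝ) :
    ∫ x in (0 : ℝ)..L, φ x * ∑ k, peakon α L (P k) (Q k) x = ∑ k, P k * pairing α L Φ (Q k) := by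
  rw [integral_congr_ae_Ioc hL (h := fun x => ∑ k, P k * (Φ x * greenK α L (x - Q k)))
    (hφ.mono fun x hx => by
      rw [hx, Finset.mul_sum]
      exact Finset.sum_congr rfl fun k _ => by rw [peakon]; ring),
    integral_sum_const_mul P (f := fun k x => Φ x * greenK α L (x - Q k)) fun k =>
      (h.continuous.mul (continuous_greenK_sub hL (Q k))).intervalIntegrable _ _]
  exact Finset.sum_congr rfl fun k _ => congrArg _ (integral_mul_greenK hL h.periodic _)

/-- The noise coefficient tested against `φ`, in terms of the pairing of `φ` with a unit peakon. -/
lemma integral_mul_noiseCoeff (hα : 0 < α) (hL : 0 < L) (hξ : ContDiff ℝ 2 ξ)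
    (hp : Function.Periodic ξ L) (h : IsPeriodicPrimitive L Φ g)
    (hφ : ∀ᵐ x ∂volume.restrict (Set.Ioc 0 L), φ x = Φ x) (P Q : κ → ℝ) :
    ∫ x in (0 : ℝ)..L, φ x * noiseCoeff α L ξ (fun y => ∑ k, peakon α L (P k) (Q k) y)
      (multiPeakonDeriv α L P Q) x
      = ∑ k, P k * (deriv ξ (Q k) * pairing α L Φ (Q k) - ξ (Q k) * pairingDeriv α L Φ (Q k)) := by
  have i1 : ∀ k, IntervalIntegrable (fun x => Φ x * greenK α L (x - Q k)) volume 0 L := fun k =>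
    (h.continuous.mul (continuous_greenK_sub hL (Q k))).intervalIntegrable _ _
  have i2 : ∀ k, IntervalIntegrable (fun x => Φ x * greenKx α L (x - Q k)) volume 0 L := fun k =>
    (intervalIntegrable_greenKx hL (Q k) 0 L).continuousOn_mul h.continuous.continuousOn
  rw [integral_congr_ae_Ioc hL (h := fun x => ∑ k, (P k * deriv ξ (Q k)
      * (Φ x * greenK α L (x - Q k)) + P k * ξ (Q k) * (Φ x * greenKx α L (x - Q k)))) (by
      filter_upwards [hφ, ae_restrict_of_ae (noiseCoeff_eq hα hL hξ hp P Q
        (ae_of_all _ fun x => rfl))] with x hx hn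
      rw [hx, hn, Finset.mul_sum]
      exact Finset.sum_congr rfl fun k _ => by ring),
    intervalIntegral.integral_finsetSum fun k _ => ((i1 k).const_mul _).add ((i2 k).const_mul _)]
  refine Finset.sum_congr rfl fun k _ => ?_
  rw [intervalIntegral.integral_add ((i1 k).const_mul _) ((i2 k).const_mul _),
    intervalIntegral.integral_const_mul, intervalIntegral.integral_const_mul,
    integral_mul_greenK hL h.periodic, integral_mul_greenKx hL h.periodic]
  ring

/-- Fubini's theorem for the convolution with the kernel. -/
lemma integral_mul_greenConv (hL : 0 < L) (hφ : IntervalIntegrable φ volume 0 L) {f : ℝ → ℝ}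
    (hf : IntervalIntegrable f volume 0 L) :
    IntervalIntegrable (fun x => φ x * greenConv α L f x) volume 0 L ∧
    ∫ x in (0 : ℝ)..L, φ x * greenConv α L f x
      = 1 / α * ∫ y in (0 : ℝ)..L, f y * ∫ x in (0 : ℝ)..L, φ x * greenK α L (x - y) := by
  rw [intervalIntegrable_iff_integrableOn_Ioc_of_le hL.le] at hφ hf ⊢
  obtain ⟨C, hC0, hC⟩ := abs_greenK_le (α := α) hL
  have hH : Integrable (fun z : ℝ × ℝ => φ z.1 * f z.2 * greenK α L (z.1 - z.2))
      ((volume.restrict (Set.Ioc 0 L)).prod (volume.restrict (Set.Ioc 0 L))) :=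
    (Integrable.mul_prod hφ hf).mul_bdd (c := C)
      (((continuous_greenK hL).comp (continuous_fst.sub continuous_snd)).aestronglyMeasurable)
      (ae_of_all _ fun z => hC _)
  have e1 : ∀ x, φ x * greenConv α L f x
      = 1 / α * ∫ y in Set.Ioc 0 L, φ x * f y * greenK α L (x - y) := by
    intro x
    rw [greenConv, intervalIntegral.integral_of_le hL.le, mul_left_comm, ← integral_const_mul]
    congr 1
    exact integral_congr_ae (ae_of_all _ fun y => by ring)
  constructor
  · have := (hH.integral_prod_left).const_mul (1 / α)
    exact this.congr (ae_of_all _ fun x => (e1 x).symm)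
  · simp only [intervalIntegral.integral_of_le hL.le, e1]
    rw [integral_const_mul, integral_integral_swap hH]
    congr 1
    refine integral_congr_ae (ae_of_all _ fun y => ?_)
    beta_reduce
    rw [← integral_const_mul]
    exact integral_congr_ae (ae_of_all _ fun x => by ring)

/-- The flux of a superposition of peakons, tested against `φ'`, is expressed through the
right-hand sides of the peakon equations. -/
lemma integral_mul_flux (hα : 0 < α) (hL : 0 < L) (h : IsPeriodicPrimitive L Φ g)
    (hφ : ∀ᵐ x ∂volume.restrict (Set.Ioc 0 L), φx x = g x) (P Q : κ → ℝ) :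
    ∫ x in (0 : ℝ)..L, φx x * flux α L (fun y => ∑ k, peakon α L (P k) (Q k) y)
      (multiPeakonDeriv α L P Q) x
      = ∑ k, (pairingDeriv α L Φ (Q k) * P k * ∑ l, P l * greenK α L (Q k - Q l)
        - pairing α L Φ (Q k) * P k * ∑ l, P l * greenKx α L (Q k - Q l)) := by
  set F := pairing α L Φ with hF
  set F' := pairingDeriv α L Φ with hF'
  have cF := continuous_pairingDeriv hα hL h.continuous h.periodic
  have cK : ∀ k l, Continuous fun x => greenK α L (x - Q k) * greenK α L (x - Q l) := fun k l =>
    (continuous_greenK_sub hL (Q k)).mul (continuous_greenK_sub hL (Q l))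
  set w : κ → κ → ℝ → ℝ := fun k l y => greenK α L (y - Q k) * greenK α L (y - Q l)
    + α ^ 2 / 2 * (greenKx α L (y - Q k) * greenKx α L (y - Q l)) with hw
  have iw : ∀ k l, IntervalIntegrable (w k l) volume 0 L := fun k l =>
    ((cK k l).intervalIntegrable _ _).add
      ((intervalIntegrable_greenKx_mul hL (Q k) (Q l) 0 L).const_mul _)
  set W : ℝ → ℝ := fun y => (∑ k, peakon α L (P k) (Q k) y) ^ 2
    + α ^ 2 / 2 * multiPeakonDeriv α L P Q y ^ 2 with hW
  have eW : ∀ y, W y = ∑ z : κ × κ, P z.1 * P z.2 * w z.1 z.2 y := by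
    intro y
    simp only [hW, hw, multiPeakonDeriv, peakon, sum_sq_eq, Finset.mul_sum,
      ← Finset.sum_add_distrib]
    exact Finset.sum_congr rfl fun z _ => by ring
  have iW : IntervalIntegrable W volume 0 L := by
    rw [show W = fun y => ∑ z : κ × κ, P z.1 * P z.2 * w z.1 z.2 y from funext eW]
    exact intervalIntegrable_sum_const_mul _ fun z => iw z.1 z.2
  have ig := h.integrable 0 L
  have igK : ∀ k l, IntervalIntegrable (fun x => g x * (greenK α L (x - Q k)
      * greenK α L (x - Q l))) volume 0 L := fun k l => ig.mul_continuousOn (cK k l).continuousOn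
  obtain ⟨i1, e1⟩ := integral_mul_greenConv (α := α) hL ig iW
  have cu : Continuous fun x => (∑ k, peakon α L (P k) (Q k) x) ^ 2 :=
    (continuous_finsetSum _ fun k _ => continuous_const.mul (continuous_greenK_sub hL (Q k))).pow 2
  have iu : IntervalIntegrable (fun x => g x * (1 / 2 * (∑ k, peakon α L (P k) (Q k) x) ^ 2))
      volume 0 L := ig.mul_continuousOn (continuous_const.mul cu).continuousOn
  have e2 : ∫ x in (0 : ℝ)..L, g x * (1 / 2 * (∑ k, peakon α L (P k) (Q k) x) ^ 2)
      = ∑ z : κ × κ, P z.1 * P z.2 * (1 / 2) * ∫ x in (0 : ℝ)..L, g x *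
        (greenK α L (x - Q z.1) * greenK α L (x - Q z.2)) := by
    rw [← integral_sum_const_mul _ fun z : κ × κ => igK z.1 z.2]
    refine intervalIntegral.integral_congr fun x _ => ?_
    simp only [peakon, sum_sq_eq, Finset.mul_sum]
    exact Finset.sum_congr rfl fun z _ => by ring
  have e3 : ∫ y in (0 : ℝ)..L, W y * ∫ x in (0 : ℝ)..L, g x * greenK α L (x - y)
      = ∑ z : κ × κ, P z.1 * P z.2 * ∫ x in (0 : ℝ)..L, w z.1 z.2 x * F' x := by
    rw [← integral_sum_const_mul _ fun z : κ × κ => (iw z.1 z.2).mul_continuousOn cF.continuousOn]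
    refine intervalIntegral.integral_congr fun x _ => ?_
    rw [h.integral_deriv_mul_greenK hα hL, eW, Finset.sum_mul]
    exact Finset.sum_congr rfl fun z _ => by ring
  rw [integral_congr_ae_Ioc hL (h := fun x => g x * (1 / 2 * (∑ k, peakon α L (P k) (Q k) x) ^ 2)
    + g x * greenConv α L W x) (hφ.mono fun x hx => by rw [hx, flux, mul_add]),
    intervalIntegral.integral_add iu i1, e1, e2, e3]
  -- symmetrize the double sum
  have key : ∀ k l, P k * P l * (1 / 2) * (∫ x in (0 : ℝ)..L, g x * (greenK α L (x - Q k)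
        * greenK α L (x - Q l))) + 1 / α * (P k * P l * ∫ x in (0 : ℝ)..L, w k l x * F' x)
      = 1 / 2 * (F' (Q k) * P k * (P l * greenK α L (Q k - Q l))
          - F (Q k) * P k * (P l * greenKx α L (Q k - Q l)))
        + 1 / 2 * (F' (Q l) * P l * (P k * greenK α L (Q l - Q k))
          - F (Q l) * P l * (P k * greenKx α L (Q l - Q k))) := by
    intro k l
    have e := h.integral_flux_pair hα hL (Q k) (Q l)
    have s1 : greenK α L (Q l - Q k) = greenK α L (Q k - Q l) := by
      rw [← greenK_neg hL, neg_sub]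
    have s2 : greenKx α L (Q l - Q k) = -greenKx α L (Q k - Q l) := by
      rw [← greenKx_neg hL, neg_sub]
    rw [s1, s2]
    linear_combination (P k * P l) * e
  rw [Finset.mul_sum, ← Finset.sum_add_distrib, Finset.sum_congr rfl fun z _ => key z.1 z.2,
    Fintype.sum_prod_type]
  simp only [Finset.sum_add_distrib]
  rw [Finset.sum_comm (f := fun k l => 1 / 2 * (F' (Q l) * P l * (P k * greenK α L (Q l - Q k))
          - F (Q l) * P l * (P k * greenKx α L (Q l - Q k)))), ← Finset.sum_add_distrib]
  refine Finset.sum_congr rfl fun k _ => ?_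
  rw [← Finset.sum_add_distrib, Finset.mul_sum, Finset.mul_sum, ← Finset.sum_sub_distrib]
  exact Finset.sum_congr rfl fun l _ => by ring

/-- A superposition of peakons belongs to `H¹`. -/
lemma hasPeriodicWeakDeriv_sum_peakon (hα : 0 < α) (hL : 0 < L) (P Q : κ → ℝ) :
    HasPeriodicWeakDeriv L (fun y => ∑ k, peakon α L (P k) (Q k) y) (multiPeakonDeriv α L P Q) := by
  have : IsFiniteMeasure (volume.restrict (Set.Ioc 0 L)) := ⟨by simp⟩
  obtain ⟨C, hC0, hC⟩ := abs_greenK_le (α := α) hL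
  obtain ⟨D, hD0, hD⟩ := abs_greenKx_le (α := α) hL
  refine ⟨?_, ?_, fun ψ hψ hψp => ?_⟩
  · refine memLp_finsetSum _ fun k _ => MemLp.const_mul ?_ _
    exact MemLp.of_bound (continuous_greenK_sub hL (Q k)).aestronglyMeasurable C
      (ae_of_all _ fun x => hC _)
  · refine memLp_finsetSum _ fun k _ => MemLp.const_mul ?_ _
    exact MemLp.of_bound (measurable_greenKx_sub (Q k)).aestronglyMeasurable D
      (ae_of_all _ fun x => hD _)
  · have hd : ∀ x, HasDerivAt ψ (deriv ψ x) x := fun x =>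
      (hψ.differentiable (by simp) x).hasDerivAt
    have hdc : Continuous (deriv ψ) := hψ.continuous_deriv (by simp)
    have hprim : IsPeriodicPrimitive L ψ (deriv ψ) := ⟨hψp, Periodic.deriv hψp,
      fun a b => hdc.intervalIntegrable a b, fun a b =>
        (intervalIntegral.integral_eq_sub_of_hasDerivAt (fun x _ => hd x)
          (hdc.intervalIntegrable a b)).symm⟩
    rw [intervalIntegral.integral_congr (g := fun x => ∑ k, P k * (deriv ψ x
      * greenK α L (x - Q k))) fun x _ => by
        simp only [peakon, Finset.sum_mul]
        exact Finset.sum_congr rfl fun k _ => by ring,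
      integral_sum_const_mul P (f := fun k x => deriv ψ x * greenK α L (x - Q k)) fun k =>
        (hdc.mul (continuous_greenK_sub hL (Q k))).intervalIntegrable _ _,
      intervalIntegral.integral_congr (f := fun x => multiPeakonDeriv α L P Q x * ψ x)
        (g := fun x => ∑ k, P k * (ψ x * greenKx α L (x - Q k))) fun x _ => by
        simp only [multiPeakonDeriv, Finset.sum_mul]
        exact Finset.sum_congr rfl fun k _ => by ring,
      integral_sum_const_mul P fun k => (intervalIntegrable_greenKx hL (Q k) 0 L).continuousOn_mul
        hprim.continuous.continuousOn, ← Finset.sum_neg_distrib]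
    refine Finset.sum_congr rfl fun k _ => ?_
    rw [integral_mul_greenKx hL hψp]
    have := hprim.integral_deriv_mul_greenK hα hL (Q k)
    rw [← this]
    ring

end Peakons

/-! ### The Stratonovich equation for sums `∑ₖ pₖ F(qₖ)` -/

section Transport

set_option linter.unusedSectionVars false

variable {Ω : Type*} [mΩ : MeasurableSpace Ω] {ℱ : Filtration ℝ≥0 mΩ} {μ : Measure Ω}
  {τ : Ω → WithTop ℝ≥0} {T : ℝ≥0} {X Y Z W I : ℝ≥0 → Ω → ℝ} {b b' : ℝ≥0 → Ω → ℝ}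
  {ι κ : Type*} [Fintype ι] [Fintype κ]

lemma IsContAdapted.isDrift [IsProbabilityMeasure μ] (hX : IsContAdapted ℱ X) :
    IsDrift ℱ μ X where
  progressive := hX.adapted.isStronglyProgressive_of_continuous hX.cont
  integrable ω _ _ := (hX.continuous_real ω).intervalIntegrable _ _
  bounded T _ hη := hX.exists_bound T hη

/-- The function `g` may be discontinuous, like `K'`. -/
lemma IsContAdapted.isDrift_comp (hX : IsContAdapted ℱ X) {g : ℝ → ℝ} (hg : Measurable g) {C : ℝ}
    (hC : ∀ x, |g x| ≤ C) : IsDrift ℱ μ (fun t ω => g (X t ω)) where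
  progressive i := (hg.comp
    ((hX.adapted.isStronglyProgressive_of_continuous hX.cont) i).measurable).stronglyMeasurable
  integrable ω := intervalIntegrable_of_abs_le
    (hg.comp (hX.continuous_real ω).measurable) fun _ => hC _
  bounded T η hη := ⟨|C| + 1, by positivity, by
    have : ∀ t ω, |g (X t ω)| ≤ |C| + 1 := fun t ω => (hC _).trans (by linarith [le_abs_self C])
    simp [this]⟩

lemma IsDrift.add (hb : IsDrift ℱ μ b) (hb' : IsDrift ℱ μ b') :
    IsDrift ℱ μ (fun t ω => b t ω + b' t ω) where
  progressive i := (hb.progressive i).add (hb'.progressive i)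
  integrable ω r s := (hb.integrable ω r s).add (hb'.integrable ω r s)
  bounded T η hη := by
    obtain ⟨C, hC, h⟩ := hb.bounded T _ (ENNReal.half_pos hη.ne')
    obtain ⟨C', hC', h'⟩ := hb'.bounded T _ (ENNReal.half_pos hη.ne')
    exact ⟨C + C', by positivity, measure_not_le_of_and h h' fun ω g g' s hs =>
      (abs_add_le _ _).trans (add_le_add (g s hs) (g' s hs))⟩

lemma IsDrift.mul_left [IsProbabilityMeasure μ] (hZ : IsContAdapted ℱ Z) (hb : IsDrift ℱ μ b) :
    IsDrift ℱ μ (fun t ω => Z t ω * b t ω) where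
  progressive := (hZ.adapted.isStronglyProgressive_of_continuous hZ.cont).mul hb.progressive
  integrable ω r s := (hb.integrable ω r s).continuousOn_mul (hZ.continuous_real ω).continuousOn
  bounded T η hη := by
    obtain ⟨C, hC, h⟩ := hZ.exists_bound (μ := μ) T (ENNReal.half_pos hη.ne')
    obtain ⟨C', hC', h'⟩ := hb.bounded T _ (ENNReal.half_pos hη.ne')
    refine ⟨C * C', by positivity, measure_not_le_of_and h h' fun ω g g' s hs => ?_⟩
    rw [abs_mul]
    exact mul_le_mul (g s hs) (g' s hs) (abs_nonneg _) hC.le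

lemma IsDrift.sum [IsProbabilityMeasure μ] {s : Finset κ} {b : κ → ℝ≥0 → Ω → ℝ}
    (hb : ∀ k, IsDrift ℱ μ (b k)) : IsDrift ℱ μ (fun t ω => ∑ k ∈ s, b k t ω) := by
  classical
  induction s using Finset.induction_on with
  | empty => simpa using (isContAdapted_const (ℱ := ℱ) 0).isDrift
  | insert a s ha ih => simpa only [Finset.sum_insert ha] using (hb a).add ih

lemma HasBddQV.neg (hX : HasBddQV μ X) : HasBddQV μ (fun t ω => -X t ω) := fun T =>
  (hX T).of_abs_le <| Eventually.of_forall fun i ω t _ => le_of_eq <| congrArg _ <|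
    Finset.sum_congr rfl fun n _ => by simp only [incr]; ring

lemma trapSum_add (Y Z W : ℝ≥0 → Ω → ℝ) (N : ℕ) (σ : ℕ → ℝ≥0) (t : ℝ≥0) (ω : Ω) :
    trapSum (fun t ω => Y t ω + Z t ω) W N σ t ω = trapSum Y W N σ t ω + trapSum Z W N σ t ω := by
  simp only [trapSum, leftSum, covSum, Finset.mul_sum, ← Finset.sum_add_distrib]
  exact Finset.sum_congr rfl fun n _ => by ring

lemma trapSum_neg (Y W : ℝ≥0 → Ω → ℝ) (N : ℕ) (σ : ℕ → ℝ≥0) (t : ℝ≥0) (ω : Ω) :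
    trapSum (fun t ω => -Y t ω) W N σ t ω = -trapSum Y W N σ t ω := by
  simp only [trapSum, leftSum, covSum, Finset.mul_sum, ← Finset.sum_add_distrib,
    ← Finset.sum_neg_distrib]
  exact Finset.sum_congr rfl fun n _ => by ring

lemma trapSum_sum (s : Finset κ) (Y : κ → ℝ≥0 → Ω → ℝ) (W : ℝ≥0 → Ω → ℝ) (N : ℕ) (σ : ℕ → ℝ≥0)
    (t : ℝ≥0) (ω : Ω) :
    trapSum (fun t ω => ∑ k ∈ s, Y k t ω) W N σ t ω = ∑ k ∈ s, trapSum (Y k) W N σ t ω := by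
  classical
  induction s using Finset.induction_on with
  | empty => simp [trapSum, leftSum, covSum]
  | insert a s ha ih => simp only [Finset.sum_insert ha, trapSum_add, ih]

/-- The Stratonovich integral is the limit of the trapezoidal sums; before `τ`, these only depend on
the integrand before `τ`. -/
lemma IsStratonovichIntegral.small_trapSum_sub (h : IsStratonovichIntegral ℱ μ τ Y W I)
    (hZ : ∀ (t : ℝ≥0) ω, (t : WithTop ℝ≥0) ≤ τ ω → Z t ω = Y t ω) (T : ℝ≥0) :
    Small μ τ T (fun i t ω => trapSum Z W i.2.1 i.2.2 t ω - I t ω) := by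
  obtain ⟨J, C, hJ, hC, hI⟩ := h
  refine ((hJ.2.small T).add ((hC.small T).mul_bdd (bdd_const (1 / 2)))).congr <|
    Eventually.of_forall fun i ω t ht => ?_
  have e : ∀ s, Z (min s t) ω = Y (min s t) ω := fun s => hZ _ _ (min_mem_horizon ht).2
  simp only [trapSum, leftSum, covSum, e, hI]
  ring

/-- The Stratonovich integrals of `∑ₖ pₖ g(qₖ)` exist, for `g` of class `C¹`. -/
lemma exists_isStratonovichIntegral [IsProbabilityMeasure μ] {p q : κ → ℝ≥0 → Ω → ℝ}
    (hp : ∀ k, IsGoodIntegrator ℱ μ (stoppedProcess (p k) τ))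
    (hq : ∀ k, IsGoodIntegrator ℱ μ (stoppedProcess (q k) τ)) (hW : IsGoodIntegrator ℱ μ W)
    {g : ℝ → ℝ} (hg : ContDiff ℝ 1 g) :
    ∃ I, IsStratonovichIntegral ℱ μ τ (fun t ω => ∑ k, p k t ω * g (q k t ω)) W I := by
  have hY : IsContAdapted ℱ
      (stoppedProcess (fun t ω => ∑ k, p k t ω * g (q k t ω)) τ) :=
    IsContAdapted.sum fun k => (hp k).toIsContAdapted.mul
      ((hq k).toIsContAdapted.comp hg.continuous)
  have e : ∀ (t : ℝ≥0) ω, (t : WithTop ℝ≥0) ≤ τ ω → ∀ s,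
      (fun t ω => ∑ k, p k t ω * g (q k t ω)) (min s t) ω
        = stoppedProcess (fun t ω => ∑ k, p k t ω * g (q k t ω)) τ (min s t) ω := fun t ω ht s =>
    (stoppedProcess_eq_of_le (u := fun t ω => ∑ k, p k t ω * g (q k t ω))
      ((WithTop.coe_le_coe.2 (min_le_right s t)).trans ht)).symm
  obtain ⟨J, hJ⟩ := hW.exists_tendstoUcp_leftSum hY
  choose C hC using fun k => exists_tendstoUcp_covSum (hp k) (hq k) hW hg
  refine ⟨_, J, _, ⟨⟨hY.adapted, hY.cont⟩, hJ.of_top.congr fun N σ t ω _ ht => ?_⟩,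
    (tendstoUcp_sum (s := Finset.univ) hC).of_top.congr fun N σ t ω _ ht => ?_, fun t ω => rfl⟩
  · simp only [leftSum, e t ω ht]
  · simp only [covSum]
    rw [Finset.sum_comm]
    refine Finset.sum_congr rfl fun n _ => ?_
    rw [← Finset.sum_mul, Finset.sum_sub_distrib]
    have e' := e t ω ht
    beta_reduce at e'
    rw [e', e']
    rfl

lemma Small.congr_ae {S S' : GridIndex → ℝ≥0 → Ω → ℝ} (hS : Small μ τ T S')
    (h : ∀ᵐ ω ∂μ, ∀ i, ∀ t ∈ horizon τ T ω, S i t ω = S' i t ω) : Small μ τ T S :=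
  fun ε hε η hη => by
  filter_upwards [hS ε hε η hη] with i hi
  refine (measure_mono_ae ?_).trans hi
  filter_upwards [h] with ω hω h1 h2
  exact h1 fun t ht => by rw [hω i t ht]; exact h2 t ht

/-- A single process which is small in probability vanishes almost surely. -/
lemma ae_eq_zero_of_small {D : ℝ≥0 → Ω → ℝ} (h : ∀ T, Small μ τ T (fun _ => D)) :
    ∀ᵐ ω ∂μ, ∀ t : ℝ≥0, (t : WithTop ℝ≥0) ≤ τ ω → D t ω = 0 := by
  have h0 : ∀ n m : ℕ, ∀ᵐ ω ∂μ, ∀ t ∈ horizon τ n ω, |D t ω| < 1 / (m + 1) := fun n m => by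
    refine nonpos_iff_eq_zero.1 (le_of_forall_gt_imp_ge_of_dense fun η hη => ?_)
    obtain ⟨i, hi⟩ := (eventually_gridFilter_iff.1
      (h n (1 / (m + 1)) (by positivity) η hη)).exists
    exact hi.exists.choose_spec
  filter_upwards [ae_all_iff.2 fun n => ae_all_iff.2 (h0 n)] with ω hω t ht
  obtain ⟨n, hn⟩ := exists_nat_ge t
  refine abs_eq_zero.1 (le_antisymm (le_of_forall_gt_imp_ge_of_dense fun ε hε => ?_)
    (abs_nonneg _))
  obtain ⟨m, hm⟩ := exists_nat_one_div_lt hε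
  exact ((hω n m t ⟨hn, ht⟩).trans hm).le

/-- If `(pₖ, qₖ)` solve `dpₖ = βₖ dt - ∑ⱼ pₖ Ξⱼ'(qₖ) ∘ dWⱼ` and `dqₖ = γₖ dt + ∑ⱼ Ξⱼ(qₖ) ∘ dWⱼ`,
then `∑ₖ pₖ F(qₖ)` has drift `∑ₖ (F(qₖ) βₖ + pₖ F'(qₖ) γₖ)` and noise coefficients
`-∑ₖ pₖ (Ξⱼ' F - Ξⱼ F')(qₖ)`, at the level of sums. -/
lemma small_sum_mul_comp_sub [IsProbabilityMeasure μ] {p q β γ : κ → ℝ≥0 → Ω → ℝ}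
    (hp : ∀ k, IsGoodIntegrator ℱ μ (p k)) (hq : ∀ k, IsGoodIntegrator ℱ μ (q k))
    (hβ : ∀ k, IsDrift ℱ μ (β k)) (hγ : ∀ k, IsDrift ℱ μ (γ k))
    {W : ι → ℝ≥0 → Ω → ℝ} (hW : ∀ j, IsGoodIntegrator ℱ μ (W j))
    {Ξ : ι → ℝ → ℝ} (hΞ : ∀ j, ContDiff ℝ 2 (Ξ j)) {F : ℝ → ℝ} (hF : ContDiff ℝ 2 F)
    (hEp : ∀ k, Small μ τ T (fun i t ω => p k t ω - p k 0 ω - timeInt (β k) t ω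
      - ∑ j, trapSum (fun t ω => -(p k t ω * deriv (Ξ j) (q k t ω))) (W j) i.2.1 i.2.2 t ω))
    (hEq : ∀ k, Small μ τ T (fun i t ω => q k t ω - q k 0 ω - timeInt (γ k) t ω
      - ∑ j, trapSum (fun t ω => Ξ j (q k t ω)) (W j) i.2.1 i.2.2 t ω)) :
    Small μ τ T (fun i t ω => ∑ k, p k t ω * F (q k t ω) - ∑ k, p k 0 ω * F (q k 0 ω)
      - (∫ s in (0 : ℝ)..t, ∑ k, (F (q k s.toNNReal ω) * β k s.toNNReal ω
          + p k s.toNNReal ω * deriv F (q k s.toNNReal ω) * γ k s.toNNReal ω))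
      + ∑ j, trapSum (fun t ω => ∑ k, p k t ω * (deriv (Ξ j) (q k t ω) * F (q k t ω)
          - Ξ j (q k t ω) * deriv F (q k t ω))) (W j) i.2.1 i.2.2 t ω) := by
  have hF1 := ContDiff.deriv_of_two hF
  have hΞ1 : ∀ j, ContDiff ℝ 1 (Ξ j) := fun j => (hΞ j).of_le one_le_two
  have hΞd := fun j => ContDiff.deriv_of_two (hΞ j)
  have cp := fun k => (hp k).toIsContAdapted
  have cq := fun k => (hq k).toIsContAdapted
  have cc : ∀ k {f : ℝ → ℝ}, ContDiff ℝ 1 f → IsContAdapted ℱ (fun t ω => f (q k t ω)) :=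
    fun k _ hf => (cq k).comp hf.continuous
  have qc : ∀ k {f : ℝ → ℝ}, ContDiff ℝ 1 f → HasBddQV μ (fun t ω => f (q k t ω)) :=
    fun k _ hf => (hq k).hasBddQV.comp hf (cq k)
  have qpc : ∀ k {f : ℝ → ℝ}, ContDiff ℝ 1 f → HasBddQV μ (fun t ω => p k t ω * f (q k t ω)) :=
    fun k _ hf => HasBddQV.mul (cp k) (hp k).hasBddQV (cc k hf) (qc k hf)
  have hF2 : ContDiff ℝ 1 F := hF.of_le one_le_two
  have s1 := fun k => small_mul_comp_sub_trapSum (μ := μ) (τ := τ) (T := T) (hp k) (hq k) hF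
  have s2 := fun k => small_trapSum_sub (hp k) (hβ k)
    (V := fun j t ω => -(p k t ω * deriv (Ξ j) (q k t ω)))
    (fun j => ((cp k).mul (cc k (hΞd j))).neg)
    (fun j => (qpc k (hΞd j)).neg)
    hW (hEp k) (cc k hF2) (qc k hF2)
  have s3 := fun k => small_trapSum_sub (hq k) (hγ k) (V := fun j t ω => Ξ j (q k t ω))
    (fun j => cc k (hΞ1 j)) (fun j => qc k (hΞ1 j)) hW (hEq k) ((cp k).mul (cc k hF1))
    (qpc k hF1)
  refine (Small.sum (s := Finset.univ) fun k => ((s1 k).add (s2 k)).add (s3 k)).congr <|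
    Eventually.of_forall fun i ω t _ => ?_
  have i1 : ∀ k, IntervalIntegrable (fun s : ℝ => F (q k s.toNNReal ω) * β k s.toNNReal ω)
      volume 0 t := fun k => (IsDrift.mul_left (cc k hF2) (hβ k)).integrable ω 0 t
  have i2 : ∀ k, IntervalIntegrable (fun s : ℝ => p k s.toNNReal ω
      * deriv F (q k s.toNNReal ω) * γ k s.toNNReal ω) volume 0 t := fun k =>
    (IsDrift.mul_left ((cp k).mul (cc k hF1)) (hγ k)).integrable ω 0 t
  have e1 : ∫ s in (0 : ℝ)..t, ∑ k, (F (q k s.toNNReal ω) * β k s.toNNReal ω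
        + p k s.toNNReal ω * deriv F (q k s.toNNReal ω) * γ k s.toNNReal ω)
      = ∑ k, ((∫ s in (0 : ℝ)..t, F (q k s.toNNReal ω) * β k s.toNNReal ω)
        + ∫ s in (0 : ℝ)..t, p k s.toNNReal ω * deriv F (q k s.toNNReal ω) * γ k s.toNNReal ω) := by
    rw [intervalIntegral.integral_finsetSum fun k _ => (i1 k).add (i2 k)]
    exact Finset.sum_congr rfl fun k _ => intervalIntegral.integral_add (i1 k) (i2 k)
  have e2 : ∀ j, trapSum (fun t ω => ∑ k, p k t ω * (deriv (Ξ j) (q k t ω) * F (q k t ω)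
        - Ξ j (q k t ω) * deriv F (q k t ω))) (W j) i.2.1 i.2.2 t ω
      = -∑ k, (trapSum (fun t ω => F (q k t ω) * -(p k t ω * deriv (Ξ j) (q k t ω)))
          (W j) i.2.1 i.2.2 t ω
        + trapSum (fun t ω => p k t ω * deriv F (q k t ω) * Ξ j (q k t ω))
          (W j) i.2.1 i.2.2 t ω) := fun j => by
    simp only [← trapSum_add, ← trapSum_sum, ← trapSum_neg, ← Finset.sum_neg_distrib]
    congr 1
    funext t ω
    exact Finset.sum_congr rfl fun k _ => by ring
  rw [e1, Finset.sum_congr rfl fun j _ => e2 j, Finset.sum_neg_distrib, Finset.sum_comm]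
  simp only [Finset.sum_add_distrib, Finset.sum_sub_distrib]
  ring

end Transport

/-! ### The equation for the pairings of a multi-peakon -/

section Peakons

set_option linter.unusedSectionVars false

variable {Ω : Type*} [mΩ : MeasurableSpace Ω] {ℱ : Filtration ℝ≥0 mΩ} {μ : Measure Ω}
  {τ : Ω → WithTop ℝ≥0} {T : ℝ≥0} {ι κ : Type*} [Fintype ι] [Fintype κ]
  {α L : ℝ} {Ξ : ι → ℝ → ℝ} {W : ι → ℝ≥0 → Ω → ℝ} {p q : κ → ℝ≥0 → Ω → ℝ}

lemma integral_stoppedProcess_eq {ω : Ω} {t : ℝ≥0} (ht : (t : WithTop ℝ≥0) ≤ τ ω)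
    (f : (κ → ℝ) → (κ → ℝ) → ℝ) :
    ∫ s in (0 : ℝ)..t, f (fun k => stoppedProcess (p k) τ s.toNNReal ω)
        (fun k => stoppedProcess (q k) τ s.toNNReal ω)
      = ∫ s in (0 : ℝ)..t, f (fun k => p k s.toNNReal ω) (fun k => q k s.toNNReal ω) := by
  refine intervalIntegral.integral_congr fun s hs => ?_
  rw [Set.uIcc_of_le (NNReal.coe_nonneg t)] at hs
  have h : ((s.toNNReal : ℝ≥0) : WithTop ℝ≥0) ≤ τ ω :=
    (WithTop.coe_le_coe.2 (Real.toNNReal_le_iff_le_coe.2 hs.2)).trans ht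
  simp only [stoppedProcess_eq_of_le h]

/-- The drift `-pₖ ∑ₗ pₗ K'(qₖ - qₗ)` of the `k`-th momentum. -/
def momentumDrift (α L : ℝ) (p q : κ → ℝ≥0 → Ω → ℝ) (k : κ) (t : ℝ≥0) (ω : Ω) : ℝ :=
  ∑ l, -(p k t ω * p l t ω) * greenKx α L (q k t ω - q l t ω)

/-- The drift `∑ₗ pₗ K(qₖ - qₗ)` of the `k`-th position. -/
def positionDrift (α L : ℝ) (p q : κ → ℝ≥0 → Ω → ℝ) (k : κ) (t : ℝ≥0) (ω : Ω) : ℝ :=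
  ∑ l, p l t ω * greenK α L (q k t ω - q l t ω)

lemma isDrift_momentumDrift [IsProbabilityMeasure μ] (hL : 0 < L)
    (hp : ∀ k, IsContAdapted ℱ (p k)) (hq : ∀ k, IsContAdapted ℱ (q k)) (k : κ) :
    IsDrift ℱ μ (momentumDrift α L p q k) := by
  obtain ⟨C, -, hC⟩ := abs_greenKx_le (α := α) hL
  exact IsDrift.sum fun l => IsDrift.mul_left ((hp k).mul (hp l)).neg
    (((hq k).sub (hq l)).isDrift_comp measurable_greenKx hC)

lemma isContAdapted_positionDrift (hL : 0 < L)
    (hp : ∀ k, IsContAdapted ℱ (p k)) (hq : ∀ k, IsContAdapted ℱ (q k)) (k : κ) :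
    IsContAdapted ℱ (positionDrift α L p q k) :=
  IsContAdapted.sum fun l => (hp l).mul (((hq k).sub (hq l)).comp (continuous_greenK hL))

/-- The equation of the `k`-th momentum, in terms of trapezoidal sums. -/
lemma IsPeakonSolution.small_momentum (h : IsPeakonSolution ℱ μ α L Ξ W τ p q) (k : κ) :
    Small μ τ T (fun i t ω => stoppedProcess (p k) τ t ω - stoppedProcess (p k) τ 0 ω
      - timeInt (momentumDrift α L (fun k => stoppedProcess (p k) τ)
          (fun k => stoppedProcess (q k) τ) k) t ω
      - ∑ j, trapSum (fun t ω => -(stoppedProcess (p k) τ t ω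
          * deriv (Ξ j) (stoppedProcess (q k) τ t ω))) (W j) i.2.1 i.2.2 t ω) := by
  obtain ⟨I, hI, hae⟩ := h.momentum k
  refine (Small.sum (s := Finset.univ) fun j => (hI j).small_trapSum_sub
    (Z := fun t ω => stoppedProcess (p k) τ t ω * deriv (Ξ j) (stoppedProcess (q k) τ t ω))
    (fun t ω ht => by simp only [stoppedProcess_eq_of_le ht]) T).congr_ae ?_
  filter_upwards [hae] with ω hω i t ht
  have h0 : ((0 : ℝ≥0) : WithTop ℝ≥0) ≤ τ ω := bot_le
  have e : timeInt (momentumDrift α L (fun k => stoppedProcess (p k) τ)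
      (fun k => stoppedProcess (q k) τ) k) t ω = -∫ s in (0 : ℝ)..t, p k s.toNNReal ω *
        ∑ l, p l s.toNNReal ω * greenKx α L (q k s.toNNReal ω - q l s.toNNReal ω) := by
    rw [← integral_stoppedProcess_eq ht.2 fun P Q => P k * ∑ l, P l * greenKx α L (Q k - Q l),
      ← intervalIntegral.integral_neg]
    refine intervalIntegral.integral_congr fun s _ => ?_
    simp only [momentumDrift, Finset.mul_sum, ← Finset.sum_neg_distrib]
    exact Finset.sum_congr rfl fun l _ => by ring
  rw [stoppedProcess_eq_of_le ht.2, stoppedProcess_eq_of_le h0, e, hω t ht.2]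
  simp only [trapSum_neg, Finset.sum_neg_distrib, Finset.sum_sub_distrib]
  ring

/-- The equation of the `k`-th position, in terms of trapezoidal sums. -/
lemma IsPeakonSolution.small_position (h : IsPeakonSolution ℱ μ α L Ξ W τ p q) (k : κ) :
    Small μ τ T (fun i t ω => stoppedProcess (q k) τ t ω - stoppedProcess (q k) τ 0 ω
      - timeInt (positionDrift α L (fun k => stoppedProcess (p k) τ)
          (fun k => stoppedProcess (q k) τ) k) t ω
      - ∑ j, trapSum (fun t ω => Ξ j (stoppedProcess (q k) τ t ω)) (W j) i.2.1 i.2.2 t ω) := by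
  obtain ⟨I, hI, hae⟩ := h.position k
  refine (Small.sum (s := Finset.univ) fun j => (hI j).small_trapSum_sub
    (Z := fun t ω => Ξ j (stoppedProcess (q k) τ t ω))
    (fun t ω ht => by simp only [stoppedProcess_eq_of_le ht]) T).neg.congr_ae ?_
  filter_upwards [hae] with ω hω i t ht
  have h0 : ((0 : ℝ≥0) : WithTop ℝ≥0) ≤ τ ω := bot_le
  have e : timeInt (positionDrift α L (fun k => stoppedProcess (p k) τ)
      (fun k => stoppedProcess (q k) τ) k) t ω = ∫ s in (0 : ℝ)..t,
        ∑ l, p l s.toNNReal ω * greenK α L (q k s.toNNReal ω - q l s.toNNReal ω) :=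
    integral_stoppedProcess_eq ht.2 fun P Q => ∑ l, P l * greenK α L (Q k - Q l)
  rw [stoppedProcess_eq_of_le ht.2, stoppedProcess_eq_of_le h0, e, hω t ht.2]
  simp only [Finset.sum_sub_distrib]
  ring

/-- Tested against `φ`, the peakon equations become the equation
`d∑ₖ pₖ F(qₖ) = (∫ φₓ flux) dt - ∑ⱼ (∫ φ noiseCoeff) ∘ dWʲ`, where `F` is the pairing of `φ` with
a unit peakon. -/
theorem isWeakSolution_multiPeakon [IsProbabilityMeasure μ] (hα : 0 < α) (hL : 0 < L)
    (hΞ : ∀ j, ContDiff ℝ 2 (Ξ j)) (hΞL : ∀ j, Function.Periodic (Ξ j) L)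
    (hW : ∀ j, IsFiltrationBrownian ℱ μ (W j)) (h : IsPeakonSolution ℱ μ α L Ξ W τ p q) :
    IsWeakSolution ℱ μ α L Ξ W τ (multiPeakon α L p q) := by
  refine ⟨fun t ω => multiPeakonDeriv α L (fun k => p k t ω) (fun k => q k t ω),
    fun t ω _ => hasPeriodicWeakDeriv_sum_peakon hα hL _ _, fun φ φx hφ => ?_⟩
  obtain ⟨Φ, g, hΦ, hφΦ, hφg⟩ := hφ.exists_primitive hL
  have hp := fun k => (h.semimartingale_p k).isGoodIntegrator
  have hq := fun k => (h.semimartingale_q k).isGoodIntegrator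
  have cp := fun k => (hp k).toIsContAdapted
  have cq := fun k => (hq k).toIsContAdapted
  have hWg := fun j => (hW j).isGoodIntegrator
  set F := pairing α L Φ with hF
  have hF2 : ContDiff ℝ 2 F := contDiff_pairing hα hL hΦ.continuous hΦ.periodic
  have hdF : deriv F = pairingDeriv α L Φ := deriv_pairing hα hL hΦ.continuous hΦ.periodic
  have hF1 := ContDiff.deriv_of_two hF2
  set G : (κ → ℝ) → (κ → ℝ) → ℝ := fun P Q =>
    ∑ k, (F (Q k) * (∑ l, -(P k * P l) * greenKx α L (Q k - Q l))
      + P k * deriv F (Q k) * ∑ l, P l * greenK α L (Q k - Q l)) with hG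
  have eU : ∀ t ω, ∫ x in (0 : ℝ)..L, φ x * multiPeakon α L p q t ω x
      = ∑ k, p k t ω * F (q k t ω) := fun t ω => integral_mul_sum_peakon hL hΦ hφΦ _ _
  have eG : ∀ P Q : κ → ℝ, ∫ x in (0 : ℝ)..L, φx x * flux α L
      (fun y => ∑ k, peakon α L (P k) (Q k) y) (multiPeakonDeriv α L P Q) x = G P Q := by
    intro P Q
    rw [integral_mul_flux hα hL hΦ hφg]
    refine Finset.sum_congr rfl fun k _ => ?_
    rw [hdF, show ∑ l, -(P k * P l) * greenKx α L (Q k - Q l)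
      = -(P k * ∑ l, P l * greenKx α L (Q k - Q l)) by
        rw [Finset.mul_sum, ← Finset.sum_neg_distrib]
        exact Finset.sum_congr rfl fun l _ => by ring]
    ring
  have eN : ∀ j, (fun t ω => ∫ x in (0 : ℝ)..L, φ x * noiseCoeff α L (Ξ j)
      (multiPeakon α L p q t ω) (multiPeakonDeriv α L (fun k => p k t ω) (fun k => q k t ω)) x)
      = fun t ω => ∑ k, p k t ω * (deriv (Ξ j) (q k t ω) * F (q k t ω)
          - Ξ j (q k t ω) * deriv F (q k t ω)) := fun j => by
    funext t ω
    rw [hdF]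
    exact integral_mul_noiseCoeff hα hL (hΞ j) (hΞL j) hΦ hφΦ _ _
  have hgj : ∀ j, ContDiff ℝ 1 fun y => deriv (Ξ j) y * F y - Ξ j y * deriv F y := fun j =>
    ((ContDiff.deriv_of_two (hΞ j)).mul (hF2.of_le one_le_two)).sub
      (((hΞ j).of_le one_le_two).mul hF1)
  have hiG : ∀ ω (t : ℝ≥0), IntervalIntegrable (fun s : ℝ =>
      G (fun k => stoppedProcess (p k) τ s.toNNReal ω)
        (fun k => stoppedProcess (q k) τ s.toNNReal ω)) volume 0 t := fun ω t =>
    (IsDrift.sum (μ := μ) fun k => (IsDrift.mul_left ((cq k).comp hF2.continuous)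
      (isDrift_momentumDrift (α := α) hL cp cq k)).add
      (((cp k).mul ((cq k).comp hF1.continuous)).mul
        (isContAdapted_positionDrift (α := α) hL cp cq k)).isDrift).integrable ω 0 t
  refine ⟨?_, fun t ω ht => ?_, ?_⟩
  · simp only [eU]
    have hc : IsContAdapted ℱ (stoppedProcess (fun t ω => ∑ k, p k t ω * F (q k t ω)) τ) :=
      IsContAdapted.sum fun k => (cp k).mul ((cq k).comp hF2.continuous)
    exact ⟨hc.adapted, hc.cont⟩
  · refine (hiG ω t).congr fun s hs => ?_
    rw [Set.uIoc_of_le (NNReal.coe_nonneg t)] at hs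
    have hs' : ((s.toNNReal : ℝ≥0) : WithTop ℝ≥0) ≤ τ ω :=
      (WithTop.coe_le_coe.2 (Real.toNNReal_le_iff_le_coe.2 hs.2)).trans ht
    simp only [stoppedProcess_eq_of_le hs']
    exact (eG _ _).symm
  choose I hI using fun j => exists_isStratonovichIntegral hp hq (hWg j) (hgj j)
  refine ⟨I, fun j => ?_, ?_⟩
  · rw [eN]
    exact hI j
  have hS := fun T => small_sum_mul_comp_sub (T := T) hp hq
    (isDrift_momentumDrift (α := α) hL cp cq)
    (fun k => (isContAdapted_positionDrift (α := α) hL cp cq k).isDrift) hWg hΞ hF2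
    h.small_momentum h.small_position
  have hI' := fun T j => (hI j).small_trapSum_sub (Z := fun t ω => ∑ k,
    stoppedProcess (p k) τ t ω * (deriv (Ξ j) (stoppedProcess (q k) τ t ω)
      * F (stoppedProcess (q k) τ t ω) - Ξ j (stoppedProcess (q k) τ t ω)
      * deriv F (stoppedProcess (q k) τ t ω)))
    (fun t ω ht => by simp only [stoppedProcess_eq_of_le ht]) T
  have hae := ae_eq_zero_of_small (D := fun t ω =>
    ∑ k, p k t ω * F (q k t ω) - ∑ k, p k 0 ω * F (q k 0 ω)
      - (∫ s in (0 : ℝ)..t, G (fun k => p k s.toNNReal ω) (fun k => q k s.toNNReal ω))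
      + ∑ j, I j t ω) fun T =>
    ((hS T).sub (Small.sum (s := Finset.univ) (hI' T))).congr <|
      Eventually.of_forall fun i ω t ht => by
        have h0 : ((0 : ℝ≥0) : WithTop ℝ≥0) ≤ τ ω := bot_le
        rw [← integral_stoppedProcess_eq ht.2 G]
        simp only [stoppedProcess_eq_of_le ht.2, stoppedProcess_eq_of_le h0,
          Finset.sum_sub_distrib]
        simp only [hG, momentumDrift, positionDrift]
        ring
  have hφi := (hφ.intervalIntegrable hL).1
  filter_upwards [hae] with ω hω t ht
  have hi : ∀ t, IntervalIntegrable (fun x => φ x * multiPeakon α L p q t ω x) volume 0 L :=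
    fun t => hφi.mul_continuousOn (continuous_finsetSum _ fun k _ =>
      continuous_const.mul (continuous_greenK_sub hL (q k t ω))).continuousOn
  have eI : ∫ s in (0 : ℝ)..t, ∫ x in (0 : ℝ)..L, φx x * flux α L (multiPeakon α L p q s.toNNReal ω)
        (multiPeakonDeriv α L (fun k => p k s.toNNReal ω) (fun k => q k s.toNNReal ω)) x
      = ∫ s in (0 : ℝ)..t, G (fun k => p k s.toNNReal ω) (fun k => q k s.toNNReal ω) :=
    intervalIntegral.integral_congr fun s _ => eG _ _
  simp only [mul_sub]
  rw [intervalIntegral.integral_sub (hi t) (hi 0), eU, eU, eI]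
  linarith [hω t ht]

/-- The convolution identity for a single peakon, in terms of genuine derivatives. -/
lemma greenConv_single_peakon (hα : 0 < α) (hL : 0 < L) {ξ : ℝ → ℝ} (hξ : ContDiff ℝ 2 ξ)
    (hξL : Function.Periodic ξ L) (P : ℝ) {Q x : ℝ} (hx : ∀ n : ℤ, x ≠ Q + n * L) :
    greenConv α L (fun y => 2 * peakon α L P Q y * deriv ξ y
        + α ^ 2 * deriv (peakon α L P Q) y * deriv (deriv ξ) y) x
      = peakon α L P Q x * deriv ξ Q + deriv (peakon α L P Q) x * ξ Q
        - deriv (peakon α L P Q) x * ξ x := by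
  have e : ∀ᵐ y : ℝ, 2 * peakon α L P Q y * deriv ξ y
      + α ^ 2 * deriv (peakon α L P Q) y * deriv (deriv ξ) y
      = ∑ _k : Unit, P * peakonSource α L ξ Q y := by
    filter_upwards [ae_ne_add_int_mul (L := L) Q] with y hy
    rw [(hasDerivAt_peakon hα hL P hy).deriv, Fintype.sum_unique, peakon, peakonSource]
    ring
  rw [greenConv_congr_ae e, greenConv_sum hL (fun _ : Unit => P) fun _ =>
    intervalIntegrable_peakonSource hL hξ Q 0 L, Fintype.sum_unique,
    greenConv_peakonSource hα hL hξ hξL hx, (hasDerivAt_peakon hα hL P hx).deriv, peakon]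
  ring

/-- The infinitesimal motion of the peaks produced by the vector field `ξ` is the noise coefficient of
the stochastic Camassa–Holm equation. -/
lemma ae_sum_peakon_sub_noiseCoeff_eq_zero (hα : 0 < α) (hL : 0 < L) {ξ : ℝ → ℝ}
    (hξ : ContDiff ℝ 2 ξ) (hξL : Function.Periodic ξ L) (P Q : κ → ℝ) :
    ∀ᵐ x : ℝ, (∑ k, (peakon α L (P k) (Q k) x * deriv ξ (Q k)
        + deriv (peakon α L (P k) (Q k)) x * ξ (Q k)))
      - noiseCoeff α L ξ (fun y => ∑ k, peakon α L (P k) (Q k) y)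
          (deriv fun y => ∑ k, peakon α L (P k) (Q k) y) x = 0 := by
  filter_upwards [noiseCoeff_eq hα hL hξ hξL P Q
      ((ae_hasDerivAt_sum_peakon hα hL P Q).mono fun x hx => hx.deriv),
    ae_all_iff.2 fun k => ae_ne_add_int_mul (L := L) (Q k)] with x hx hxQ
  rw [hx, sub_eq_zero]
  refine Finset.sum_congr rfl fun k _ => ?_
  rw [(hasDerivAt_peakon hα hL (P k) (hxQ k)).deriv, peakon]
  ring

end Peakons

end

end SCH

theorem mainTheorem1 {Ω : Type*} [mΩ : MeasurableSpace Ω]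
    (μ : Measure Ω) [IsProbabilityMeasure μ] (ℱ : Filtration ℝ≥0 mΩ)
    {ι κ : Type*} [Fintype ι] [Fintype κ]
    (α L : ℝ) (hα : 0 < α) (hL : 0 < L)
    (Ξ : ι → ℝ → ℝ) (hΞ : ∀ j, ContDiff ℝ 2 (Ξ j)) (hΞL : ∀ j, Function.Periodic (Ξ j) L)
    (W : ι → ℝ≥0 → Ω → ℝ) (hW : ∀ j, SCH.IsFiltrationBrownian ℱ μ (W j))
    (τ : Ω → WithTop ℝ≥0) (hτ : IsStoppingTime ℱ τ)
    (p q : κ → ℝ≥0 → Ω → ℝ) (hpq : SCH.IsPeakonSolution ℱ μ α L Ξ W τ p q) :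
    -- the multi-peakon is a weak solution
    SCH.IsWeakSolution ℱ μ α L Ξ W τ (SCH.multiPeakon α L p q) ∧
    -- the convolution identity for a single peakon, away from its peak
    (∀ (j : ι) (P Q x : ℝ), (∀ n : ℤ, x ≠ Q + n * L) →
      SCH.greenConv α L (fun y => 2 * SCH.peakon α L P Q y * deriv (Ξ j) y
          + α ^ 2 * deriv (SCH.peakon α L P Q) y * deriv (deriv (Ξ j)) y) x
        = SCH.peakon α L P Q x * deriv (Ξ j) Q + deriv (SCH.peakon α L P Q) x * Ξ j Q
          - deriv (SCH.peakon α L P Q) x * Ξ j x) ∧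
    -- the integrand of the stochastic part vanishes almost everywhere
    (∀ (j : ι) (P Q : κ → ℝ), ∀ᵐ x : ℝ,
      (∑ k, (SCH.peakon α L (P k) (Q k) x * deriv (Ξ j) (Q k)
          + deriv (SCH.peakon α L (P k) (Q k)) x * Ξ j (Q k)))
        - SCH.noiseCoeff α L (Ξ j) (fun y => ∑ k, SCH.peakon α L (P k) (Q k) y)
            (deriv fun y => ∑ k, SCH.peakon α L (P k) (Q k) y) x = 0) := by
  exact ⟨SCH.isWeakSolution_multiPeakon hα hL hΞ hΞL hW hpq,
    fun j P _ _ hx => SCH.greenConv_single_peakon hα hL (hΞ j) (hΞL j) P hx,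
    fun j P Q => SCH.ae_sum_peakon_sub_noiseCoeff_eq_zero hα hL (hΞ j) (hΞL j) P Q⟩
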